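/- Let $M$ be a closed (compact, without boundary) smooth CR $3$-manifold, with CR structure $J$ on a contact bundle $\xi$, such that $\mathcal Y(J)>0$, where $\mathcal Y(J)=\inf_{\theta}\int_M R_{J,\theta}\,\theta\wedge d\theta\big/\big(\int_M\theta\wedge d\theta\big)^{1/2}$ is the infimum over all contact forms $\theta$ for $(\xi,J)$ (with $\ker\theta=\xi$ and $d\theta(\cdot,J\cdot)>0$ on $\xi$) and $R$ denotes the Tanaka–Webster curvature. Conventions. For a contact form $\theta$, a unitary coframe is a local complex one-form $\theta^1$ of type $(1,0)$ with $d\theta=i\theta^1\wedge\theta^{\bar1}$; its connection form $\omega_1^1$ is determined by $d\theta^1=\theta^1\wedge\omega_1^1+A^1{}_{\bar 1}\,\theta\wedge\theta^{\bar1}$ and $\omega_1^1+\overline{\omega_1^1}=0$, and $d\omega_1^1=R\,\theta^1\wedge\theta^{\bar1}$ mod $\theta$. With $(T,Z_1,Z_{\bar1})$ the frame dual to $(\theta,\theta^1,\theta^{\bar1})$, the sublaplacian is $\Delta_bf=f_{,1\bar1}+f_{,\bar11}$, where $f_{,1\bar1}=Z_{\bar1}Z_1f-\omega_1^1(Z_{\bar1})Z_1f$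 and $f_{,\bar11}=Z_1Z_{\bar1}f+\omega_1^1(Z_1)Z_{\bar1}f$. For $(z,t)\in\mathbb C\times\mathbb R$ put $\rho^4=|z|^4+t^2$, $v=t+i|z|^2$, $\theta_0=dt+iz\,d\bar z-i\bar z\,dz$. Let $p\in M$, let $\hat\theta$ be a contact form for $(\xi,J)$, and let $(z,t)$ be smooth coordinates centred at $p$ and $\hat\theta^1$ a unitary coframe for $\hat\theta$ near $p$ such that, as $\rho\to0$, $$\hat\theta=(1+O(\rho^4))\theta_0+O(\rho^5)dz+O(\rho^5)d\bar z,\qquad \hat\theta^1=\sqrt2\,(1+O(\rho^4))dz+O(\rho^4)d\bar z+O(\rho^3)\theta_0 .$$ Let $G_p$ be the Green's function with pole $p$ of the conformal sublaplacian of $\hat\theta$, that is, $-4\Delta_bG_p+RG_p=16\,\delta_p$ in the sense of distributions with respect to $\hat\theta\wedge d\hat\theta$, with $G_p$ smooth off $p$, and let $A\in\mathbb R$ be the constant term in $$G_p=\frac1{2\pi\rho^2}+A+O(\rho)\qquad\text{near }p .$$ Consider the blow-up $N=M\setminus\{p\}$ with the normalized contact form $\theta=(2\pi G_p)^2\hat\theta$,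 the inverted coordinates $z_*=z/v$, $t_*=-t/|v|^2$ near infinity (that is, near $p$), with $\rho_*$ and $v_*$ formed from $(z_*,t_*)$ as $\rho$ and $v$ from $(z,t)$, and the unitary coframe $$\theta^1=-\frac{v_*^3}{\rho_*^6}\,2\pi\big(G_p\hat\theta^1+2i(G_p)_{,\bar1}\hat\theta\big),$$ with connection form $\omega_1^1$. Then the p-mass $$m(J,\theta)=\lim_{\Lambda\to+\infty}i\oint_{\{\rho_*=\Lambda\}}\omega_1^1\wedge\theta ,$$ where $\{\rho_*=\Lambda\}$ is oriented as the boundary of $\{\rho_*\le\Lambda\}$ (for the orientation $dx_*\wedge dy_*\wedge dt_*$, $z_*=x_*+iy_*$), exists and $$m(J,\theta)=48\pi^2A .$$ -/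

import Mathlib

open Complex MeasureTheory Filter Topology Asymptotics Set
open scoped Manifold ContDiff ComplexConjugate

noncomputable section

/-- The coordinate space of points `(z, t)`, used as the model of smooth 3-manifolds and as the
underlying manifold of the Heisenberg group. -/
abbrev Heis : Type := ℂ × ℝ

/-- The Heisenberg norm `ρ`, with `ρ ^ 4 = |z| ^ 4 + t ^ 2`. -/
def heisNorm (q : Heis) : ℝ := (‖q.1‖ ^ 4 + q.2 ^ 2) ^ (1 / 4 : ℝ)

/-- The standard contact form `θ₀ = dt + i z dz̄ - i z̄ dz`, evaluated at the point `q` on `u`.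
(For `u = (ζ, τ)` this is `τ + 2 Im (z̄ ζ)`.) -/
def stdContact (q u : Heis) : ℂ :=
  (u.2 : ℂ) + I * q.1 * conj u.1 - I * conj q.1 * u.1

/-! ### Forms in coordinates -/

/-- The exterior derivative of a one-form on (an open subset of) the coordinate space. -/
def dForm {F : Type*} [NormedAddCommGroup F] [NormedSpace ℝ F]
    (α : Heis → Heis →L[ℝ] F) (q u v : Heis) : F :=
  fderiv ℝ α q u v - fderiv ℝ α q v u

/-- The wedge product of two complex-valued one-forms at a point. -/
def wedge (α β : Heis → ℂ) (u v : Heis) : ℂ := α u * β v - α v * β u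

/-- The conjugate of a complex-valued one-form at a point. -/
def conjForm (α : Heis →L[ℝ] ℂ) (u : Heis) : ℂ := conj (α u)

/-- A real one-form at a point, as a complex-valued one. -/
def toC (α : Heis →L[ℝ] ℝ) (u : Heis) : ℂ := (α u : ℂ)

/-- `(ϑ ∧ dϑ)(∂ₓ, ∂_y, ∂ₜ)` in the coordinates `z = x + i y, t`. -/
def contactDensity (ϑ : Heis → Heis →L[ℝ] ℝ) (q : Heis) : ℝ :=
  ϑ q (1, 0) * dForm ϑ q (I, 0) (0, 1) - ϑ q (I, 0) * dForm ϑ q (1, 0) (0, 1)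
    + ϑ q (0, 1) * dForm ϑ q (1, 0) (I, 0)

/-! ### Pseudohermitian calculus with respect to a coframe `(ϑ, η, η̄)` in coordinates -/

/-- The real vector with `ϑ`-component `c.1` and `η`-component `c.2`: the inverse of
`u ↦ (ϑ u, η u)`. -/
def dualFrame (ϑ : Heis → Heis →L[ℝ] ℝ) (η : Heis → Heis →L[ℝ] ℂ) (q : Heis) :
    ℝ × ℂ →L[ℝ] Heis :=
  ((ϑ q).prod (η q)).inverse

/-- The value of a complex-valued real-linear functional on `Z₁ = (X - i Y) / 2`, where
`(T, Z₁, Z̄₁)` is the frame dual to `(ϑ, η, η̄)`, and `X`, `Y` are the real vectors annihilated by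
`ϑ` with `η X = 1`, `η Y = i`. -/
def onZ (ϑ : Heis → Heis →L[ℝ] ℝ) (η : Heis → Heis →L[ℝ] ℂ) (q : Heis)
    (α : Heis →L[ℝ] ℂ) : ℂ :=
  (α (dualFrame ϑ η q (0, 1)) - I * α (dualFrame ϑ η q (0, I))) / 2

/-- The value of a complex-valued real-linear functional on `Z̄₁ = (X + i Y) / 2`. -/
def onZbar (ϑ : Heis → Heis →L[ℝ] ℝ) (η : Heis → Heis →L[ℝ] ℂ) (q : Heis)
    (α : Heis →L[ℝ] ℂ) : ℂ :=
  (α (dualFrame ϑ η q (0, 1)) + I * α (dualFrame ϑ η q (0, I))) / 2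

/-- `Z₁ f`. -/
def derivZ (ϑ : Heis → Heis →L[ℝ] ℝ) (η : Heis → Heis →L[ℝ] ℂ) (f : Heis → ℂ) (q : Heis) : ℂ :=
  onZ ϑ η q (fderiv ℝ f q)

/-- `Z̄₁ f`. -/
def derivZbar (ϑ : Heis → Heis →L[ℝ] ℝ) (η : Heis → Heis →L[ℝ] ℂ) (f : Heis → ℂ)
    (q : Heis) : ℂ :=
  onZbar ϑ η q (fderiv ℝ f q)

/-- The sublaplacian `Δ_b f = f_{,1 1̄} + f_{,1̄ 1}`, where `ω₁` is the connection form `ω₁¹`: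
`f_{,1 1̄} = Z̄₁ Z₁ f - ω₁(Z̄₁) Z₁ f` and `f_{,1̄ 1} = Z₁ Z̄₁ f + ω₁(Z₁) Z̄₁ f`
(the connection form on the conjugate index is `-ω₁`). -/
def subLaplacian (ϑ : Heis → Heis →L[ℝ] ℝ) (η ω₁ : Heis → Heis →L[ℝ] ℂ) (f : Heis → ℂ)
    (q : Heis) : ℂ :=
  (derivZbar ϑ η (derivZ ϑ η f) q - onZbar ϑ η q (ω₁ q) * derivZ ϑ η f q)
    + (derivZ ϑ η (derivZbar ϑ η f) q + onZ ϑ η q (ω₁ q) * derivZbar ϑ η f q)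

/-- `ω₁` is the connection form `ω₁¹` of the coframe `(ϑ, η, η̄)` on `V`: it is purely imaginary and
`dη = η ∧ ω₁ + a ϑ ∧ η̄` for some function `a` (the torsion). These equations determine `ω₁`. -/
structure IsConnectionForm (ϑ : Heis → Heis →L[ℝ] ℝ) (η : Heis → Heis →L[ℝ] ℂ) (V : Set Heis)
    (ω₁ : Heis → Heis →L[ℝ] ℂ) : Prop where
  smooth : ContDiffOn ℝ ∞ ω₁ V
  imaginary : ∀ q ∈ V, ∀ u, ω₁ q u + conj (ω₁ q u) = 0
  structure_eq : ∃ a : Heis → ℂ, ∀ q ∈ V, ∀ u v,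
    dForm η q u v = wedge (η q) (ω₁ q) u v + a q * wedge (toC (ϑ q)) (conjForm (η q)) u v

section Manifold

variable {M : Type*} [TopologicalSpace M] [ChartedSpace Heis M]

variable (M) in
/-- One-forms on `M` with values in `F`; smoothness is imposed separately. -/
abbrev OneForm (F : Type*) [NormedAddCommGroup F] [NormedSpace ℝ F] : Type _ :=
  ∀ x : M, TangentSpace 𝓘(ℝ, Heis) x →L[ℝ] F

/-- The differential at `q` of a map `κ` from the coordinate space to `M`. -/
def dParam (κ : Heis → M) (q : Heis) : Heis →L[ℝ] TangentSpace 𝓘(ℝ, Heis) (κ q) :=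
  mfderiv 𝓘(ℝ, Heis) 𝓘(ℝ, Heis) κ q

/-- The coordinate expression (pullback) of a one-form. -/
def pull {F : Type*} [NormedAddCommGroup F] [NormedSpace ℝ F] (κ : Heis → M) (α : OneForm M F)
    (q : Heis) : Heis →L[ℝ] F :=
  (α (κ q)).comp (dParam κ q)

/-- `κ` restricted to the open set `V` is a smooth local parametrization of `M`, that is, the
inverse of a smooth coordinate system. -/
structure IsParam (κ : Heis → M) (V : Set Heis) : Prop where
  isOpen : IsOpen V
  injOn : InjOn κ V
  smooth : ContMDiffOn 𝓘(ℝ, Heis) 𝓘(ℝ, Heis) ∞ κ V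
  bijective : ∀ q ∈ V, Function.Bijective (dParam κ q)

variable (M) in
/-- A (smooth) CR structure on a 3-manifold: a plane field `ξ` with an endomorphism `J` of `ξ`
such that `J² = -1`. Only the values of `J x` on `ξ x` matter. Smoothness is expressed by smooth
local one-forms `ϑ`, `η`, where `ϑ` defines `ξ` and `η` restricts to a `J`-complex-linear
isomorphism from `ξ` to `ℂ`. -/
structure CRStructure where
  ξ : ∀ x : M, Submodule ℝ (TangentSpace 𝓘(ℝ, Heis) x)
  J : ∀ x : M, TangentSpace 𝓘(ℝ, Heis) x →ₗ[ℝ] TangentSpace 𝓘(ℝ, Heis) x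
  finrank_ξ : ∀ x, Module.finrank ℝ (ξ x) = 2
  J_mem : ∀ x, ∀ v ∈ ξ x, J x v ∈ ξ x
  J_sq : ∀ x, ∀ v ∈ ξ x, J x (J x v) = -v
  smooth : ∀ x, ∃ (κ : Heis → M) (V : Set Heis) (ϑ : Heis → Heis →L[ℝ] ℝ)
      (η : Heis → Heis →L[ℝ] ℂ), IsParam κ V ∧ x ∈ κ '' V ∧
    ContDiffOn ℝ ∞ ϑ V ∧ ContDiffOn ℝ ∞ η V ∧ ∀ q ∈ V,
      (∀ u, dParam κ q u ∈ ξ (κ q) ↔ ϑ q u = 0) ∧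
      (∀ u, ϑ q u = 0 → η q u = 0 → u = 0) ∧
      ∀ u w, dParam κ q u ∈ ξ (κ q) → dParam κ q w = J (κ q) (dParam κ q u) →
        η q w = I * η q u

namespace CRStructure

variable (C : CRStructure M)

/-- On the open set `U`, `θ` is a contact form for the CR structure: a smooth one-form with kernel
`ξ` and `dθ(v, J v) > 0` for `0 ≠ v ∈ ξ` (so that `θ ∧ dθ ≠ 0` and the structure is strictly
pseudoconvex). -/
structure IsContactForm (θ : OneForm M ℝ) (U : Set M) : Prop where
  smooth : ∀ (κ : Heis → M) (V : Set Heis), IsParam κ V → κ '' V ⊆ U →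
    ContDiffOn ℝ ∞ (pull κ θ) V
  mem_ξ_iff : ∀ x ∈ U, ∀ v, v ∈ C.ξ x ↔ θ x v = 0
  pos : ∀ (κ : Heis → M) (V : Set Heis), IsParam κ V → κ '' V ⊆ U → ∀ q ∈ V, ∀ u w, u ≠ 0 →
    dParam κ q u ∈ C.ξ (κ q) → dParam κ q w = C.J (κ q) (dParam κ q u) →
      0 < dForm (pull κ θ) q u w

/-- `η` is, in the coordinates `κ` on `V`, a unitary coframe `θ¹` of type `(1,0)` for `(J, θ)`:
`θ¹ ∘ J = i θ¹` on `ξ` and `dθ = i θ¹ ∧ θ¹̄` (so that `θ¹` annihilates the Reeb field). -/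
structure IsUnitaryCoframe (θ : OneForm M ℝ) (κ : Heis → M) (V : Set Heis)
    (η : Heis → Heis →L[ℝ] ℂ) : Prop where
  smooth : ContDiffOn ℝ ∞ η V
  type_one_zero : ∀ q ∈ V, ∀ u w, dParam κ q u ∈ C.ξ (κ q) →
    dParam κ q w = C.J (κ q) (dParam κ q u) → η q w = I * η q u
  unitary : ∀ q ∈ V, ∀ u v,
    ((dForm (pull κ θ) q u v : ℝ) : ℂ) = I * wedge (η q) (conjForm (η q)) u v

/-- `R` is the Tanaka-Webster curvature of `(J, θ)`: `dω₁¹ = R θ¹ ∧ θ¹̄` modulo `θ`, for all local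
unitary coframes. -/
def IsWebsterCurvature (θ : OneForm M ℝ) (R : M → ℝ) : Prop :=
  ∀ (κ : Heis → M) (V : Set Heis) (η ω₁ : Heis → Heis →L[ℝ] ℂ), IsParam κ V →
    C.IsUnitaryCoframe θ κ V η → IsConnectionForm (pull κ θ) η V ω₁ →
    ∀ q ∈ V, ∀ u v, pull κ θ q u = 0 → pull κ θ q v = 0 →
      dForm ω₁ q u v = R (κ q) * wedge (η q) (conjForm (η q)) u v

end CRStructure

/-- `μ` is the measure on `M` defined by the volume form `θ ∧ dθ`. -/
def IsContactVolume [MeasurableSpace M] (θ : OneForm M ℝ) (μ : Measure M) : Prop :=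
  ∀ (κ : Heis → M) (V : Set Heis), IsParam κ V → ∀ s ⊆ V, MeasurableSet s →
    μ (κ '' s) = ∫⁻ q in s, ENNReal.ofReal |contactDensity (pull κ θ) q|

namespace CRStructure

variable (C : CRStructure M)

/-- The Tanaka-Webster (CR Yamabe) invariant `𝒴(J)`, the infimum over all contact forms `θ` of
`(∫ R θ ∧ dθ) / (∫ θ ∧ dθ) ^ (1/2)`. (The real infimum of an empty set, or of a set without lower
bound, is `0`, so that `0 < 𝒴(J)` means what it should.) -/
def yamabeInvariant [MeasurableSpace M] : ℝ :=
  sInf {y : ℝ | ∃ (θ : OneForm M ℝ) (R : M → ℝ) (μ : Measure M), C.IsContactForm θ univ ∧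
    C.IsWebsterCurvature θ R ∧ IsContactVolume θ μ ∧
    y = (∫ x, R x ∂μ) / √(μ.real univ)}

/-- `G` is a Green's function with pole `p` of the conformal sublaplacian of `(J, θ)`, where `R` is
the Tanaka-Webster curvature: it is smooth off `p`, locally integrable, and
`-4 Δ_b G + R G = 16 δ_p` in the sense of distributions with respect to `θ ∧ dθ`, tested in
coordinates (`Δ_b` is symmetric with respect to `θ ∧ dθ`). -/
structure IsGreenFunction (θ : OneForm M ℝ) (R : M → ℝ) (p : M) (G : M → ℝ) : Prop where
  smooth : ContMDiffOn 𝓘(ℝ, Heis) 𝓘(ℝ, ℝ) ∞ G {p}ᶜ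
  locallyIntegrable : ∀ (κ : Heis → M) (V : Set Heis), IsParam κ V →
    LocallyIntegrableOn (fun q => G (κ q)) V
  equation : ∀ (κ : Heis → M) (V : Set Heis) (η ω₁ : Heis → Heis →L[ℝ] ℂ), IsParam κ V →
    C.IsUnitaryCoframe θ κ V η → IsConnectionForm (pull κ θ) η V ω₁ →
    ∀ φ : Heis → ℝ, ContDiff ℝ ∞ φ → HasCompactSupport φ → tsupport φ ⊆ V →
      let pairing : ℂ := ∫ q in V, (G (κ q) : ℂ) *
        (-4 * subLaplacian (pull κ θ) η ω₁ (fun q => (φ q : ℂ)) q + (R (κ q) * φ q : ℝ)) *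
          (|contactDensity (pull κ θ) q| : ℝ)
      (∀ q ∈ V, κ q = p → pairing = 16 * φ q) ∧ (p ∉ κ '' V → pairing = 0)

/-- `κ` on `V` gives coordinates `(z, t)` centred at `p`, and `η` is a unitary coframe for
`(J, θ)` there, such that, with `θ₀ = dt + i z dz̄ - i z̄ dz`, near `p`
`θ = (1 + O(ρ⁴)) θ₀ + O(ρ⁵) dz + O(ρ⁵) dz̄` and
`θ¹ = √2 (1 + O(ρ⁴)) dz + O(ρ⁴) dz̄ + O(ρ³) θ₀`. -/
structure IsCRNormal (θ : OneForm M ℝ) (p : M) (κ : Heis → M) (V : Set Heis)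
    (η : Heis → Heis →L[ℝ] ℂ) : Prop where
  isParam : IsParam κ V
  zero_mem : 0 ∈ V
  map_zero : κ 0 = p
  coframe : C.IsUnitaryCoframe θ κ V η
  contact_expansion : ∃ a b c : Heis → ℂ,
    a =O[𝓝 0] (fun q => heisNorm q ^ 4) ∧ b =O[𝓝 0] (fun q => heisNorm q ^ 5) ∧
    c =O[𝓝 0] (fun q => heisNorm q ^ 5) ∧
    ∀ q ∈ V, ∀ u : Heis, ((pull κ θ q u : ℝ) : ℂ) =
      (1 + a q) * stdContact q u + b q * u.1 + c q * conj u.1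
  coframe_expansion : ∃ a b c : Heis → ℂ,
    a =O[𝓝 0] (fun q => heisNorm q ^ 4) ∧ b =O[𝓝 0] (fun q => heisNorm q ^ 4) ∧
    c =O[𝓝 0] (fun q => heisNorm q ^ 3) ∧
    ∀ q ∈ V, ∀ u : Heis, η q u =
      √2 * (1 + a q) * u.1 + b q * conj u.1 + c q * stdContact q u

end CRStructure

/-! ### The p-mass -/

/-- The parametrization of the Heisenberg sphere `S_Λ = {ρ = Λ}` by
`(φ, s) ↦ (Λ cos s e^{iφ}, Λ² sin s √(1 + cos² s))`, for `φ ∈ [-π, π]`, `s ∈ [-π/2, π/2]`. -/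
def heisSphere (Λ φ s : ℝ) : Heis :=
  (((Λ * Real.cos s : ℝ) : ℂ) * exp (φ * I), Λ ^ 2 * Real.sin s * √(1 + Real.cos s ^ 2))

/-- The integral over `S_Λ` of a (complex-valued) two-form `β`, where `S_Λ` is oriented as the
boundary of `{ρ ≤ Λ}`, so that `dφ ∧ dt > 0`. -/
def sphereIntegral (β : Heis → Heis → Heis → ℂ) (Λ : ℝ) : ℂ :=
  ∫ φ in (-Real.pi)..Real.pi, ∫ s in (-(Real.pi / 2))..(Real.pi / 2),
    β (heisSphere Λ φ s) (deriv (fun φ' => heisSphere Λ φ' s) φ)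
      (deriv (fun s' => heisSphere Λ φ s') s)

/-- The p-mass `i ∮_∞ ω₁¹ ∧ θ = lim_{Λ → ∞} i ∮_{S_Λ} ω₁¹ ∧ θ` of the pseudohermitian structure
`(J, θ)`, computed in the coordinates `κ` near infinity (where they parametrize an end by
`{ρ > r}`), with respect to the unitary coframe `η` with connection form `ω₁¹`, exists and
equals `m`. -/
def CRStructure.HasPMass (C : CRStructure M) (θ : OneForm M ℝ) (κ : Heis → M)
    (η : Heis → Heis →L[ℝ] ℂ) (m : ℝ) : Prop :=
  ∃ (r : ℝ) (V : Set Heis), V = {q | r < heisNorm q} ∧ IsParam κ V ∧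
    C.IsContactForm θ (κ '' V) ∧ C.IsUnitaryCoframe θ κ V η ∧
    ∃ ω₁ : Heis → Heis →L[ℝ] ℂ, IsConnectionForm (pull κ θ) η V ω₁ ∧
      Tendsto (fun Λ : ℝ => I * sphereIntegral (fun q => wedge (ω₁ q) (toC (pull κ θ q))) Λ)
        atTop (𝓝 (m : ℂ))

/-! ### The blow-up -/

/-- `v = t + i |z|²`. -/
def heisV (q : Heis) : ℂ := (q.2 : ℂ) + I * (‖q.1‖ ^ 2 : ℝ)

/-- The CR inversion `(z_*, t_*) = (z / v, -t / |v|²)`. -/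
def heisInv (q : Heis) : Heis := (q.1 / heisV q, -q.2 / ‖heisV q‖ ^ 2)

/-- The inverse `(z, t) = (-z_* / v_*, -t_* / |v_*|²)` of the CR inversion. -/
def heisInvSymm (q : Heis) : Heis := (-q.1 / heisV q, -q.2 / ‖heisV q‖ ^ 2)

theorem norm_heisV_sq (q : Heis) : ‖heisV q‖ ^ 2 = ‖q.1‖ ^ 4 + q.2 ^ 2 := by
  rw [← Complex.normSq_eq_norm_sq, Complex.normSq_apply]
  simp [heisV, ← Complex.ofReal_pow]; ring

/-- The two maps are inverse to each other off the origin. -/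
theorem heisInv_heisInvSymm (q : Heis) (hq : q ≠ 0) :
    heisInv (heisInvSymm q) = q ∧ heisInvSymm (heisInv q) = q := by
  have h0 : heisV q ≠ 0 := by
    intro h
    have := norm_heisV_sq q
    rw [h] at this
    simp at this
    have h1 : ‖q.1‖ ^ 4 = 0 := by nlinarith [sq_nonneg q.2, pow_nonneg (norm_nonneg q.1) 4]
    have h2 : q.2 ^ 2 = 0 := by nlinarith [sq_nonneg q.2, pow_nonneg (norm_nonneg q.1) 4]
    exact hq (Prod.ext (by simpa using h1) (by simpa using h2))
  have hn : ‖heisV q‖ ≠ 0 := by simpa using h0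
  have hc : (conj (heisV q)) ≠ 0 := by simpa using h0
  have hm : ((‖heisV q‖ : ℝ) : ℂ) ^ 2 = conj (heisV q) * heisV q := by
    rw [← Complex.ofReal_pow, ← Complex.normSq_eq_norm_sq, Complex.normSq_eq_conj_mul_self]
  have hcv : conj (heisV q) = (q.2 : ℂ) - I * (‖q.1‖ ^ 2 : ℝ) := by simp [heisV, sub_eq_add_neg]
  have k1 : heisV (heisInvSymm q) = - (heisV q)⁻¹ := by
    have : heisV (heisInvSymm q) = -conj (heisV q) / ((‖heisV q‖ : ℝ) : ℂ) ^ 2 := by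
      rw [hcv]; simp [heisV, heisInvSymm]; ring
    rw [this, hm]; field_simp
  have k2 : heisV (heisInv q) = - (heisV q)⁻¹ := by
    have : heisV (heisInv q) = -conj (heisV q) / ((‖heisV q‖ : ℝ) : ℂ) ^ 2 := by
      rw [hcv]; simp [heisV, heisInv]; ring
    rw [this, hm]; field_simp
  constructor
  · rw [heisInv, k1]; ext1
    · simp [heisInvSymm]; field_simp
    · simp [heisInvSymm]; field_simp
  · rw [heisInvSymm, k2]; ext1
    · simp [heisInv]; field_simp
    · simp [heisInv]; field_simp

/-- The contact form `(2π G)² θ` of the blow-up. -/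
def blowupForm (G : M → ℝ) (θ : OneForm M ℝ) : OneForm M ℝ :=
  fun x => ((2 * Real.pi * G x) ^ 2) • θ x

/-- The unitary coframe of the blow-up in the coordinates `(z, t)`, namely
`2π G (θ¹ + 2 i (log G)_{,1̄} θ) = 2π (G θ¹ + 2 i G_{,1̄} θ)`. -/
def blowupCoframe₀ (G : M → ℝ) (θ : OneForm M ℝ) (κ : Heis → M) (η : Heis → Heis →L[ℝ] ℂ)
    (q : Heis) : Heis →L[ℝ] ℂ :=
  (2 * Real.pi : ℂ) • ((G (κ q) : ℂ) • η q +
    (2 * I * derivZbar (pull κ θ) η (fun q' => (G (κ q') : ℂ)) q) •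
      (ofRealCLM.comp (pull κ θ q)))

/-- The unitary coframe of the blow-up in the inverted coordinates `(z_*, t_*)`, after
multiplication by the unitary factor `-v_*³ / ρ_*⁶`. -/
def blowupCoframe (G : M → ℝ) (θ : OneForm M ℝ) (κ : Heis → M) (η : Heis → Heis →L[ℝ] ℂ)
    (q : Heis) : Heis →L[ℝ] ℂ :=
  (-heisV q ^ 3 / (heisNorm q : ℂ) ^ 6) •
    ((blowupCoframe₀ G θ κ η (heisInvSymm q)).comp (fderiv ℝ heisInvSymm q))

end Manifold

end

/-!
Everything takes place in coordinates `q = (z, t)` around the pole. There the contact form `ϑ` and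
the coframe `η` osculate the standard ones (`IsNormalCoframe`), and `u = 2π G` has the expansion
`u = ρ⁻² + a + w` with `a = 2π A`, `w = O(ρ)` (`HasPoleExpansion`).

*Reduction to a flux near the pole.* Write the connection form of `(ϑ, η)` as `i μ`. Passing from
`ϑ` to `u² ϑ` subtracts `(3 / u) λ_u` from `μ` modulo `ϑ`, where `λ_u` is the rotated horizontal
gradient `rotGrad` (`IsCoframe.isConnMod_scaled`). The unitary factor `-v_*³ / ρ_*⁶` contributes
`3 d(arg v)` (`fderiv_unitaryFactor`), whose sign is changed by the inversion
(`argForm_heisInvSymm`). Since the inversion maps the sphere of radius `Λ` to that of radius `1 / Λ`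
and reverses its orientation, `i ∮ ω₁¹ ∧ θ` over the large sphere is the integral of
`u² μ ∧ ϑ - 3 u λ_u ∧ ϑ + 3 u² d(arg v) ∧ ϑ` over the small one
(`IsCoframe.sphereIntegral_inverted`, `fluxDens_blowup`). A two-form is treated throughout as the
vector field `B` with which it is `ι_B (dx ∧ dy ∧ dt)`; the field `B_f` of `λ_f ∧ ϑ` is a negative
multiple of the horizontal gradient of `f`, and its divergence is the sublaplacian up to a factor.

*The model terms.* The form `μ ∧ ϑ` is of order `ρ⁵` on spheres, which beats `u² = O(ρ⁻⁴)`
(`fluxDens_connPot`). Both `λ_{ρ⁻²} ∧ ϑ` and `r⁻² d(arg v) ∧ ϑ` have the same limit density, of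
integral `8π` (`fluxDens_gradField_poleFun`, `fluxDens_argForm`, `sphInt_modelDens`). Hence the
terms of order `r⁻²` cancel, and those of order `1` are `-3 a + 6 a` times this density: they
contribute `24π a = 48π² A`.

*The regular part.* It remains that `r⁻²` times the flux of `B_w`, and the flux of `w B_w`, tend to
zero. Nothing is assumed about the derivatives of `w`, and no regularity theory is used. Off the
pole `G` satisfies its equation classically (`IsCoframe.equation_of_weak`), and the curvature
vanishes at the pole (`curvature_center`), so that `div B_u = o(ρ⁻²)`. Consequently the flux of
`B_w` varies only by `o(r²)` (`flux_rem_sub`). A weighted mean of this flux over the radii in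
`[ε, 2 ε]` involves only the values of `w`, by Green's identity with `ρ⁻²` (`green`, `green_bound`),
and is small because `w = O(ρ)`. A nearly constant function with small mean is small
(`flux_rem_isLittleO`). The flux of `w B_w` is half that of `B_{w²}`, so that the same identity
bounds its mean. Its variation contains the integral of `|∇w|²`, which has no known bound but has a
sign, so that the flux is nearly monotone, and this suffices to conclude (`flux_energy_sub`,
`flux_energy_tendsto`).
-/

noncomputable section

/-! ### Vector calculus on the coordinate space -/

/-- The coordinate vector `∂ₓ`. -/
abbrev ex : Heis := (1, 0)

/-- The coordinate vector `∂_y`. -/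
abbrev ey : Heis := (I, 0)

/-- The coordinate vector `∂ₜ`. -/
abbrev et : Heis := (0, 1)

/-- The volume form `dx ∧ dy ∧ dt`. -/
def det3 (a b c : Heis) : ℝ :=
  a.1.re * (b.1.im * c.2 - c.1.im * b.2) - a.1.im * (b.1.re * c.2 - c.1.re * b.2)
    + a.2 * (b.1.re * c.1.im - c.1.re * b.1.im)

/-- The vector `B` with `l ∧ m = ι_B (dx ∧ dy ∧ dt)`. -/
def cross (l m : Heis →L[ℝ] ℝ) : Heis :=
  (⟨l ey * m et - l et * m ey, l et * m ex - l ex * m et⟩, l ex * m ey - l ey * m ex)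

/-- The divergence with respect to `dx ∧ dy ∧ dt`. -/
def divg (B : Heis → Heis) (q : Heis) : ℝ :=
  (fderiv ℝ B q ex).1.re + (fderiv ℝ B q ey).1.im + (fderiv ℝ B q et).2

theorem heis_eq (u : Heis) : u = u.1.re • ex + u.1.im • ey + u.2 • et := by
  ext <;> simp [ex, ey, et]

theorem map_heis {F : Type*} [NormedAddCommGroup F] [NormedSpace ℝ F] (l : Heis →L[ℝ] F)
    (u : Heis) : l u = u.1.re • l ex + u.1.im • l ey + u.2 • l et := by
  conv_lhs => rw [heis_eq u]
  simp only [map_add, map_smul]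

theorem det3_cross (l m : Heis →L[ℝ] ℝ) (a b : Heis) :
    det3 (cross l m) a b = l a * m b - l b * m a := by
  rw [map_heis l a, map_heis l b, map_heis m a, map_heis m b]
  simp only [det3, cross, smul_eq_mul]; ring

theorem map_cross (l m n : Heis →L[ℝ] ℝ) :
    n (cross l m) = n ex * (l ey * m et - l et * m ey) + n ey * (l et * m ex - l ex * m et)
      + n et * (l ex * m ey - l ey * m ex) := by
  rw [map_heis n (cross l m)]
  simp only [cross, smul_eq_mul]; ring

theorem cross_self_left (l m : Heis →L[ℝ] ℝ) : l (cross l m) = 0 := by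
  rw [map_cross]; ring

theorem cross_self_right (l m : Heis →L[ℝ] ℝ) : m (cross l m) = 0 := by
  rw [map_cross]; ring

/-- The divergence as a trace: the derivative of the determinant along a linear map. -/
theorem det3_trace (L : Heis →L[ℝ] Heis) (a b c : Heis) :
    det3 (L a) b c + det3 a (L b) c + det3 a b (L c)
      = ((L ex).1.re + (L ey).1.im + (L et).2) * det3 a b c := by
  rw [map_heis L a, map_heis L b, map_heis L c]
  simp only [det3, Prod.fst_add, Prod.snd_add, Prod.smul_fst, Prod.smul_snd, Complex.add_re,
    Complex.add_im, Complex.smul_re, Complex.smul_im, smul_eq_mul]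
  ring

/-- Cramer's rule for a linear form. -/
theorem det3_cramer (l : Heis →L[ℝ] ℝ) (B a b c : Heis) :
    l B * det3 a b c = l a * det3 B b c + l b * det3 a B c + l c * det3 a b B := by
  rw [map_heis l a, map_heis l b, map_heis l c, map_heis l B]
  simp only [det3, smul_eq_mul]
  ring

theorem divg_smul {f : Heis → ℝ} {B : Heis → Heis} {q : Heis} (hf : DifferentiableAt ℝ f q)
    (hB : DifferentiableAt ℝ B q) :
    divg (fun x => f x • B x) q = fderiv ℝ f q (B q) + f q * divg B q := by
  have h := (hf.hasFDerivAt.smul hB.hasFDerivAt).fderiv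
  have h' : fderiv ℝ (fun x => f x • B x) q
      = f q • fderiv ℝ B q + (fderiv ℝ f q).smulRight (B q) := h
  rw [divg, h', map_heis (fderiv ℝ f q) (B q)]
  simp [divg]; ring

theorem divg_add {A B : Heis → Heis} {q : Heis} (hA : DifferentiableAt ℝ A q)
    (hB : DifferentiableAt ℝ B q) : divg (fun x => A x + B x) q = divg A q + divg B q := by
  have h : fderiv ℝ (fun x => A x + B x) q = fderiv ℝ A q + fderiv ℝ B q := fderiv_add hA hB
  rw [divg, h]; simp [divg]; ring

theorem divg_sub {A B : Heis → Heis} {q : Heis} (hA : DifferentiableAt ℝ A q)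
    (hB : DifferentiableAt ℝ B q) : divg (fun x => A x - B x) q = divg A q - divg B q := by
  have h : fderiv ℝ (fun x => A x - B x) q = fderiv ℝ A q - fderiv ℝ B q := fderiv_sub hA hB
  rw [divg, h]; simp [divg]; ring

theorem divg_congr {A B : Heis → Heis} {q : Heis} (h : A =ᶠ[𝓝 q] B) : divg A q = divg B q := by
  rw [divg, divg, h.fderiv_eq]

/-- The bilinear map `cross`, bundled. -/
def crossL : (Heis →L[ℝ] ℝ) →L[ℝ] (Heis →L[ℝ] ℝ) →L[ℝ] Heis :=
  (LinearMap.mk₂ ℝ cross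
    (by intro a b c; simp only [cross, Prod.ext_iff, Complex.ext_iff]; simp; refine ⟨⟨?_, ?_⟩, ?_⟩ <;> ring)
    (by intro a b c; simp only [cross, Prod.ext_iff, Complex.ext_iff]; simp; refine ⟨⟨?_, ?_⟩, ?_⟩ <;> ring)
    (by intro a b c; simp only [cross, Prod.ext_iff, Complex.ext_iff]; simp; refine ⟨⟨?_, ?_⟩, ?_⟩ <;> ring)
    (by intro a b c; simp only [cross, Prod.ext_iff, Complex.ext_iff]; simp; refine ⟨⟨?_, ?_⟩, ?_⟩ <;> ring)).toContinuousBilinearMap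

theorem crossL_apply (l m : Heis →L[ℝ] ℝ) : crossL l m = cross l m := rfl

theorem divg_cross {l m : Heis → Heis →L[ℝ] ℝ} {q : Heis} (hl : DifferentiableAt ℝ l q)
    (hm : DifferentiableAt ℝ m q) :
    divg (fun x => cross (l x) (m x)) q =
      (dForm l q ey et * m q ex - dForm l q ex et * m q ey + dForm l q ex ey * m q et)
      - (dForm m q ey et * l q ex - dForm m q ex et * l q ey + dForm m q ex ey * l q et) := by
  have h : HasFDerivAt (fun x => cross (l x) (m x)) _ q :=
    crossL.hasFDerivAt_of_bilinear hl.hasFDerivAt hm.hasFDerivAt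
  rw [divg, h.fderiv]
  simp [crossL_apply, dForm, cross]
  ring

theorem ContDiffOn.cross {l m : Heis → Heis →L[ℝ] ℝ} {U : Set Heis} {n : WithTop ℕ∞}
    (hl : ContDiffOn ℝ n l U) (hm : ContDiffOn ℝ n m U) :
    ContDiffOn ℝ n (fun x => _root_.cross (l x) (m x)) U :=
  crossL.isBoundedBilinearMap.contDiff.comp_contDiffOn (hl.prodMk hm)

instance : (volume : Measure Heis).IsAddHaarMeasure :=
  MeasureTheory.Measure.prod.instIsAddHaarMeasure (volume : Measure ℂ) (volume : Measure ℝ)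

theorem integral_fderiv_eq_zero {f : Heis → ℝ} (hf : ContDiff ℝ 1 f) (hc : HasCompactSupport f)
    (v : Heis) : ∫ q, fderiv ℝ f q v = 0 := by
  have hd : Differentiable ℝ f := hf.differentiable (by simp)
  have hi : Integrable f := hf.continuous.integrable_of_hasCompactSupport hc
  have hi' : Integrable (fun q => fderiv ℝ f q v) := by
    refine Continuous.integrable_of_hasCompactSupport ?_ ?_
    · exact (hf.continuous_fderiv (by simp)).clm_apply continuous_const
    · exact hc.fderiv_apply (𝕜 := ℝ) v
  have := integral_bilinear_hasLineDerivAt_right_eq_neg_left_of_integrable (μ := (volume : Measure Heis))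
    (f := f) (f' := fun q => fderiv ℝ f q v) (g := fun _ => (1 : ℝ)) (g' := fun _ => (0 : ℝ)) (v := v)
    (B := ContinuousLinearMap.mul ℝ ℝ)
    (by simpa using hi') (by simp) (by simpa using hi)
    (fun q _ => (hd q).hasFDerivAt.hasLineDerivAt v)
    (fun q _ => by simpa using (hasFDerivAt_const (1 : ℝ) q).hasLineDerivAt v)
  simpa using this.symm

/-- The divergence theorem for compactly supported fields. -/
theorem integral_divg_eq_zero {K : Heis → Heis} (hK : ContDiff ℝ 1 K)
    (hc : HasCompactSupport K) : ∫ q, divg K q = 0 := by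
  have hd : Differentiable ℝ K := hK.differentiable (by simp)
  have key : ∀ (L : Heis →L[ℝ] ℝ) (v : Heis), Integrable (fun q => L (fderiv ℝ K q v)) ∧
      ∫ q, L (fderiv ℝ K q v) = 0 := by
    intro L v
    have e : ∀ q, L (fderiv ℝ K q v) = fderiv ℝ (fun x => L (K x)) q v := by
      intro q
      have : fderiv ℝ (fun x => L (K x)) q = L.comp (fderiv ℝ K q) :=
        (L.hasFDerivAt.comp q (hd q).hasFDerivAt).fderiv
      rw [this]; rfl
    have hL : ContDiff ℝ 1 (fun x => L (K x)) := L.contDiff.comp hK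
    have hLc : HasCompactSupport (fun x => L (K x)) := hc.comp_left (g := L) (map_zero L)
    simp only [e]
    refine ⟨?_, integral_fderiv_eq_zero hL hLc v⟩
    refine Continuous.integrable_of_hasCompactSupport ?_ (hLc.fderiv_apply (𝕜 := ℝ) v)
    exact (hL.continuous_fderiv (by simp)).clm_apply continuous_const
  have h1 := key (reCLM.comp (ContinuousLinearMap.fst ℝ ℂ ℝ)) ex
  have h2 := key (imCLM.comp (ContinuousLinearMap.fst ℝ ℂ ℝ)) ey
  have h3 := key (ContinuousLinearMap.snd ℝ ℂ ℝ) et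
  have e : ∫ q, divg K q = _ := integral_add (h1.1.add h2.1) h3.1
  have e' := integral_add h1.1 h2.1
  rw [h1.2, h2.2] at e'
  have e3 := h3.2
  exact e.trans (by simpa using congrArg₂ (· + ·) e' e3)

/-! ### Polar coordinates and the divergence theorem -/

/-- The height function `sin s √(1 + cos² s)` of the unit Heisenberg sphere. -/
def sphHeight (s : ℝ) : ℝ := Real.sin s * √(1 + Real.cos s ^ 2)

/-- The partial derivative of `heisSphere` in `r`. -/
def sphR (r φ s : ℝ) : Heis := ((Real.cos s : ℂ) * exp (φ * I), 2 * r * sphHeight s)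

/-- The partial derivative of `heisSphere` in `φ`. -/
def sphPhi (r φ s : ℝ) : Heis :=
  (((r * Real.cos s : ℝ) : ℂ) * (I * exp (φ * I)), 0)

/-- The partial derivative of `heisSphere` in `s`. -/
def sphS (r φ s : ℝ) : Heis :=
  (((-r * Real.sin s : ℝ) : ℂ) * exp (φ * I),
    r ^ 2 * (2 * Real.cos s ^ 3 / √(1 + Real.cos s ^ 2)))

theorem one_add_cos_sq_pos (s : ℝ) : 0 < 1 + Real.cos s ^ 2 := by positivity

theorem sqrt_one_add_cos_sq_pos (s : ℝ) : 0 < √(1 + Real.cos s ^ 2) :=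
  Real.sqrt_pos.2 (one_add_cos_sq_pos s)

theorem hasDerivAt_sphHeight (s : ℝ) :
    HasDerivAt sphHeight (2 * Real.cos s ^ 3 / √(1 + Real.cos s ^ 2)) s := by
  have h0 := one_add_cos_sq_pos s
  have h1 := sqrt_one_add_cos_sq_pos s
  have h := (Real.hasDerivAt_sin s).mul
    ((((Real.hasDerivAt_cos s).pow 2).const_add 1).sqrt h0.ne')
  refine h.congr_deriv ?_
  have h2 := Real.sq_sqrt h0.le
  have h3 := Real.sin_sq_add_cos_sq s
  simp only [Pi.pow_apply, Nat.cast_ofNat, Nat.add_one_sub_one, pow_one]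
  field_simp
  rw [h2]
  linear_combination (-Real.cos s) * h3

theorem heisSphere_eq (r φ s : ℝ) :
    heisSphere r φ s = (((r * Real.cos s : ℝ) : ℂ) * exp (φ * I), r ^ 2 * sphHeight s) := by
  simp [heisSphere, sphHeight, mul_assoc]

theorem hasDerivAt_exp_mul_I (φ : ℝ) :
    HasDerivAt (fun x : ℝ => exp ((x : ℂ) * I)) (I * exp (φ * I)) φ := by
  have h := (((hasDerivAt_id φ).ofReal_comp).mul_const I).cexp
  refine h.congr_deriv ?_
  simp; ring

theorem hasDerivAt_ofReal_mul {f : ℝ → ℝ} {f' x : ℝ} (h : HasDerivAt f f' x) (c : ℂ) :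
    HasDerivAt (fun y => (f y : ℂ) * c) ((f' : ℂ) * c) x := h.ofReal_comp.mul_const c

theorem hasDerivAt_heisSphere_r (r φ s : ℝ) :
    HasDerivAt (fun x => heisSphere x φ s) (sphR r φ s) r := by
  simp only [heisSphere_eq]
  refine HasDerivAt.prodMk (hasDerivAt_ofReal_mul (f' := Real.cos s) ?_ _) ?_
  · simpa using (hasDerivAt_id r).mul_const (Real.cos s)
  · simpa using ((hasDerivAt_id r).pow 2).mul_const (sphHeight s)

theorem hasDerivAt_heisSphere_phi (r φ s : ℝ) :
    HasDerivAt (fun x => heisSphere r x s) (sphPhi r φ s) φ := by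
  simp only [heisSphere_eq]
  exact ((hasDerivAt_exp_mul_I φ).const_mul _).prodMk (hasDerivAt_const _ _)

theorem hasDerivAt_heisSphere_s (r φ s : ℝ) :
    HasDerivAt (fun x => heisSphere r φ x) (sphS r φ s) s := by
  simp only [heisSphere_eq]
  refine HasDerivAt.prodMk (hasDerivAt_ofReal_mul ?_ _) ((hasDerivAt_sphHeight s).const_mul _)
  simpa using (Real.hasDerivAt_cos s).const_mul r

/-- The second derivative of `heisSphere` in `r` and `φ`. -/
def sphRPhi (_r φ s : ℝ) : Heis := ((Real.cos s : ℂ) * (I * exp (φ * I)), 0)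

/-- The second derivative of `heisSphere` in `r` and `s`. -/
def sphRS (r φ s : ℝ) : Heis :=
  (((-Real.sin s : ℝ) : ℂ) * exp (φ * I), 2 * r * (2 * Real.cos s ^ 3 / √(1 + Real.cos s ^ 2)))

/-- The second derivative of `heisSphere` in `φ` and `s`. -/
def sphPhiS (r φ s : ℝ) : Heis :=
  (((-r * Real.sin s : ℝ) : ℂ) * (I * exp (φ * I)), 0)

theorem hasDerivAt_sphR_phi (r φ s : ℝ) :
    HasDerivAt (fun x => sphR r x s) (sphRPhi r φ s) φ :=
  ((hasDerivAt_exp_mul_I φ).const_mul _).prodMk (hasDerivAt_const _ _)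

theorem hasDerivAt_sphR_s (r φ s : ℝ) :
    HasDerivAt (fun x => sphR r φ x) (sphRS r φ s) s := by
  refine HasDerivAt.prodMk (hasDerivAt_ofReal_mul (Real.hasDerivAt_cos s) _)
    ((hasDerivAt_sphHeight s).const_mul _)

theorem hasDerivAt_sphPhi_r (r φ s : ℝ) :
    HasDerivAt (fun x => sphPhi x φ s) (sphRPhi r φ s) r := by
  refine HasDerivAt.prodMk (hasDerivAt_ofReal_mul (f' := Real.cos s) ?_ _) (hasDerivAt_const _ _)
  simpa using (hasDerivAt_id r).mul_const (Real.cos s)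

theorem hasDerivAt_sphPhi_s (r φ s : ℝ) :
    HasDerivAt (fun x => sphPhi r φ x) (sphPhiS r φ s) s := by
  refine HasDerivAt.prodMk (hasDerivAt_ofReal_mul ?_ _) (hasDerivAt_const _ _)
  simpa using (Real.hasDerivAt_cos s).const_mul r

theorem hasDerivAt_sphS_r (r φ s : ℝ) :
    HasDerivAt (fun x => sphS x φ s) (sphRS r φ s) r := by
  refine HasDerivAt.prodMk (hasDerivAt_ofReal_mul (f' := -Real.sin s) ?_ _) ?_
  · simpa using (hasDerivAt_id r).neg.mul_const (Real.sin s)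
  · simpa using ((hasDerivAt_id r).pow 2).mul_const (2 * Real.cos s ^ 3 / √(1 + Real.cos s ^ 2))

theorem hasDerivAt_sphS_phi (r φ s : ℝ) :
    HasDerivAt (fun x => sphS r x s) (sphPhiS r φ s) φ :=
  ((hasDerivAt_exp_mul_I φ).const_mul _).prodMk (hasDerivAt_const _ _)

section Cont
variable {X : Type*} [TopologicalSpace X] {r φ s : X → ℝ}

theorem Continuous.heisSphere (hr : Continuous r) (hφ : Continuous φ) (hs : Continuous s) :
    Continuous fun x => _root_.heisSphere (r x) (φ x) (s x) := by
  unfold _root_.heisSphere; fun_prop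

theorem Continuous.sphR (hr : Continuous r) (hφ : Continuous φ) (hs : Continuous s) :
    Continuous fun x => _root_.sphR (r x) (φ x) (s x) := by
  unfold _root_.sphR sphHeight; fun_prop

theorem Continuous.sphPhi (hr : Continuous r) (hφ : Continuous φ) (hs : Continuous s) :
    Continuous fun x => _root_.sphPhi (r x) (φ x) (s x) := by
  unfold _root_.sphPhi; fun_prop

theorem continuous_sphS_aux : Continuous fun s : ℝ => 2 * Real.cos s ^ 3 / √(1 + Real.cos s ^ 2) :=
  Continuous.div (by fun_prop) (by fun_prop) fun s => (sqrt_one_add_cos_sq_pos s).ne'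

theorem Continuous.sphS (hr : Continuous r) (hφ : Continuous φ) (hs : Continuous s) :
    Continuous fun x => _root_.sphS (r x) (φ x) (s x) := by
  have := continuous_sphS_aux.comp hs
  unfold _root_.sphS
  refine Continuous.prodMk (by fun_prop) ((hr.pow 2).mul this)

theorem Continuous.sphRPhi (_hr : Continuous r) (hφ : Continuous φ) (hs : Continuous s) :
    Continuous fun x => _root_.sphRPhi (r x) (φ x) (s x) := by
  unfold _root_.sphRPhi; fun_prop

theorem Continuous.sphPhiS (hr : Continuous r) (hφ : Continuous φ) (hs : Continuous s) :
    Continuous fun x => _root_.sphPhiS (r x) (φ x) (s x) := by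
  unfold _root_.sphPhiS; fun_prop

theorem Continuous.sphRS (hr : Continuous r) (hφ : Continuous φ) (hs : Continuous s) :
    Continuous fun x => _root_.sphRS (r x) (φ x) (s x) := by
  have := continuous_sphS_aux.comp hs
  unfold _root_.sphRS
  refine Continuous.prodMk (by fun_prop) ((continuous_const.mul hr).mul this)

theorem Continuous.det3 {a b c : X → Heis} (ha : Continuous a) (hb : Continuous b)
    (hc : Continuous c) : Continuous fun x => _root_.det3 (a x) (b x) (c x) := by
  unfold _root_.det3; fun_prop
end Cont

theorem sphHeight_sq (s : ℝ) : sphHeight s ^ 2 = 1 - Real.cos s ^ 4 := by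
  rw [sphHeight, mul_pow, Real.sq_sqrt (one_add_cos_sq_pos s).le]
  linear_combination (1 + Real.cos s ^ 2) * Real.sin_sq_add_cos_sq s

/-- The fourth power `|z|⁴ + t²` of the Heisenberg norm. -/
def heisN (q : Heis) : ℝ := ‖q.1‖ ^ 4 + q.2 ^ 2

theorem heisN_nonneg (q : Heis) : 0 ≤ heisN q := by unfold heisN; positivity

theorem heisNorm_nonneg (q : Heis) : 0 ≤ heisNorm q := by
  unfold heisNorm; positivity

theorem heisNorm_pow_four (q : Heis) : heisNorm q ^ 4 = heisN q := by
  have := heisN_nonneg q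
  unfold heisNorm
  change (heisN q ^ (1 / 4 : ℝ)) ^ 4 = heisN q
  rw [← Real.rpow_natCast, ← Real.rpow_mul this]; simp

theorem heisN_heisSphere (r φ s : ℝ) : heisN (heisSphere r φ s) = r ^ 4 := by
  rw [heisSphere_eq, heisN]
  simp only [norm_mul, Complex.norm_exp_ofReal_mul_I, mul_one, Complex.norm_real]
  have : ‖r * Real.cos s‖ ^ 4 = (r * Real.cos s) ^ 4 := by
    rw [Real.norm_eq_abs, Even.pow_abs (by decide)]
  rw [mul_pow (r ^ 2), sphHeight_sq]
  rw [← norm_mul, this]; ring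

theorem heisNorm_heisSphere {r : ℝ} (hr : 0 ≤ r) (φ s : ℝ) : heisNorm (heisSphere r φ s) = r := by
  have h := heisNorm_pow_four (heisSphere r φ s)
  rw [heisN_heisSphere] at h
  exact (pow_left_inj₀ (heisNorm_nonneg _) hr (by norm_num)).1 h

/-- The Jacobian of polar coordinates. -/
def polJac (r s : ℝ) : ℝ := 2 * r ^ 3 * Real.cos s / √(1 + Real.cos s ^ 2)

theorem continuous_polJac : Continuous fun x : ℝ × ℝ => polJac x.1 x.2 := by
  unfold polJac
  exact Continuous.div (by fun_prop) (by fun_prop) fun s => (sqrt_one_add_cos_sq_pos _).ne'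

theorem det3_sph (r φ s : ℝ) : det3 (sphR r φ s) (sphPhi r φ s) (sphS r φ s) = polJac r s := by
  have h1 := sqrt_one_add_cos_sq_pos s
  have h2 := Real.sq_sqrt (one_add_cos_sq_pos s).le
  have h3 := Real.sin_sq_add_cos_sq s
  have h4 := Real.sin_sq_add_cos_sq φ
  have e : exp ((φ : ℂ) * I) = ⟨Real.cos φ, Real.sin φ⟩ := by
    rw [Complex.exp_mul_I, ← Complex.ofReal_cos, ← Complex.ofReal_sin]
    apply Complex.ext <;> simp [-Complex.ofReal_cos, -Complex.ofReal_sin]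
  simp only [det3, sphR, sphPhi, sphS, polJac, e, sphHeight]
  set c := Real.cos s
  set d := Real.sin s
  set w := √(1 + c ^ 2)
  set p := Real.cos φ
  set k := Real.sin φ
  simp
  field_simp
  have hk : k ^ 2 = 1 - p ^ 2 := by linarith
  have hd : d ^ 2 = 1 - c ^ 2 := by linarith
  rw [h2]
  ring_nf
  simp only [show k ^ 2 = 1 - p ^ 2 from hk, hd]
  ring

theorem HasDerivAt.det3 {a b c : ℝ → Heis} {a' b' c' : Heis} {x : ℝ} (ha : HasDerivAt a a' x)
    (hb : HasDerivAt b b' x) (hc : HasDerivAt c c' x) :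
    HasDerivAt (fun y => _root_.det3 (a y) (b y) (c y))
      (_root_.det3 a' (b x) (c x) + _root_.det3 (a x) b' (c x) + _root_.det3 (a x) (b x) c') x := by
  have re : ∀ {f : ℝ → Heis} {f' : Heis}, HasDerivAt f f' x →
      HasDerivAt (fun y => (f y).1.re) f'.1.re x := fun h =>
    (reCLM.comp (ContinuousLinearMap.fst ℝ ℂ ℝ)).hasFDerivAt.comp_hasDerivAt x h
  have im : ∀ {f : ℝ → Heis} {f' : Heis}, HasDerivAt f f' x →
      HasDerivAt (fun y => (f y).1.im) f'.1.im x := fun h =>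
    (imCLM.comp (ContinuousLinearMap.fst ℝ ℂ ℝ)).hasFDerivAt.comp_hasDerivAt x h
  have sn : ∀ {f : ℝ → Heis} {f' : Heis}, HasDerivAt f f' x →
      HasDerivAt (fun y => (f y).2) f'.2 x := fun h =>
    (ContinuousLinearMap.snd ℝ ℂ ℝ).hasFDerivAt.comp_hasDerivAt x h
  have := (((re ha).mul (((im hb).mul (sn hc)).sub ((im hc).mul (sn hb)))).sub
    ((im ha).mul (((re hb).mul (sn hc)).sub ((re hc).mul (sn hb))))).add
    ((sn ha).mul (((re hb).mul (im hc)).sub ((re hc).mul (im hb))))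
  refine this.congr_deriv ?_
  simp only [_root_.det3, Pi.mul_apply, Pi.sub_apply]
  ring

/-- The flux of the vector field `B` through the Heisenberg sphere of radius `r`, that is, the
integral of the two-form `ι_B (dx ∧ dy ∧ dt)`. -/
def flux (B : Heis → Heis) (r : ℝ) : ℝ :=
  ∫ φ in (-Real.pi)..Real.pi, ∫ s in (-(Real.pi / 2))..(Real.pi / 2),
    det3 (B (heisSphere r φ s)) (sphPhi r φ s) (sphS r φ s)

/-- The integral of `g` over the Heisenberg sphere of radius `r`, such that
`∫ shellInt g r dr` is the volume integral of `g`. -/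
def shellInt (g : Heis → ℝ) (r : ℝ) : ℝ :=
  ∫ φ in (-Real.pi)..Real.pi, ∫ s in (-(Real.pi / 2))..(Real.pi / 2),
    g (heisSphere r φ s) * polJac r s

section IntervalIntegrals

theorem integral_swap {f : ℝ → ℝ → ℝ} (hf : Continuous fun x : ℝ × ℝ => f x.1 x.2)
    (a b c d : ℝ) : ∫ x in a..b, ∫ y in c..d, f x y = ∫ y in c..d, ∫ x in a..b, f x y := by
  refine intervalIntegral_intervalIntegral_swap ?_
  have : IntegrableOn (Function.uncurry f) (uIcc a b ×ˢ uIcc c d) :=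
    hf.continuousOn.integrableOn_compact (isCompact_uIcc.prod isCompact_uIcc)
  exact this.mono_set (prod_mono uIoc_subset_uIcc uIoc_subset_uIcc)

theorem continuous_integral {X : Type*} [TopologicalSpace X] {f : X → ℝ → ℝ}
    (hf : Continuous fun x : X × ℝ => f x.1 x.2) (c d : ℝ) :
    Continuous fun x => ∫ y in c..d, f x y :=
  intervalIntegral.continuous_parametric_intervalIntegral_of_continuous' hf c d

theorem integral_swap3 {f : ℝ → ℝ → ℝ → ℝ} (hf : Continuous fun x : ℝ × ℝ × ℝ => f x.1 x.2.1 x.2.2)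
    (a b a' b' a'' b'' : ℝ) :
    ∫ x in a..b, ∫ y in a'..b', ∫ z in a''..b'', f x y z
      = ∫ y in a'..b', ∫ z in a''..b'', ∫ x in a..b, f x y z := by
  rw [integral_swap]
  · refine intervalIntegral.integral_congr fun y _ => ?_
    exact integral_swap (hf.comp (by fun_prop : Continuous fun x : ℝ × ℝ => (x.1, y, x.2))) _ _ _ _
  · exact continuous_integral (X := ℝ × ℝ) (f := fun p z => f p.1 p.2 z)
      (hf.comp (by fun_prop : Continuous fun x : (ℝ × ℝ) × ℝ => (x.1.1, x.1.2, x.2))) _ _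

end IntervalIntegrals

set_option maxHeartbeats 1000000 in
/-- The divergence theorem for the region between two Heisenberg spheres. -/
theorem flux_sub_flux {B : Heis → Heis} {U : Set Heis} (hU : IsOpen U) (hB : ContDiffOn ℝ 1 B U)
    {r₁ r₂ : ℝ} (h0 : 0 ≤ r₁) (h12 : r₁ ≤ r₂) (hsub : ∀ q, heisNorm q ∈ Icc r₁ r₂ → q ∈ U) :
    flux B r₂ - flux B r₁ = ∫ r in r₁..r₂, shellInt (divg B) r := by
  -- The radius is clamped to `[r₁, r₂]`, so that all integrands become globally continuous.
  set k : ℝ → ℝ := fun r => (projIcc r₁ r₂ h12 r : ℝ) with hk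
  have kc : Continuous k := continuous_subtype_val.comp continuous_projIcc
  have kmem : ∀ r, k r ∈ Icc r₁ r₂ := fun r => (projIcc r₁ r₂ h12 r).2
  have keq : ∀ r ∈ Icc r₁ r₂, k r = r := fun r hr => by simp [hk, projIcc_of_mem h12 hr]
  have memU : ∀ r ∈ Icc r₁ r₂, ∀ φ s, heisSphere r φ s ∈ U := fun r hr φ s =>
    hsub _ (by rwa [heisNorm_heisSphere (h0.trans hr.1)])
  have hd : ∀ q ∈ U, HasFDerivAt B (fderiv ℝ B q) q := fun q hq =>
    ((hB.contDiffAt (hU.mem_nhds hq)).differentiableAt (by simp)).hasFDerivAt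
  let P : ℝ × ℝ × ℝ → Heis := fun x => heisSphere (k x.1) x.2.1 x.2.2
  have c1 : Continuous fun x : ℝ × ℝ × ℝ => k x.1 := kc.comp continuous_fst
  have c2 : Continuous fun x : ℝ × ℝ × ℝ => x.2.1 := by fun_prop
  have c3 : Continuous fun x : ℝ × ℝ × ℝ => x.2.2 := by fun_prop
  have Pc : Continuous P := c1.heisSphere c2 c3
  have PU : ∀ x, P x ∈ U := fun x => memU _ (kmem _) _ _
  have Bc : Continuous fun x => B (P x) := hB.continuousOn.comp_continuous Pc PU
  have Dc : Continuous fun x => fderiv ℝ B (P x) :=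
    (hB.continuousOn_fderiv_of_isOpen hU (by simp)).comp_continuous Pc PU
  -- derivatives of the three components of the two-form in polar coordinates
  let a' : ℝ → ℝ → ℝ → ℝ := fun r φ s =>
    det3 (fderiv ℝ B (heisSphere r φ s) (sphR r φ s)) (sphPhi r φ s) (sphS r φ s)
    + det3 (B (heisSphere r φ s)) (sphRPhi r φ s) (sphS r φ s)
    + det3 (B (heisSphere r φ s)) (sphPhi r φ s) (sphRS r φ s)
  let b' : ℝ → ℝ → ℝ → ℝ := fun r φ s =>
    det3 (fderiv ℝ B (heisSphere r φ s) (sphPhi r φ s)) (sphR r φ s) (sphS r φ s)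
    + det3 (B (heisSphere r φ s)) (sphRPhi r φ s) (sphS r φ s)
    + det3 (B (heisSphere r φ s)) (sphR r φ s) (sphPhiS r φ s)
  let e' : ℝ → ℝ → ℝ → ℝ := fun r φ s =>
    det3 (fderiv ℝ B (heisSphere r φ s) (sphS r φ s)) (sphR r φ s) (sphPhi r φ s)
    + det3 (B (heisSphere r φ s)) (sphRS r φ s) (sphPhi r φ s)
    + det3 (B (heisSphere r φ s)) (sphR r φ s) (sphPhiS r φ s)
  have ac : Continuous fun x : ℝ × ℝ × ℝ => a' (k x.1) x.2.1 x.2.2 :=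
    ((((Dc.clm_apply (c1.sphR c2 c3)).det3 (c1.sphPhi c2 c3) (c1.sphS c2 c3))).add
      (Bc.det3 (c1.sphRPhi c2 c3) (c1.sphS c2 c3))).add
      (Bc.det3 (c1.sphPhi c2 c3) (c1.sphRS c2 c3))
  have bc : Continuous fun x : ℝ × ℝ × ℝ => b' (k x.1) x.2.1 x.2.2 :=
    ((((Dc.clm_apply (c1.sphPhi c2 c3)).det3 (c1.sphR c2 c3) (c1.sphS c2 c3))).add
      (Bc.det3 (c1.sphRPhi c2 c3) (c1.sphS c2 c3))).add
      (Bc.det3 (c1.sphR c2 c3) (c1.sphPhiS c2 c3))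
  have ec : Continuous fun x : ℝ × ℝ × ℝ => e' (k x.1) x.2.1 x.2.2 :=
    ((((Dc.clm_apply (c1.sphS c2 c3)).det3 (c1.sphR c2 c3) (c1.sphPhi c2 c3))).add
      (Bc.det3 (c1.sphRS c2 c3) (c1.sphPhi c2 c3))).add
      (Bc.det3 (c1.sphR c2 c3) (c1.sphPhiS c2 c3))
  have ident : ∀ r φ s, divg B (heisSphere r φ s) * polJac r s
      = a' r φ s - b' r φ s + e' r φ s := by
    intro r φ s
    rw [← det3_sph r φ s, divg, ← det3_trace]
    simp only [a', b', e', det3]; ring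
  have ha : ∀ r ∈ Icc r₁ r₂, ∀ φ s, HasDerivAt
      (fun x => det3 (B (heisSphere x φ s)) (sphPhi x φ s) (sphS x φ s)) (a' r φ s) r := by
    intro r hr φ s
    exact ((hd _ (memU r hr φ s)).comp_hasDerivAt r (hasDerivAt_heisSphere_r r φ s)).det3
      (hasDerivAt_sphPhi_r r φ s) (hasDerivAt_sphS_r r φ s)
  have hb : ∀ r ∈ Icc r₁ r₂, ∀ φ s, HasDerivAt
      (fun x => det3 (B (heisSphere r x s)) (sphR r x s) (sphS r x s)) (b' r φ s) φ := by
    intro r hr φ s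
    exact ((hd _ (memU r hr φ s)).comp_hasDerivAt φ (hasDerivAt_heisSphere_phi r φ s)).det3
      (hasDerivAt_sphR_phi r φ s) (hasDerivAt_sphS_phi r φ s)
  have he : ∀ r ∈ Icc r₁ r₂, ∀ φ s, HasDerivAt
      (fun x => det3 (B (heisSphere r φ x)) (sphR r φ x) (sphPhi r φ x)) (e' r φ s) s := by
    intro r hr φ s
    exact ((hd _ (memU r hr φ s)).comp_hasDerivAt s (hasDerivAt_heisSphere_s r φ s)).det3
      (hasDerivAt_sphR_s r φ s) (hasDerivAt_sphPhi_s r φ s)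
  have cs : ∀ r : ℝ, Continuous fun x : ℝ × ℝ => (r, x.1, x.2) := fun r => by fun_prop
  -- the `φ`- and `s`-derivatives integrate to zero
  have ib : ∀ r, ∫ φ in (-Real.pi)..Real.pi, ∫ s in (-(Real.pi / 2))..(Real.pi / 2),
      b' (k r) φ s = 0 := by
    intro r
    rw [integral_swap (bc.comp (cs r))]
    have : ∀ s, ∫ φ in (-Real.pi)..Real.pi, b' (k r) φ s = 0 := by
      intro s
      rw [intervalIntegral.integral_eq_sub_of_hasDerivAt (fun φ _ => hb (k r) (kmem r) φ s)
        (Continuous.intervalIntegrable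
          (bc.comp (by fun_prop : Continuous fun φ : ℝ => (r, φ, s))) _ _)]
      have e1 : exp (((-Real.pi : ℝ) : ℂ) * I) = exp ((Real.pi : ℂ) * I) := by
        simp [Complex.exp_neg]
      simp only [heisSphere_eq, sphR, sphS, e1, sub_self]
    simp [this]
  have ie : ∀ r, ∫ φ in (-Real.pi)..Real.pi, ∫ s in (-(Real.pi / 2))..(Real.pi / 2),
      e' (k r) φ s = 0 := by
    intro r
    have : ∀ φ, ∫ s in (-(Real.pi / 2))..(Real.pi / 2), e' (k r) φ s = 0 := by
      intro φ
      rw [intervalIntegral.integral_eq_sub_of_hasDerivAt (fun s _ => he (k r) (kmem r) φ s)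
        (Continuous.intervalIntegrable
          (ec.comp (by fun_prop : Continuous fun s : ℝ => (r, φ, s))) _ _)]
      simp [sphPhi, det3]
    simp [this]
  have shell : ∀ r ∈ Icc r₁ r₂, shellInt (divg B) r
      = ∫ φ in (-Real.pi)..Real.pi, ∫ s in (-(Real.pi / 2))..(Real.pi / 2), a' (k r) φ s := by
    intro r hr
    have i2 : ∀ {f : ℝ → ℝ → ℝ → ℝ}, (Continuous fun x : ℝ × ℝ × ℝ => f (k x.1) x.2.1 x.2.2) →
        ∀ φ, IntervalIntegrable (fun s => f (k r) φ s) volume (-(Real.pi / 2)) (Real.pi / 2) :=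
      fun hf φ => Continuous.intervalIntegrable
          (hf.comp (by fun_prop : Continuous fun s : ℝ => (r, φ, s))) _ _
    have i1 : ∀ {f : ℝ → ℝ → ℝ → ℝ}, (Continuous fun x : ℝ × ℝ × ℝ => f (k x.1) x.2.1 x.2.2) →
        IntervalIntegrable (fun φ => ∫ s in (-(Real.pi / 2))..(Real.pi / 2), f (k r) φ s) volume
          (-Real.pi) Real.pi :=
      fun {f} hf => Continuous.intervalIntegrable
          (continuous_integral (f := fun φ s => f (k r) φ s) (hf.comp (cs r)) _ _) _ _
    have : shellInt (divg B) r = ∫ φ in (-Real.pi)..Real.pi,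
        ((∫ s in (-(Real.pi / 2))..(Real.pi / 2), a' (k r) φ s)
        - (∫ s in (-(Real.pi / 2))..(Real.pi / 2), b' (k r) φ s)
        + ∫ s in (-(Real.pi / 2))..(Real.pi / 2), e' (k r) φ s) := by
      refine intervalIntegral.integral_congr fun φ _ => ?_
      rw [← intervalIntegral.integral_sub (i2 ac φ) (i2 bc φ),
        ← intervalIntegral.integral_add ((i2 ac φ).sub (i2 bc φ)) (i2 ec φ)]
      refine intervalIntegral.integral_congr fun s _ => ?_
      simp only [keq r hr, ident]
    rw [this, intervalIntegral.integral_add ((i1 ac).sub (i1 bc)) (i1 ec),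
      intervalIntegral.integral_sub (i1 ac) (i1 bc), ib, ie]
    ring
  have e1 : ∫ r in r₁..r₂, shellInt (divg B) r = ∫ r in r₁..r₂, ∫ φ in (-Real.pi)..Real.pi,
      ∫ s in (-(Real.pi / 2))..(Real.pi / 2), a' (k r) φ s :=
    intervalIntegral.integral_congr fun r hr => shell r (by rwa [uIcc_of_le h12] at hr)
  have e2 : ∀ φ s, ∫ r in r₁..r₂, a' (k r) φ s
      = det3 (B (heisSphere r₂ φ s)) (sphPhi r₂ φ s) (sphS r₂ φ s)
        - det3 (B (heisSphere r₁ φ s)) (sphPhi r₁ φ s) (sphS r₁ φ s) := by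
    intro φ s
    have hu : uIcc r₁ r₂ = Icc r₁ r₂ := uIcc_of_le h12
    rw [← intervalIntegral.integral_eq_sub_of_hasDerivAt (f := fun r =>
      det3 (B (heisSphere r φ s)) (sphPhi r φ s) (sphS r φ s)) (f' := fun r => a' (k r) φ s)]
    · intro r hr
      rw [hu] at hr
      simp only [keq r hr]
      exact ha r hr φ s
    · exact Continuous.intervalIntegrable
          (ac.comp (by fun_prop : Continuous fun r : ℝ => (r, φ, s))) _ _
  rw [e1]
  refine Eq.symm ((integral_swap3 (f := fun r => a' (k r)) ac _ _ _ _ _ _).trans ?_)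
  refine Eq.trans (intervalIntegral.integral_congr fun φ _ =>
    intervalIntegral.integral_congr fun s _ => e2 φ s) ?_
  have fc : ∀ r ∈ Icc r₁ r₂, Continuous fun x : ℝ × ℝ =>
      det3 (B (heisSphere r x.1 x.2)) (sphPhi r x.1 x.2) (sphS r x.1 x.2) := by
    intro r hr
    have hc := (Bc.det3 (c1.sphPhi c2 c3) (c1.sphS c2 c3)).comp (cs r)
    refine hc.congr fun x => ?_
    simp [P, keq r hr]
  have j2 : ∀ r ∈ Icc r₁ r₂, ∀ φ, IntervalIntegrable (fun s =>
      det3 (B (heisSphere r φ s)) (sphPhi r φ s) (sphS r φ s)) volume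
        (-(Real.pi / 2)) (Real.pi / 2) := fun r hr φ => Continuous.intervalIntegrable
          ((fc r hr).comp (by fun_prop : Continuous fun s : ℝ => (φ, s))) _ _
  have j1 : ∀ r ∈ Icc r₁ r₂, IntervalIntegrable (fun φ => ∫ s in (-(Real.pi / 2))..(Real.pi / 2),
      det3 (B (heisSphere r φ s)) (sphPhi r φ s) (sphS r φ s)) volume (-Real.pi) Real.pi :=
    fun r hr => Continuous.intervalIntegrable
      (continuous_integral (f := fun φ s => _) (fc r hr) _ _) _ _
  have m1 : r₁ ∈ Icc r₁ r₂ := ⟨le_rfl, h12⟩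
  have m2 : r₂ ∈ Icc r₁ r₂ := ⟨h12, le_rfl⟩
  refine Eq.trans (intervalIntegral.integral_congr fun φ _ =>
    intervalIntegral.integral_sub (j2 r₂ m2 φ) (j2 r₁ m1 φ)) ?_
  exact intervalIntegral.integral_sub (j1 r₂ m2) (j1 r₁ m1)

/-! ### Unitary coframes in coordinates -/

/-- `(ϑ, η, η̄)` is a smooth unitary coframe on the open set `U` of the coordinate space:
`dϑ = i η ∧ η̄`, written in real terms as `dϑ = 2 Re η ∧ Im η`. By `inj`, the three real
one-forms `ϑ`, `Re η`, `Im η` are a basis of the cotangent space. -/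
structure IsCoframe (ϑ : Heis → Heis →L[ℝ] ℝ) (η : Heis → Heis →L[ℝ] ℂ) (U : Set Heis) : Prop where
  isOpen : IsOpen U
  smooth₁ : ContDiffOn ℝ ∞ ϑ U
  smooth₂ : ContDiffOn ℝ ∞ η U
  unitary : ∀ q ∈ U, ∀ u v,
    dForm ϑ q u v = 2 * ((η q u).re * (η q v).im - (η q u).im * (η q v).re)
  inj : ∀ q ∈ U, ∀ u, ϑ q u = 0 → η q u = 0 → u = 0

/-- The vector `T` of the real frame `T`, `X`, `Y` dual to `ϑ`, `Re η`, `Im η`. -/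
def frT (ϑ : Heis → Heis →L[ℝ] ℝ) (η : Heis → Heis →L[ℝ] ℂ) (q : Heis) : Heis :=
  dualFrame ϑ η q (1, 0)

/-- The vector `X` of the dual frame: `ϑ X = 0`, `η X = 1`. -/
def frX (ϑ : Heis → Heis →L[ℝ] ℝ) (η : Heis → Heis →L[ℝ] ℂ) (q : Heis) : Heis :=
  dualFrame ϑ η q (0, 1)

/-- The vector `Y` of the dual frame: `ϑ Y = 0`, `η Y = i`. -/
def frY (ϑ : Heis → Heis →L[ℝ] ℝ) (η : Heis → Heis →L[ℝ] ℂ) (q : Heis) : Heis :=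
  dualFrame ϑ η q (0, I)

/-- The real part of the complex one-form `η`. -/
def reForm (η : Heis → Heis →L[ℝ] ℂ) (q : Heis) : Heis →L[ℝ] ℝ := reCLM.comp (η q)

/-- The imaginary part of the complex one-form `η`. -/
def imForm (η : Heis → Heis →L[ℝ] ℂ) (q : Heis) : Heis →L[ℝ] ℝ :=
  imCLM.comp (η q)

@[simp] theorem reForm_apply (η : Heis → Heis →L[ℝ] ℂ) (q u : Heis) :
    reForm η q u = (η q u).re := rfl
@[simp] theorem imForm_apply (η : Heis → Heis →L[ℝ] ℂ) (q u : Heis) :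
    imForm η q u = (η q u).im := rfl

/-- The horizontal one-form `λ_f = i (f_{,1} η - f_{,1̄} η̄) = (Y f) Re η - (X f) Im η`. -/
def rotGrad (ϑ : Heis → Heis →L[ℝ] ℝ) (η : Heis → Heis →L[ℝ] ℂ) (f : Heis → ℝ) (q : Heis) :
    Heis →L[ℝ] ℝ :=
  (fderiv ℝ f q (frY ϑ η q)) • reForm η q - (fderiv ℝ f q (frX ϑ η q)) • imForm η q

/-- The vector field `B_f` with `λ_f ∧ ϑ = ι_{B_f} (dx ∧ dy ∧ dt)`. Up to the factor
`-(contactDensity ϑ) / 2` it is the horizontal gradient `(X f) X + (Y f) Y`. -/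
def gradField (ϑ : Heis → Heis →L[ℝ] ℝ) (η : Heis → Heis →L[ℝ] ℂ) (f : Heis → ℝ) (q : Heis) :
    Heis :=
  cross (rotGrad ϑ η f q) (ϑ q)

/-- The real one-form `μ` such that `i μ` is the connection form of the coframe. -/
def connPot (ϑ : Heis → Heis →L[ℝ] ℝ) (η : Heis → Heis →L[ℝ] ℂ) (q : Heis) : Heis →L[ℝ] ℝ :=
  (dForm η q (frX ϑ η q) (frY ϑ η q)).re • reForm η q
    + (dForm η q (frX ϑ η q) (frY ϑ η q)).im • imForm η q
    + (((dForm η q (frT ϑ η q) (frY ϑ η q)).re - (dForm η q (frT ϑ η q) (frX ϑ η q)).im) / 2) • ϑ q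

/-- The purely imaginary one-form `i μ`. -/
def imagForm (μ : Heis → Heis →L[ℝ] ℝ) (q : Heis) : Heis →L[ℝ] ℂ := I • ofRealCLM.comp (μ q)

@[simp] theorem imagForm_apply (μ : Heis → Heis →L[ℝ] ℝ) (q u : Heis) :
    imagForm μ q u = I * (μ q u : ℂ) := rfl

theorem ContDiffOn.dForm {F : Type*} [NormedAddCommGroup F] [NormedSpace ℝ F]
    {α : Heis → Heis →L[ℝ] F} {u v : Heis → Heis} {U : Set Heis} (hU : IsOpen U)
    (hα : ContDiffOn ℝ ∞ α U) (hu : ContDiffOn ℝ ∞ u U) (hv : ContDiffOn ℝ ∞ v U) :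
    ContDiffOn ℝ ∞ (fun q => _root_.dForm α q (u q) (v q)) U := by
  have h := hα.fderiv_of_isOpen hU (m := ∞) (by simp)
  exact ((h.clm_apply hu).clm_apply hv).sub ((h.clm_apply hv).clm_apply hu)

theorem two_le_infty : (2 : WithTop ℕ∞) ≤ ∞ :=
  WithTop.coe_le_coe.2 (le_top : (2 : ℕ∞) ≤ ⊤)

namespace IsCoframe

variable {ϑ : Heis → Heis →L[ℝ] ℝ} {η : Heis → Heis →L[ℝ] ℂ} {U : Set Heis}

theorem mono (h : IsCoframe ϑ η U) {U' : Set Heis} (hU' : IsOpen U') (hs : U' ⊆ U) :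
    IsCoframe ϑ η U' :=
  ⟨hU', h.smooth₁.mono hs, h.smooth₂.mono hs, fun q hq => h.unitary q (hs hq),
    fun q hq => h.inj q (hs hq)⟩

theorem exists_equiv (h : IsCoframe ϑ η U) {q : Heis} (hq : q ∈ U) :
    ∃ e : Heis ≃L[ℝ] ℝ × ℂ, (e : Heis →L[ℝ] ℝ × ℂ) = (ϑ q).prod (η q) := by
  have hinj : Function.Injective ((ϑ q).prod (η q)) := by
    rw [injective_iff_map_eq_zero]
    intro u hu
    have h1 := congrArg Prod.fst hu
    have h2 := congrArg Prod.snd hu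
    exact h.inj q hq u h1 h2
  have hfin : Module.finrank ℝ Heis = Module.finrank ℝ (ℝ × ℂ) := by
    simp [Module.finrank_prod, Complex.finrank_real_complex]
  have hsurj := (LinearMap.injective_iff_surjective_of_finrank_eq_finrank
    (f := ((ϑ q).prod (η q) : Heis →ₗ[ℝ] ℝ × ℂ)) hfin).1 hinj
  refine ⟨ContinuousLinearEquiv.ofBijective ((ϑ q).prod (η q)) (LinearMap.ker_eq_bot.2 hinj)
    (LinearMap.range_eq_top.2 hsurj), ?_⟩
  ext <;> rfl

theorem dualFrame_apply (h : IsCoframe ϑ η U) {q : Heis} (hq : q ∈ U) (x : ℝ × ℂ) :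
    (ϑ q (dualFrame ϑ η q x), η q (dualFrame ϑ η q x)) = x := by
  obtain ⟨e, he⟩ := h.exists_equiv hq
  have : (ϑ q).prod (η q) (dualFrame ϑ η q x) = x := by
    rw [dualFrame, ← he, ContinuousLinearMap.inverse_equiv]; simp
  exact this

theorem dualFrame_coframe (h : IsCoframe ϑ η U) {q : Heis} (hq : q ∈ U) (u : Heis) :
    dualFrame ϑ η q (ϑ q u, η q u) = u := by
  obtain ⟨e, he⟩ := h.exists_equiv hq
  have : dualFrame ϑ η q ((ϑ q).prod (η q) u) = u := by
    rw [dualFrame, ← he, ContinuousLinearMap.inverse_equiv]; simp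
  exact this

variable (h : IsCoframe ϑ η U)
include h

theorem η_T {q : Heis} (hq : q ∈ U) : η q (frT ϑ η q) = 0 :=
  congrArg Prod.snd (h.dualFrame_apply hq (1, 0))
theorem ϑ_X {q : Heis} (hq : q ∈ U) : ϑ q (frX ϑ η q) = 0 :=
  congrArg Prod.fst (h.dualFrame_apply hq (0, 1))
theorem η_X {q : Heis} (hq : q ∈ U) : η q (frX ϑ η q) = 1 :=
  congrArg Prod.snd (h.dualFrame_apply hq (0, 1))
theorem ϑ_Y {q : Heis} (hq : q ∈ U) : ϑ q (frY ϑ η q) = 0 :=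
  congrArg Prod.fst (h.dualFrame_apply hq (0, I))
theorem η_Y {q : Heis} (hq : q ∈ U) : η q (frY ϑ η q) = I :=
  congrArg Prod.snd (h.dualFrame_apply hq (0, I))

theorem expand {q : Heis} (hq : q ∈ U) (u : Heis) :
    u = ϑ q u • frT ϑ η q + (η q u).re • frX ϑ η q + (η q u).im • frY ϑ η q := by
  conv_lhs => rw [← h.dualFrame_coframe hq u]
  rw [frT, frX, frY, ← map_smul, ← map_smul, ← map_smul, ← map_add, ← map_add]
  congr 1
  ext <;> simp

theorem map_expand {F : Type*} [NormedAddCommGroup F] [NormedSpace ℝ F] {q : Heis} (hq : q ∈ U)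
    (l : Heis →L[ℝ] F) (u : Heis) :
    l u = ϑ q u • l (frT ϑ η q) + (η q u).re • l (frX ϑ η q) + (η q u).im • l (frY ϑ η q) := by
  conv_lhs => rw [h.expand hq u]
  simp only [map_add, map_smul]

/-- A two-form in the frame: it is determined by its values on pairs of frame vectors. -/
theorem dForm_expand {F : Type*} [NormedAddCommGroup F] [NormedSpace ℝ F] {q : Heis} (hq : q ∈ U)
    (α : Heis → Heis →L[ℝ] F) (u v : Heis) :
    dForm α q u v =
      ((η q u).re * (η q v).im - (η q u).im * (η q v).re) • dForm α q (frX ϑ η q) (frY ϑ η q)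
      + (ϑ q u * (η q v).re - (η q u).re * ϑ q v) • dForm α q (frT ϑ η q) (frX ϑ η q)
      + (ϑ q u * (η q v).im - (η q u).im * ϑ q v) • dForm α q (frT ϑ η q) (frY ϑ η q) := by
  rw [dForm, h.map_expand hq (fderiv ℝ α q u) v, h.map_expand hq (fderiv ℝ α q v) u,
    h.map_expand hq (fderiv ℝ α q) u, h.map_expand hq (fderiv ℝ α q) v]
  simp only [dForm, add_apply, smul_apply]
  module

theorem contDiffOn_dualFrame : ContDiffOn ℝ ∞ (dualFrame ϑ η) U := by
  intro q hq
  obtain ⟨e, he⟩ := h.exists_equiv hq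
  have h1 : ContDiffAt ℝ ∞ (fun x => (ϑ x).prod (η x)) q := by
    have a := (h.smooth₁.contDiffAt (h.isOpen.mem_nhds hq))
    have b := (h.smooth₂.contDiffAt (h.isOpen.mem_nhds hq))
    exact (ContinuousLinearMap.prodₗᵢ (𝕜 := ℝ) (E := Heis) (F := ℝ) (G := ℂ) ℝ).contDiff.contDiffAt.comp
      q (a.prodMk b)
  have h2 := contDiffAt_map_inverse (n := ∞) (𝕜 := ℝ) e
  rw [he] at h2
  exact (h2.comp q h1).contDiffWithinAt

theorem contDiffOn_T : ContDiffOn ℝ ∞ (frT ϑ η) U :=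
  h.contDiffOn_dualFrame.clm_apply contDiffOn_const
theorem contDiffOn_X : ContDiffOn ℝ ∞ (frX ϑ η) U :=
  h.contDiffOn_dualFrame.clm_apply contDiffOn_const
theorem contDiffOn_Y : ContDiffOn ℝ ∞ (frY ϑ η) U :=
  h.contDiffOn_dualFrame.clm_apply contDiffOn_const

theorem contDiffOn_reForm : ContDiffOn ℝ ∞ (reForm η) U :=
  contDiffOn_const.clm_comp h.smooth₂
theorem contDiffOn_imForm : ContDiffOn ℝ ∞ (imForm η) U :=
  contDiffOn_const.clm_comp h.smooth₂

theorem contDiffOn_connPot : ContDiffOn ℝ ∞ (connPot ϑ η) U := by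
  have hre : ContDiff ℝ ∞ (fun z : ℂ => z.re) := reCLM.contDiff
  have him : ContDiff ℝ ∞ (fun z : ℂ => z.im) := imCLM.contDiff
  have hXY := ContDiffOn.dForm h.isOpen h.smooth₂ h.contDiffOn_X h.contDiffOn_Y
  have hTY := ContDiffOn.dForm h.isOpen h.smooth₂ h.contDiffOn_T h.contDiffOn_Y
  have hTX := ContDiffOn.dForm h.isOpen h.smooth₂ h.contDiffOn_T h.contDiffOn_X
  exact (((hre.comp_contDiffOn hXY).smul h.contDiffOn_reForm).add
    ((him.comp_contDiffOn hXY).smul h.contDiffOn_imForm)).add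
    ((((hre.comp_contDiffOn hTY).sub (him.comp_contDiffOn hTX)).div_const 2).smul h.smooth₁)

/-- The compatibility condition on the structure functions of the coframe that `d (dϑ) = 0`
imposes; it is what makes the connection form purely imaginary. -/
theorem dForm_T_compat {q : Heis} (hq : q ∈ U) :
    (dForm η q (frT ϑ η q) (frX ϑ η q)).re + (dForm η q (frT ϑ η q) (frY ϑ η q)).im = 0 := by
  have hn := h.isOpen.mem_nhds hq
  have hϑ : ContDiffAt ℝ ∞ ϑ q := h.smooth₁.contDiffAt hn
  have hη : HasFDerivAt η (fderiv ℝ η q) q :=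
    ((h.smooth₂.contDiffAt hn).differentiableAt (by simp)).hasFDerivAt
  have hsym : ∀ a b, fderiv ℝ (fderiv ℝ ϑ) q a b = fderiv ℝ (fderiv ℝ ϑ) q b a := fun a b =>
    (hϑ.isSymmSndFDerivAt (by simpa using two_le_infty)) a b
  have hD : HasFDerivAt (fderiv ℝ ϑ) (fderiv ℝ (fderiv ℝ ϑ) q) q :=
    ((hϑ.fderiv_right (m := ∞) (by simp)).differentiableAt (by simp)).hasFDerivAt
  have key : ∀ u v w, fderiv ℝ (fderiv ℝ ϑ) q w u v - fderiv ℝ (fderiv ℝ ϑ) q w v u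
      = 2 * ((fderiv ℝ η q w u).re * (η q v).im + (η q u).re * (fderiv ℝ η q w v).im
        - ((fderiv ℝ η q w u).im * (η q v).re + (η q u).im * (fderiv ℝ η q w v).re)) := by
    intro u v w
    have e : (fun x => dForm ϑ x u v) =ᶠ[𝓝 q]
        fun x => 2 * ((η x u).re * (η x v).im - (η x u).im * (η x v).re) := by
      filter_upwards [hn] with x hx using h.unitary x hx u v
    have d1 : HasFDerivAt (fun x => dForm ϑ x u v) _ q :=
      ((hD.clm_apply (hasFDerivAt_const u q)).clm_apply (hasFDerivAt_const v q)).sub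
      ((hD.clm_apply (hasFDerivAt_const v q)).clm_apply (hasFDerivAt_const u q))
    have r : ∀ a, HasFDerivAt (fun x => (η x a).re) _ q := fun a =>
      reCLM.hasFDerivAt.comp q (hη.clm_apply (hasFDerivAt_const a q))
    have i : ∀ a, HasFDerivAt (fun x => (η x a).im) _ q := fun a =>
      imCLM.hasFDerivAt.comp q (hη.clm_apply (hasFDerivAt_const a q))
    have d2 := (((r u).mul (i v)).sub ((i u).mul (r v))).const_mul 2
    have := congrArg (fun L => L w) ((d2.congr_of_eventuallyEq e).unique d1)
    simp at this
    linarith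
  have k1 := key (frT ϑ η q) (frX ϑ η q) (frY ϑ η q)
  have k2 := key (frX ϑ η q) (frY ϑ η q) (frT ϑ η q)
  have k3 := key (frY ϑ η q) (frT ϑ η q) (frX ϑ η q)
  rw [hsym (frY ϑ η q) (frX ϑ η q), hsym (frY ϑ η q) (frT ϑ η q)] at k1
  rw [hsym (frX ϑ η q) (frT ϑ η q)] at k3
  simp only [h.η_T hq, h.η_X hq, h.η_Y hq] at k1 k2 k3
  simp at k1 k2 k3
  simp only [dForm, Complex.sub_re, Complex.sub_im]
  linarith

/-- Every unitary coframe has a connection form. -/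
theorem isConnectionForm : IsConnectionForm ϑ η U (imagForm (connPot ϑ η)) where
  smooth := by
    have : ContDiffOn ℝ ∞ (fun q => ofRealCLM.comp (connPot ϑ η q)) U :=
      contDiffOn_const.clm_comp h.contDiffOn_connPot
    exact this.const_smul I
  imaginary q _ u := by simp
  structure_eq := by
    refine ⟨fun q => dForm η q (frT ϑ η q) (frX ϑ η q) + I * (((dForm η q (frT ϑ η q)
      (frY ϑ η q)).re - (dForm η q (frT ϑ η q) (frX ϑ η q)).im) / 2 : ℝ), fun q hq u v => ?_⟩
    have hc := h.dForm_T_compat hq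
    rw [h.dForm_expand hq]
    simp only [wedge, toC, conjForm, imagForm_apply, connPot, add_apply,
      smul_apply, reForm_apply, imForm_apply, smul_eq_mul]
    set p := dForm η q (frX ϑ η q) (frY ϑ η q)
    set t := dForm η q (frT ϑ η q) (frX ϑ η q)
    set k := dForm η q (frT ϑ η q) (frY ϑ η q)
    have hk : k.im = - t.re := by linarith
    apply Complex.ext
    · simp
      ring
    · simp [hk]
      ring

end IsCoframe

/-! ### The horizontal gradient and the sublaplacian -/

namespace IsCoframe

variable {ϑ : Heis → Heis →L[ℝ] ℝ} {η : Heis → Heis →L[ℝ] ℂ} {U : Set Heis} (h : IsCoframe ϑ η U)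
include h

theorem contactDensity_eq {q : Heis} (hq : q ∈ U) :
    contactDensity ϑ q = 2 * reForm η q (cross (imForm η q) (ϑ q)) := by
  rw [contactDensity, h.unitary q hq, h.unitary q hq, h.unitary q hq, map_cross]
  simp only [reForm_apply, imForm_apply]
  ring

theorem cross_im {q : Heis} (hq : q ∈ U) :
    cross (imForm η q) (ϑ q) = (contactDensity ϑ q / 2) • frX ϑ η q := by
  rw [h.expand hq (cross (imForm η q) (ϑ q)), cross_self_right]
  have h1 : (η q (cross (imForm η q) (ϑ q))).im = 0 := cross_self_left (imForm η q) (ϑ q)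
  have h2 : (η q (cross (imForm η q) (ϑ q))).re = contactDensity ϑ q / 2 := by
    rw [h.contactDensity_eq hq]; simp
  rw [h1, h2]; simp

theorem cross_re {q : Heis} (hq : q ∈ U) :
    cross (reForm η q) (ϑ q) = -(contactDensity ϑ q / 2) • frY ϑ η q := by
  rw [h.expand hq (cross (reForm η q) (ϑ q)), cross_self_right]
  have h1 : (η q (cross (reForm η q) (ϑ q))).re = 0 := cross_self_left (reForm η q) (ϑ q)
  have h2 : (η q (cross (reForm η q) (ϑ q))).im = -(contactDensity ϑ q / 2) := by
    have : (η q (cross (reForm η q) (ϑ q))).im = imForm η q (cross (reForm η q) (ϑ q)) := rfl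
    rw [this, h.contactDensity_eq hq, map_cross, map_cross]; ring
  rw [h1, h2]; simp

theorem gradField_eq {q : Heis} (hq : q ∈ U) (f : Heis → ℝ) :
    gradField ϑ η f q = -(contactDensity ϑ q / 2) •
      (fderiv ℝ f q (frX ϑ η q) • frX ϑ η q + fderiv ℝ f q (frY ϑ η q) • frY ϑ η q) := by
  rw [gradField, rotGrad, ← crossL_apply, map_sub, map_smul, map_smul, sub_apply, smul_apply,
    smul_apply, crossL_apply, crossL_apply, h.cross_im hq, h.cross_re hq]
  module

/-- `-dg(B_f)` is a positive multiple of the inner product of the horizontal gradients wherever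
`ϑ ∧ dϑ` is positive. -/
theorem fderiv_gradField {q : Heis} (hq : q ∈ U) (f g : Heis → ℝ) :
    fderiv ℝ g q (gradField ϑ η f q) = -(contactDensity ϑ q / 2) *
      (fderiv ℝ f q (frX ϑ η q) * fderiv ℝ g q (frX ϑ η q)
        + fderiv ℝ f q (frY ϑ η q) * fderiv ℝ g q (frY ϑ η q)) := by
  rw [h.gradField_eq hq]; simp; ring

/-- The bilinear form `(f, g) ↦ dg(B_f)` is symmetric, which is what Green's identity needs. -/
theorem fderiv_gradField_symm {q : Heis} (hq : q ∈ U) (f g : Heis → ℝ) :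
    fderiv ℝ g q (gradField ϑ η f q) = fderiv ℝ f q (gradField ϑ η g q) := by
  rw [h.fderiv_gradField hq, h.fderiv_gradField hq]; ring

theorem contDiffOn_fderiv_X {f : Heis → ℝ} (hf : ContDiffOn ℝ ∞ f U) :
    ContDiffOn ℝ ∞ (fun q => fderiv ℝ f q (frX ϑ η q)) U :=
  (hf.fderiv_of_isOpen h.isOpen (m := ∞) (by simp)).clm_apply h.contDiffOn_X

theorem contDiffOn_fderiv_Y {f : Heis → ℝ} (hf : ContDiffOn ℝ ∞ f U) :
    ContDiffOn ℝ ∞ (fun q => fderiv ℝ f q (frY ϑ η q)) U :=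
  (hf.fderiv_of_isOpen h.isOpen (m := ∞) (by simp)).clm_apply h.contDiffOn_Y

theorem contDiffOn_rotGrad {f : Heis → ℝ} (hf : ContDiffOn ℝ ∞ f U) :
    ContDiffOn ℝ ∞ (rotGrad ϑ η f) U :=
  ((h.contDiffOn_fderiv_Y hf).smul h.contDiffOn_reForm).sub
    ((h.contDiffOn_fderiv_X hf).smul h.contDiffOn_imForm)

theorem contDiffOn_gradField {f : Heis → ℝ} (hf : ContDiffOn ℝ ∞ f U) :
    ContDiffOn ℝ ∞ (gradField ϑ η f) U :=
  (h.contDiffOn_rotGrad hf).cross h.smooth₁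

theorem contDiffOn_contactDensity : ContDiffOn ℝ ∞ (contactDensity ϑ) U := by
  have c : ∀ v : Heis, ContDiffOn ℝ ∞ (fun _ : Heis => v) U := fun v => contDiffOn_const
  have a : ∀ v : Heis, ContDiffOn ℝ ∞ (fun q => ϑ q v) U := fun v => h.smooth₁.clm_apply (c v)
  have d : ∀ u v : Heis, ContDiffOn ℝ ∞ (fun q => dForm ϑ q u v) U := fun u v =>
    ContDiffOn.dForm h.isOpen h.smooth₁ (c u) (c v)
  exact (((a _).mul (d _ _)).sub ((a _).mul (d _ _))).add ((a _).mul (d _ _))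

omit h in
theorem gradField_smul_const {q : Heis} {f g : Heis → ℝ} {k : ℝ}
    (hk : fderiv ℝ f q = k • fderiv ℝ g q) : gradField ϑ η f q = k • gradField ϑ η g q := by
  rw [gradField, gradField, rotGrad, rotGrad, hk, ← crossL_apply, ← crossL_apply, ← smul_apply,
    ← map_smul, smul_sub, smul_smul, smul_smul]
  rfl

/-- The sublaplacian in divergence form. -/
theorem divg_gradField {f : Heis → ℝ} (hf : ContDiffOn ℝ ∞ f U) {q : Heis} (hq : q ∈ U) :
    subLaplacian ϑ η (imagForm (connPot ϑ η)) (fun x => (f x : ℂ)) q * contactDensity ϑ q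
      = -(divg (gradField ϑ η f) q : ℝ) := by
  have hn := h.isOpen.mem_nhds hq
  have hfd : ∀ x ∈ U, HasFDerivAt f (fderiv ℝ f x) x := fun x hx =>
    ((hf.contDiffAt (h.isOpen.mem_nhds hx)).differentiableAt (by simp)).hasFDerivAt
  have hX : HasFDerivAt (fun x => fderiv ℝ f x (frX ϑ η x))
      (fderiv ℝ (fun x => fderiv ℝ f x (frX ϑ η x)) q) q :=
    (((h.contDiffOn_fderiv_X hf).contDiffAt hn).differentiableAt (by simp)).hasFDerivAt
  have hY : HasFDerivAt (fun x => fderiv ℝ f x (frY ϑ η x))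
      (fderiv ℝ (fun x => fderiv ℝ f x (frY ϑ η x)) q) q :=
    (((h.contDiffOn_fderiv_Y hf).contDiffAt hn).differentiableAt (by simp)).hasFDerivAt
  have hη : HasFDerivAt η (fderiv ℝ η q) q :=
    ((h.smooth₂.contDiffAt hn).differentiableAt (by simp)).hasFDerivAt
  have hϑ : DifferentiableAt ℝ ϑ q := (h.smooth₁.contDiffAt hn).differentiableAt (by simp)
  set DX := fderiv ℝ (fun x => fderiv ℝ f x (frX ϑ η x)) q with hDX
  set DY := fderiv ℝ (fun x => fderiv ℝ f x (frY ϑ η x)) q with hDY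
  set fX := fderiv ℝ f q (frX ϑ η q) with hfX
  set fY := fderiv ℝ f q (frY ϑ η q) with hfY
  set d := dForm η q (frX ϑ η q) (frY ϑ η q) with hd
  -- the sublaplacian in terms of the real frame
  have hcx : ∀ x ∈ U, fderiv ℝ (fun x => (f x : ℂ)) x = ofRealCLM.comp (fderiv ℝ f x) :=
    fun x hx => (ofRealCLM.hasFDerivAt.comp x (hfd x hx)).fderiv
  have hdx : HasFDerivAt (fun x => ((fderiv ℝ f x (frX ϑ η x) : ℝ) : ℂ)) (ofRealCLM.comp DX) q :=
    ofRealCLM.hasFDerivAt.comp q hX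
  have hdy : HasFDerivAt (fun x => ((fderiv ℝ f x (frY ϑ η x) : ℝ) : ℂ)) (ofRealCLM.comp DY) q :=
    ofRealCLM.hasFDerivAt.comp q hY
  have hZ : ∀ v, fderiv ℝ (derivZ ϑ η fun x => (f x : ℂ)) q v = ((DX v : ℝ) - I * (DY v : ℝ)) / 2 := by
    intro v
    have e : (derivZ ϑ η fun x => (f x : ℂ)) =ᶠ[𝓝 q] fun x =>
        (((fderiv ℝ f x (frX ϑ η x) : ℝ) : ℂ) - I * ((fderiv ℝ f x (frY ϑ η x) : ℝ) : ℂ)) * (1 / 2) := by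
      filter_upwards [hn] with x hx
      rw [derivZ, onZ, hcx x hx]
      simp [frX, frY]; ring
    have := (((hdx.sub (hdy.const_mul I)).mul_const (1 / 2)).congr_of_eventuallyEq e).fderiv
    rw [this]; simp; ring
  have hZb : ∀ v, fderiv ℝ (derivZbar ϑ η fun x => (f x : ℂ)) q v
      = ((DX v : ℝ) + I * (DY v : ℝ)) / 2 := by
    intro v
    have e : (derivZbar ϑ η fun x => (f x : ℂ)) =ᶠ[𝓝 q] fun x =>
        (((fderiv ℝ f x (frX ϑ η x) : ℝ) : ℂ) + I * ((fderiv ℝ f x (frY ϑ η x) : ℝ) : ℂ)) * (1 / 2) := by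
      filter_upwards [hn] with x hx
      rw [derivZbar, onZbar, hcx x hx]
      simp [frX, frY]; ring
    have := (((hdx.add (hdy.const_mul I)).mul_const (1 / 2)).congr_of_eventuallyEq e).fderiv
    rw [this]; simp; ring
  have hsub : subLaplacian ϑ η (imagForm (connPot ϑ η)) (fun x => (f x : ℂ)) q
      = ((DX (frX ϑ η q) + DY (frY ϑ η q) + d.im * fX - d.re * fY) / 2 : ℝ) := by
    have z : derivZ ϑ η (fun x => (f x : ℂ)) q = ((fX : ℂ) - I * fY) / 2 := by
      rw [derivZ, onZ, hcx q hq]; rfl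
    have zb : derivZbar ϑ η (fun x => (f x : ℂ)) q = ((fX : ℂ) + I * fY) / 2 := by
      rw [derivZbar, onZbar, hcx q hq]; rfl
    have oz : onZ ϑ η q (imagForm (connPot ϑ η) q) = (I * d.re + d.im) / 2 := by
      rw [onZ, ← frX, ← frY]
      simp only [imagForm_apply, connPot, add_apply, smul_apply, reForm_apply, imForm_apply,
        h.η_X hq, h.η_Y hq, h.ϑ_X hq, h.ϑ_Y hq]
      simp [← hd]
      linear_combination (-(d.im : ℂ)) * Complex.I_sq
    have ozb : onZbar ϑ η q (imagForm (connPot ϑ η) q) = (I * d.re - d.im) / 2 := by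
      rw [onZbar, ← frX, ← frY]
      simp only [imagForm_apply, connPot, add_apply, smul_apply, reForm_apply, imForm_apply,
        h.η_X hq, h.η_Y hq, h.ϑ_X hq, h.ϑ_Y hq]
      simp [← hd]
      linear_combination (d.im : ℂ) * Complex.I_sq
    rw [subLaplacian, z, zb, oz, ozb, derivZbar, derivZ, onZ, onZbar, ← frX, ← frY, hZ, hZ, hZb, hZb]
    push_cast
    linear_combination (-(DY (frY ϑ η q) : ℂ) / 2 + d.re * fY / 2) * Complex.I_sq
  -- the divergence
  have hrot : ∀ a b, dForm (rotGrad ϑ η f) q a b =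
      DY a * (η q b).re - DY b * (η q a).re + fY * (dForm η q a b).re
      - (DX a * (η q b).im - DX b * (η q a).im) - fX * (dForm η q a b).im := by
    intro a b
    have r : HasFDerivAt (reForm η) _ q := (hasFDerivAt_const reCLM q).clm_comp hη
    have i : HasFDerivAt (imForm η) _ q := (hasFDerivAt_const imCLM q).clm_comp hη
    have hr : HasFDerivAt (rotGrad ϑ η f) _ q := (hY.smul r).sub (hX.smul i)
    rw [dForm, hr.fderiv]
    simp [dForm]
    ring
  have hdiff : DifferentiableAt ℝ (rotGrad ϑ η f) q :=
    ((h.contDiffOn_rotGrad hf).contDiffAt hn).differentiableAt (by simp)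
  have hdiv : divg (gradField ϑ η f) q = -((DX (frX ϑ η q) + DY (frY ϑ η q) + d.im * fX
      - d.re * fY) / 2 * contactDensity ϑ q) := by
    unfold gradField
    rw [divg_cross hdiff hϑ, h.contactDensity_eq hq, map_cross]
    simp only [hrot, h.unitary q hq, h.dForm_expand hq η ex, h.dForm_expand hq η ey,
      h.map_expand hq DX ex, h.map_expand hq DX ey, h.map_expand hq DX et,
      h.map_expand hq DY ex, h.map_expand hq DY ey, h.map_expand hq DY et, rotGrad,
      sub_apply, smul_apply, reForm_apply, imForm_apply, smul_eq_mul, ← hfX, ← hfY, ← hd,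
      Complex.add_re, Complex.add_im, Complex.real_smul, Complex.re_ofReal_mul,
      Complex.im_ofReal_mul]
    ring
  rw [hsub, hdiv]
  push_cast
  ring

end IsCoframe

/-! ### Change of the coframe and of its connection form -/

/-- The pullback of a one-form by a map of the coordinate space. -/
def pullForm {F : Type*} [NormedAddCommGroup F] [NormedSpace ℝ F] (f : Heis → Heis)
    (α : Heis → Heis →L[ℝ] F) (q : Heis) : Heis →L[ℝ] F :=
  (α (f q)).comp (fderiv ℝ f q)

/-- The contact form `u² ϑ`. -/
def scaledForm (u : Heis → ℝ) (ϑ : Heis → Heis →L[ℝ] ℝ) (q : Heis) : Heis →L[ℝ] ℝ :=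
  (u q ^ 2) • ϑ q

/-- The unitary coframe `u η + (i X u - Y u) ϑ = u (η + 2 i (log u)_{,1̄} ϑ)` of `u² ϑ`. -/
def scaledCoframe (u : Heis → ℝ) (ϑ : Heis → Heis →L[ℝ] ℝ) (η : Heis → Heis →L[ℝ] ℂ) (q : Heis) :
    Heis →L[ℝ] ℂ :=
  (u q : ℂ) • η q + (I * (fderiv ℝ u q (frX ϑ η q) : ℝ) - (fderiv ℝ u q (frY ϑ η q) : ℝ) : ℂ) •
    ofRealCLM.comp (ϑ q)

/-- `i ν` is, modulo `ϑ`, the connection form of the coframe `(ϑ, η, η̄)` at `q`. -/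
def IsConnMod (ϑ : Heis → Heis →L[ℝ] ℝ) (η : Heis → Heis →L[ℝ] ℂ) (q : Heis)
    (ν : Heis →L[ℝ] ℝ) : Prop :=
  ∀ a b, ϑ q a = 0 → ϑ q b = 0 →
    dForm η q a b = η q a * (I * (ν b : ℂ)) - η q b * (I * (ν a : ℂ))

theorem dForm_smul {α : Heis → Heis →L[ℝ] ℝ} {f : Heis → ℝ} {q : Heis}
    (hf : DifferentiableAt ℝ f q) (hα : DifferentiableAt ℝ α q) (a b : Heis) :
    dForm (fun x => f x • α x) q a b =
      fderiv ℝ f q a * α q b - fderiv ℝ f q b * α q a + f q * dForm α q a b := by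
  have h : HasFDerivAt (fun x => f x • α x) _ q := hf.hasFDerivAt.smul hα.hasFDerivAt
  rw [dForm, h.fderiv]
  simp [dForm]; ring

theorem dForm_add {F : Type*} [NormedAddCommGroup F] [NormedSpace ℝ F]
    {α β : Heis → Heis →L[ℝ] F} {q : Heis}
    (hα : DifferentiableAt ℝ α q) (hβ : DifferentiableAt ℝ β q) (a b : Heis) :
    dForm (fun x => α x + β x) q a b = dForm α q a b + dForm β q a b := by
  have h : HasFDerivAt (fun x => α x + β x) _ q := hα.hasFDerivAt.add hβ.hasFDerivAt
  rw [dForm, h.fderiv]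
  simp [dForm]; abel

theorem dForm_csmul {α : Heis → Heis →L[ℝ] ℂ} {f : Heis → ℂ} {q : Heis}
    (hf : DifferentiableAt ℝ f q) (hα : DifferentiableAt ℝ α q) (a b : Heis) :
    dForm (fun x => f x • α x) q a b =
      fderiv ℝ f q a * α q b - fderiv ℝ f q b * α q a + f q * dForm α q a b := by
  have h : HasFDerivAt (fun x => f x • α x) _ q := hf.hasFDerivAt.smul hα.hasFDerivAt
  rw [dForm, h.fderiv]
  simp [dForm]; ring

theorem dForm_pullForm {F : Type*} [NormedAddCommGroup F] [NormedSpace ℝ F] {f : Heis → Heis}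
    {α : Heis → Heis →L[ℝ] F} {q : Heis} (hf : ContDiffAt ℝ ∞ f q)
    (hα : DifferentiableAt ℝ α (f q)) (a b : Heis) :
    dForm (pullForm f α) q a b = dForm α (f q) (fderiv ℝ f q a) (fderiv ℝ f q b) := by
  have h1 : HasFDerivAt f (fderiv ℝ f q) q := (hf.differentiableAt (by simp)).hasFDerivAt
  have h2 : HasFDerivAt (fderiv ℝ f) (fderiv ℝ (fderiv ℝ f) q) q :=
    ((hf.fderiv_right (m := ∞) (by simp)).differentiableAt (by simp)).hasFDerivAt
  have h : HasFDerivAt (pullForm f α) _ q := (hα.hasFDerivAt.comp q h1).clm_comp h2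
  have hsym : fderiv ℝ (fderiv ℝ f) q a b = fderiv ℝ (fderiv ℝ f) q b a :=
    (hf.isSymmSndFDerivAt (by simpa using two_le_infty)) a b
  rw [dForm, h.fderiv]
  simp [dForm, hsym]

namespace IsCoframe

variable {ϑ : Heis → Heis →L[ℝ] ℝ} {η : Heis → Heis →L[ℝ] ℂ} {U : Set Heis} (h : IsCoframe ϑ η U)
include h

theorem differentiableAt₁ {q : Heis} (hq : q ∈ U) : DifferentiableAt ℝ ϑ q :=
  (h.smooth₁.contDiffAt (h.isOpen.mem_nhds hq)).differentiableAt (by simp)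

theorem differentiableAt₂ {q : Heis} (hq : q ∈ U) : DifferentiableAt ℝ η q :=
  (h.smooth₂.contDiffAt (h.isOpen.mem_nhds hq)).differentiableAt (by simp)

theorem isConnMod_connPot {q : Heis} (hq : q ∈ U) : IsConnMod ϑ η q (connPot ϑ η q) := by
  intro a b ha hb
  obtain ⟨c, hc⟩ := h.isConnectionForm.structure_eq
  rw [hc q hq a b]
  simp [wedge, toC, ha, hb]

/-- The two-form `ν ∧ ϑ` depends only on the connection form modulo `ϑ`. -/
theorem isConnMod_unique {q : Heis} (hq : q ∈ U) {ν ν' : Heis →L[ℝ] ℝ} (hν : IsConnMod ϑ η q ν)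
    (hν' : IsConnMod ϑ η q ν') (a b : Heis) :
    ν a * ϑ q b - ν b * ϑ q a = ν' a * ϑ q b - ν' b * ϑ q a := by
  have e := (hν _ _ (h.ϑ_X hq) (h.ϑ_Y hq)).symm.trans (hν' _ _ (h.ϑ_X hq) (h.ϑ_Y hq))
  rw [h.η_X hq, h.η_Y hq] at e
  have e1 := congrArg Complex.re e
  have e2 := congrArg Complex.im e
  simp at e1 e2
  rw [h.map_expand hq ν a, h.map_expand hq ν b, h.map_expand hq ν' a, h.map_expand hq ν' b, e1, e2]
  simp only [smul_eq_mul]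
  ring

theorem contDiffOn_scaledCoframe {u : Heis → ℝ} (hu : ContDiffOn ℝ ∞ u U) :
    ContDiffOn ℝ ∞ (scaledCoframe u ϑ η) U := by
  have c : ContDiff ℝ ∞ (fun x : ℝ => (x : ℂ)) := ofRealCLM.contDiff
  have k : ContDiffOn ℝ ∞ (fun q => ofRealCLM.comp (ϑ q)) U :=
    contDiffOn_const.clm_comp h.smooth₁
  exact ((c.comp_contDiffOn hu).smul h.smooth₂).add
    (((contDiffOn_const.mul (c.comp_contDiffOn (h.contDiffOn_fderiv_X hu))).sub
      (c.comp_contDiffOn (h.contDiffOn_fderiv_Y hu))).smul k)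

theorem fderiv_horizontal {q : Heis} (hq : q ∈ U) (u : Heis → ℝ) {a : Heis} (ha : ϑ q a = 0) :
    fderiv ℝ u q a = (η q a).re * fderiv ℝ u q (frX ϑ η q)
      + (η q a).im * fderiv ℝ u q (frY ϑ η q) := by
  rw [h.map_expand hq _ a, ha]; simp

theorem scaled {u : Heis → ℝ} (hu : ContDiffOn ℝ ∞ u U) (h0 : ∀ q ∈ U, u q ≠ 0) :
    IsCoframe (scaledForm u ϑ) (scaledCoframe u ϑ η) U where
  isOpen := h.isOpen
  smooth₁ := (hu.pow 2).smul h.smooth₁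
  smooth₂ := h.contDiffOn_scaledCoframe hu
  unitary q hq a b := by
    have hd : HasFDerivAt u (fderiv ℝ u q) q :=
      ((hu.contDiffAt (h.isOpen.mem_nhds hq)).differentiableAt (by simp)).hasFDerivAt
    have hd2 := hd.pow 2
    have e : dForm (scaledForm u ϑ) q a b = _ :=
      dForm_smul hd2.differentiableAt (h.differentiableAt₁ hq) a b
    rw [e, hd2.fderiv, h.unitary q hq]
    simp only [scaledCoframe, add_apply, smul_apply, h.map_expand hq (fderiv ℝ u q) a,
      h.map_expand hq (fderiv ℝ u q) b]
    simp
    ring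
  inj q hq a h1 h2 := by
    have hz := h0 q hq
    have h1' : ϑ q a = 0 := by simpa [scaledForm, hz] using h1
    refine h.inj q hq a h1' ?_
    simpa [scaledCoframe, h1', hz] using h2

/-- The transformation law of the connection form: `ω̃ = ω - 3 (f_{,1̄} η̄ - f_{,1} η)` modulo `ϑ`,
where `f = log u`. -/
theorem isConnMod_scaled {u : Heis → ℝ} (hu : ContDiffOn ℝ ∞ u U) {q : Heis} (hq : q ∈ U)
    (h0 : u q ≠ 0) {ν : Heis →L[ℝ] ℝ} (hν : IsConnMod ϑ η q ν) :
    IsConnMod (scaledForm u ϑ) (scaledCoframe u ϑ η) q (ν - (3 / u q) • rotGrad ϑ η u q) := by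
  intro a b ha hb
  have ha' : ϑ q a = 0 := by simpa [scaledForm, h0] using ha
  have hb' : ϑ q b = 0 := by simpa [scaledForm, h0] using hb
  have hn := h.isOpen.mem_nhds hq
  have hud : HasFDerivAt u (fderiv ℝ u q) q :=
    ((hu.contDiffAt hn).differentiableAt (by simp)).hasFDerivAt
  have huc : HasFDerivAt (fun x => (u x : ℂ)) (ofRealCLM.comp (fderiv ℝ u q)) q :=
    ofRealCLM.hasFDerivAt.comp q hud
  have c : ContDiff ℝ ∞ (fun x : ℝ => (x : ℂ)) := ofRealCLM.contDiff
  have hk : DifferentiableAt ℝ (fun q => (I * (fderiv ℝ u q (frX ϑ η q) : ℝ)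
      - (fderiv ℝ u q (frY ϑ η q) : ℝ) : ℂ)) q :=
    (((contDiffOn_const.mul (c.comp_contDiffOn (h.contDiffOn_fderiv_X hu))).sub
      (c.comp_contDiffOn (h.contDiffOn_fderiv_Y hu))).contDiffAt hn).differentiableAt (by simp)
  have hϑc : HasFDerivAt (fun q => ofRealCLM.comp (ϑ q)) _ q :=
    (hasFDerivAt_const ofRealCLM q).clm_comp (h.differentiableAt₁ hq).hasFDerivAt
  have d1 := dForm_csmul huc.differentiableAt (h.differentiableAt₂ hq) a b
  have d2 := dForm_csmul hk hϑc.differentiableAt a b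
  have d3 : dForm (fun q => ofRealCLM.comp (ϑ q)) q a b = (dForm ϑ q a b : ℝ) := by
    rw [dForm, hϑc.fderiv]; simp [dForm]
  have d4 : dForm (scaledCoframe u ϑ η) q a b = _ :=
    (dForm_add (huc.differentiableAt.smul (h.differentiableAt₂ hq))
      (hk.smul hϑc.differentiableAt) a b).trans (congrArg₂ (· + ·) d1 d2)
  rw [d4, d3, h.unitary q hq, hν a b ha' hb', huc.fderiv]
  simp only [scaledCoframe, add_apply, sub_apply, smul_apply, rotGrad,
    ContinuousLinearMap.comp_apply, ofRealCLM_apply, ha', hb', reForm_apply,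
    imForm_apply, h.fderiv_horizontal hq u ha', h.fderiv_horizontal hq u hb', smul_eq_mul]
  have hu3 : u q * (3 / u q) = 3 := by field_simp
  set fX := fderiv ℝ u q (frX ϑ η q)
  set fY := fderiv ℝ u q (frY ϑ η q)
  set k := 3 / u q
  have hu3' : (u q : ℂ) * (k : ℂ) = 3 := by exact_mod_cast hu3
  have e2 : ∀ z w : ℂ, (u q : ℂ) * z * (I * ((ν b - k * (fY * (η q b).re - fX * (η q b).im) : ℝ) : ℂ))
      - (u q : ℂ) * w * (I * ((ν a - k * (fY * (η q a).re - fX * (η q a).im) : ℝ) : ℂ))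
      = (u q : ℂ) * z * (I * ν b) - (u q : ℂ) * w * (I * ν a)
      - 3 * I * (z * ((fY * (η q b).re - fX * (η q b).im : ℝ) : ℂ)
        - w * ((fY * (η q a).re - fX * (η q a).im : ℝ) : ℂ)) := by
    intro z w
    push_cast
    linear_combination (-I * (z * (fY * (η q b).re - fX * (η q b).im)
      - w * (fY * (η q a).re - fX * (η q a).im))) * hu3'
  simp only [ofReal_zero, mul_zero, sub_zero, add_zero]
  rw [e2]
  apply Complex.ext <;> simp <;> ring

theorem pullForm {f : Heis → Heis} {U' : Set Heis} (hU' : IsOpen U') (hf : ContDiffOn ℝ ∞ f U')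
    (hm : MapsTo f U' U) (hi : ∀ q ∈ U', ∀ a, fderiv ℝ f q a = 0 → a = 0) :
    IsCoframe (pullForm f ϑ) (_root_.pullForm f η) U' where
  isOpen := hU'
  smooth₁ := (h.smooth₁.comp hf hm).clm_comp (hf.fderiv_of_isOpen hU' (by simp))
  smooth₂ := (h.smooth₂.comp hf hm).clm_comp (hf.fderiv_of_isOpen hU' (by simp))
  unitary q hq a b := by
    rw [dForm_pullForm (hf.contDiffAt (hU'.mem_nhds hq)) (h.differentiableAt₁ (hm hq)),
      h.unitary _ (hm hq)]
    rfl
  inj q hq a h1 h2 := hi q hq a (h.inj _ (hm hq) _ h1 h2)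

theorem isConnMod_pullForm {f : Heis → Heis} {q : Heis} (hf : ContDiffAt ℝ ∞ f q) (hq : f q ∈ U)
    {ν : Heis →L[ℝ] ℝ} (hν : IsConnMod ϑ η (f q) ν) :
    IsConnMod (_root_.pullForm f ϑ) (_root_.pullForm f η) q (ν.comp (fderiv ℝ f q)) := by
  intro a b ha hb
  rw [dForm_pullForm hf (h.differentiableAt₂ hq)]
  exact hν _ _ ha hb

/-- Multiplication of `η` by a unitary function. -/
theorem rotate {g : Heis → ℂ} (hg : ContDiffOn ℝ ∞ g U) (h1 : ∀ q ∈ U, ‖g q‖ = 1) :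
    IsCoframe ϑ (fun q => g q • η q) U where
  isOpen := h.isOpen
  smooth₁ := h.smooth₁
  smooth₂ := hg.smul h.smooth₂
  unitary q hq a b := by
    rw [h.unitary q hq]
    have := h1 q hq
    have h2 : (g q).re ^ 2 + (g q).im ^ 2 = 1 := by
      have e := Complex.sq_norm (g q)
      rw [this, Complex.normSq_apply] at e
      linarith
    simp
    linear_combination (-1 * ((η q a).re * (η q b).im - (η q a).im * (η q b).re)) * h2
  inj q hq a ha hb := by
    refine h.inj q hq a ha ?_
    have : g q ≠ 0 := fun h0 => by have := h1 q hq; simp [h0] at this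
    simpa [this] using hb

/-- Multiplication of `η` by a unitary function `g` with `dg = i g κ` changes `ν` by `-κ`. -/
theorem isConnMod_rotate {g : Heis → ℂ} {q : Heis} (hq : q ∈ U) (hg : DifferentiableAt ℝ g q)
    {κ ν : Heis →L[ℝ] ℝ} (hκ : ∀ a, fderiv ℝ g q a = g q * (I * (κ a : ℂ)))
    (hν : IsConnMod ϑ η q ν) : IsConnMod ϑ (fun q => g q • η q) q (ν - κ) := by
  intro a b ha hb
  rw [dForm_csmul hg (h.differentiableAt₂ hq), hν a b ha hb, hκ, hκ]
  simp
  ring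

end IsCoframe

/-! ### The CR inversion -/

/-- The differential of `arg v`, that is, `Im (dv / v)`. -/
def argForm (q : Heis) : Heis →L[ℝ] ℝ := imCLM.comp ((heisV q)⁻¹ • fderiv ℝ heisV q)

theorem argForm_apply (q a : Heis) : argForm q a = ((heisV q)⁻¹ * fderiv ℝ heisV q a).im := rfl

theorem heisN_eq_norm_sq (q : Heis) : heisN q = ‖heisV q‖ ^ 2 := (norm_heisV_sq q).symm

theorem heisNorm_sq (q : Heis) : heisNorm q ^ 2 = ‖heisV q‖ := by
  have h := heisNorm_pow_four q
  rw [heisN_eq_norm_sq, show (4 : ℕ) = 2 * 2 by rfl, pow_mul] at h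
  exact (pow_left_inj₀ (by positivity) (norm_nonneg _) (by norm_num)).1 h

theorem heisN_pos {q : Heis} (hq : q ≠ 0) : 0 < heisN q := by
  refine lt_of_le_of_ne (heisN_nonneg q) fun h0 => hq ?_
  have h1 : ‖q.1‖ ^ 4 = 0 := by
    have := sq_nonneg q.2; have := pow_nonneg (norm_nonneg q.1) 4; unfold heisN at h0; linarith
  have h2 : q.2 ^ 2 = 0 := by
    have := sq_nonneg q.2; have := pow_nonneg (norm_nonneg q.1) 4; unfold heisN at h0; linarith
  exact Prod.ext (by simpa using h1) (by simpa using h2)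

theorem heisV_ne_zero {q : Heis} (hq : q ≠ 0) : heisV q ≠ 0 := fun h0 => by
  have := heisN_pos hq; rw [heisN_eq_norm_sq, h0] at this; simp at this

theorem heisNorm_pos {q : Heis} (hq : q ≠ 0) : 0 < heisNorm q := by
  refine lt_of_le_of_ne (heisNorm_nonneg q) fun h0 => (heisN_pos hq).ne' ?_
  rw [← heisNorm_pow_four, ← h0]; simp

theorem heisNorm_zero : heisNorm 0 = 0 := by simp [heisNorm]

theorem ne_zero_of_heisNorm_pos {q : Heis} (hq : 0 < heisNorm q) : q ≠ 0 := by
  rintro rfl; rw [heisNorm_zero] at hq; exact lt_irrefl _ hq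

theorem contDiff_heisV : ContDiff ℝ ∞ heisV := by
  have h1 : ContDiff ℝ ∞ (fun q : Heis => (q.2 : ℂ)) := ofRealCLM.contDiff.comp contDiff_snd
  have h2 : ContDiff ℝ ∞ (fun q : Heis => ((‖q.1‖ ^ 2 : ℝ) : ℂ)) :=
    ofRealCLM.contDiff.comp ((contDiff_norm_sq ℝ).comp contDiff_fst)
  exact h1.add (contDiff_const.mul h2)

theorem hasFDerivAt_heisV (q : Heis) : HasFDerivAt heisV (fderiv ℝ heisV q) q :=
  (contDiff_heisV.differentiable (by simp) q).hasFDerivAt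

theorem fderiv_heisV (q a : Heis) :
    fderiv ℝ heisV q a = (a.2 : ℂ) + I * (2 * (q.1.re * a.1.re + q.1.im * a.1.im) : ℝ) := by
  have hre : HasFDerivAt (fun q : Heis => q.1.re) (reCLM.comp (ContinuousLinearMap.fst ℝ ℂ ℝ)) q :=
    (reCLM.comp (ContinuousLinearMap.fst ℝ ℂ ℝ)).hasFDerivAt
  have him : HasFDerivAt (fun q : Heis => q.1.im) (imCLM.comp (ContinuousLinearMap.fst ℝ ℂ ℝ)) q :=
    (imCLM.comp (ContinuousLinearMap.fst ℝ ℂ ℝ)).hasFDerivAt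
  have h2 : HasFDerivAt (fun q : Heis => q.2) (ContinuousLinearMap.snd ℝ ℂ ℝ) q :=
    (ContinuousLinearMap.snd ℝ ℂ ℝ).hasFDerivAt
  have h3 : HasFDerivAt (fun q : Heis => (ofRealCLM : ℝ →L[ℝ] ℂ) (q.1.re ^ 2 + q.1.im ^ 2)) _ q :=
    ofRealCLM.hasFDerivAt.comp q ((hre.pow 2).add (him.pow 2))
  have h4 : HasFDerivAt (fun q : Heis => (ofRealCLM : ℝ →L[ℝ] ℂ) q.2) _ q := ofRealCLM.hasFDerivAt.comp q h2
  have h5 := h3.const_mul (I : ℂ)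
  have h := h4.add h5
  have e : heisV = fun q : Heis => ofRealCLM q.2 + I * ofRealCLM (q.1.re ^ 2 + q.1.im ^ 2) := by
    funext q
    change ((q.2 : ℝ) : ℂ) + I * ((‖q.1‖ ^ 2 : ℝ) : ℂ) = (q.2 : ℂ) + I * ((q.1.re ^ 2 + q.1.im ^ 2 : ℝ) : ℂ)
    rw [← Complex.normSq_eq_norm_sq, Complex.normSq_apply]
    push_cast; ring
  have h' := h.congr_of_eventuallyEq (f₁ := heisV) (Filter.Eventually.of_forall fun x => congrFun e x)
  rw [h'.fderiv]
  simp
  ring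

theorem heisV_heisInvSymm {q : Heis} (hq : q ≠ 0) : heisV (heisInvSymm q) = -(heisV q)⁻¹ := by
  have h0 := heisV_ne_zero hq
  have hn : ‖heisV q‖ ≠ 0 := by simpa using h0
  have hc : conj (heisV q) ≠ 0 := by simpa using h0
  have hm : ((‖heisV q‖ : ℝ) : ℂ) ^ 2 = conj (heisV q) * heisV q := by
    rw [← Complex.ofReal_pow, ← Complex.normSq_eq_norm_sq, Complex.normSq_eq_conj_mul_self]
  have hcv : conj (heisV q) = (q.2 : ℂ) - I * (‖q.1‖ ^ 2 : ℝ) := by simp [heisV, sub_eq_add_neg]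
  have : heisV (heisInvSymm q) = -conj (heisV q) / ((‖heisV q‖ : ℝ) : ℂ) ^ 2 := by
    rw [hcv]; simp [heisV, heisInvSymm]; ring
  rw [this, hm]; field_simp

theorem heisNorm_heisInvSymm {q : Heis} (hq : q ≠ 0) : heisNorm (heisInvSymm q) = (heisNorm q)⁻¹ := by
  have h := heisNorm_sq (heisInvSymm q)
  rw [heisV_heisInvSymm hq, norm_neg, norm_inv, ← heisNorm_sq, ← inv_pow] at h
  exact (pow_left_inj₀ (heisNorm_nonneg _) (inv_nonneg.2 (heisNorm_nonneg _)) (by norm_num)).1 h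

theorem heisInvSymm_ne_zero {q : Heis} (hq : q ≠ 0) : heisInvSymm q ≠ 0 := by
  refine ne_zero_of_heisNorm_pos ?_
  rw [heisNorm_heisInvSymm hq]; exact inv_pos.2 (heisNorm_pos hq)

theorem contDiffAt_heisInvSymm {q : Heis} (hq : q ≠ 0) : ContDiffAt ℝ ∞ heisInvSymm q := by
  have h0 := heisV_ne_zero hq
  refine ContDiffAt.prodMk ?_ ?_
  · simp only [div_eq_mul_inv]
    exact (contDiff_fst.neg.contDiffAt).mul (contDiff_heisV.contDiffAt.inv h0)
  · exact (contDiff_snd.neg.contDiffAt).div ((contDiff_heisV.norm_sq ℝ).contDiffAt)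
      (by simpa using h0)

theorem contDiffAt_heisInv {q : Heis} (hq : q ≠ 0) : ContDiffAt ℝ ∞ heisInv q := by
  have h0 := heisV_ne_zero hq
  refine ContDiffAt.prodMk ?_ ?_
  · simp only [div_eq_mul_inv]
    exact (contDiff_fst.contDiffAt).mul (contDiff_heisV.contDiffAt.inv h0)
  · exact (contDiff_snd.neg.contDiffAt).div ((contDiff_heisV.norm_sq ℝ).contDiffAt)
      (by simpa using h0)

theorem hasFDerivAt_heisInvSymm {q : Heis} (hq : q ≠ 0) :
    HasFDerivAt heisInvSymm (fderiv ℝ heisInvSymm q) q :=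
  ((contDiffAt_heisInvSymm hq).differentiableAt (by simp)).hasFDerivAt

theorem ne_zero_mem_nhds {q : Heis} (hq : q ≠ 0) : ∀ᶠ x in 𝓝 q, x ≠ 0 :=
  isOpen_compl_singleton.mem_nhds hq

theorem fderiv_heisInvSymm_injective {q : Heis} (hq : q ≠ 0) {a : Heis}
    (ha : fderiv ℝ heisInvSymm q a = 0) : a = 0 := by
  have h1 : HasFDerivAt heisInv (fderiv ℝ heisInv (heisInvSymm q)) (heisInvSymm q) :=
    ((contDiffAt_heisInv (heisInvSymm_ne_zero hq)).differentiableAt (by simp)).hasFDerivAt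
  have h2 := h1.comp q (hasFDerivAt_heisInvSymm hq)
  have e : heisInv ∘ heisInvSymm =ᶠ[𝓝 q] id := by
    filter_upwards [ne_zero_mem_nhds hq] with x hx using (heisInv_heisInvSymm x hx).1
  have := (h2.congr_of_eventuallyEq e.symm).unique (hasFDerivAt_id q)
  have h3 := congrArg (fun L => L a) this
  simp [ha] at h3
  exact h3.symm

/-- The inversion changes the sign of `d (arg v)`. -/
theorem argForm_heisInvSymm {q : Heis} (hq : q ≠ 0) (a : Heis) :
    argForm (heisInvSymm q) (fderiv ℝ heisInvSymm q a) = -argForm q a := by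
  have h0 := heisV_ne_zero hq
  have h1 := (hasFDerivAt_heisV (heisInvSymm q)).comp q (hasFDerivAt_heisInvSymm hq)
  have h2 := h1.mul (hasFDerivAt_heisV q)
  have e : (heisV ∘ heisInvSymm) * heisV =ᶠ[𝓝 q] fun x => -1 := by
    filter_upwards [ne_zero_mem_nhds hq] with x hx
    simp [heisV_heisInvSymm hx, heisV_ne_zero hx]
  have h3 := congrArg (fun L => L a)
    ((h2.congr_of_eventuallyEq e.symm).unique (hasFDerivAt_const (-1 : ℂ) q))
  simp [heisV_heisInvSymm hq] at h3
  rw [argForm_apply, argForm_apply, heisV_heisInvSymm hq, ← Complex.neg_im]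
  congr 1
  field_simp
  field_simp at h3
  linear_combination -h3

/-- The unitary factor `-v³ / ρ⁶` has logarithmic differential `3 i d(arg v)`. -/
theorem fderiv_unitaryFactor {q : Heis} (hq : q ≠ 0) :
    ContDiffAt ℝ ∞ (fun q => -heisV q ^ 3 / (heisNorm q : ℂ) ^ 6) q ∧
    ∀ a, fderiv ℝ (fun q => -heisV q ^ 3 / (heisNorm q : ℂ) ^ 6) q a
      = -heisV q ^ 3 / (heisNorm q : ℂ) ^ 6 * (I * (((3 : ℝ) • argForm q) a : ℝ)) := by
  have h0 := heisV_ne_zero hq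
  have hn0 : ‖heisV q‖ ≠ 0 := by simpa using h0
  have e : ∀ q, (heisNorm q : ℂ) ^ 6 = ((‖heisV q‖ : ℝ) : ℂ) ^ 3 := fun q => by
    rw [← heisNorm_sq]; push_cast; ring
  simp only [e]
  have hnc : ContDiffAt ℝ ∞ (fun q => ‖heisV q‖) q := contDiff_heisV.contDiffAt.norm ℝ h0
  have hnC : ContDiffAt ℝ ∞ (fun q => ((‖heisV q‖ : ℝ) : ℂ)) q :=
    ofRealCLM.contDiff.contDiffAt.comp q hnc
  have hnC0 : ((‖heisV q‖ : ℝ) : ℂ) ^ 3 ≠ 0 := by simpa using h0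
  have hgc : ContDiffAt ℝ ∞ (fun q => -heisV q ^ 3 / ((‖heisV q‖ : ℝ) : ℂ) ^ 3) q := by
    simp only [div_eq_mul_inv]
    exact ((contDiff_heisV.contDiffAt.pow 3).neg).mul ((hnC.pow 3).inv hnC0)
  refine ⟨hgc, fun a => ?_⟩
  have hn : HasFDerivAt (fun q => ‖heisV q‖) (fderiv ℝ (fun q => ‖heisV q‖) q) q :=
    (hnc.differentiableAt (by simp)).hasFDerivAt
  have hv := hasFDerivAt_heisV q
  set n' := fderiv ℝ (fun q => ‖heisV q‖) q
  set v' := fderiv ℝ heisV q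
  -- the differential of `|v|`
  have k1 : ‖heisV q‖ * n' a = (heisV q).re * (v' a).re + (heisV q).im * (v' a).im := by
    have d1 := hn.pow 2
    have hre := reCLM.hasFDerivAt.comp q hv
    have him := imCLM.hasFDerivAt.comp q hv
    have d2 := (hre.pow 2).add (him.pow 2)
    have ee : (fun x => ‖heisV x‖ ^ 2)
        = (fun x => (⇑reCLM ∘ heisV) x ^ 2) + fun x => (⇑imCLM ∘ heisV) x ^ 2 := by
      funext x
      change ‖heisV x‖ ^ 2 = (heisV x).re ^ 2 + (heisV x).im ^ 2
      rw [← Complex.normSq_eq_norm_sq, Complex.normSq_apply]; ring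
    rw [ee] at d1
    have := congrArg (fun L => L a) (d1.unique d2)
    simp at this
    linarith
  have hnC' : HasFDerivAt (fun q => ((‖heisV q‖ : ℝ) : ℂ)) (ofRealCLM.comp n') q :=
    ofRealCLM.hasFDerivAt.comp q hn
  have hg : HasFDerivAt (fun q => -heisV q ^ 3 / ((‖heisV q‖ : ℝ) : ℂ) ^ 3) _ q :=
    (hgc.differentiableAt (by simp)).hasFDerivAt
  have hD : fderiv ℝ (fun q => -heisV q ^ 3 / ((‖heisV q‖ : ℝ) : ℂ) ^ 3) q a
      * ((‖heisV q‖ : ℝ) : ℂ) ^ 3 + -heisV q ^ 3 / ((‖heisV q‖ : ℝ) : ℂ) ^ 3 *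
        (3 * ((‖heisV q‖ : ℝ) : ℂ) ^ 2 * (n' a : ℝ)) = -(3 * heisV q ^ 2 * v' a) := by
    have d1 := hg.mul (hnC'.pow 3)
    have d2 := (hv.pow 3).neg
    have e : (fun q => -heisV q ^ 3 / ((‖heisV q‖ : ℝ) : ℂ) ^ 3)
        * (fun q => ((‖heisV q‖ : ℝ) : ℂ)) ^ 3 =ᶠ[𝓝 q] -heisV ^ 3 := by
      filter_upwards [ne_zero_mem_nhds hq] with x hx
      have : ((‖heisV x‖ : ℝ) : ℂ) ≠ 0 := by simpa using heisV_ne_zero hx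
      change -heisV x ^ 3 / ((‖heisV x‖ : ℝ) : ℂ) ^ 3 * ((‖heisV x‖ : ℝ) : ℂ) ^ 3 = -heisV x ^ 3
      field_simp
    have := congrArg (fun L => L a) ((d1.congr_of_eventuallyEq e.symm).unique d2)
    simp at this
    linear_combination this
  have hN : ((‖heisV q‖ : ℝ) : ℂ) ≠ 0 := by exact_mod_cast hn0
  have k2 : (argForm q a : ℝ) = (((heisV q).re * (v' a).im - (heisV q).im * (v' a).re))
      / ‖heisV q‖ ^ 2 := by
    rw [argForm_apply, Complex.mul_im, Complex.inv_re, Complex.inv_im, Complex.normSq_eq_norm_sq]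
    field_simp
    ring
  have hm : ((‖heisV q‖ : ℝ) : ℂ) ^ 2 = heisV q * conj (heisV q) := by
    rw [← Complex.ofReal_pow, ← Complex.normSq_eq_norm_sq, Complex.normSq_eq_conj_mul_self, mul_comm]
  have hrel : (((heisV q).re * (v' a).re + (heisV q).im * (v' a).im : ℝ) : ℂ)
      + I * (((heisV q).re * (v' a).im - (heisV q).im * (v' a).re : ℝ) : ℂ)
      = conj (heisV q) * v' a := by
    apply Complex.ext
    · simp
    · simp; ring
  have k2' : ‖heisV q‖ ^ 2 * argForm q a = (heisV q).re * (v' a).im - (heisV q).im * (v' a).re := by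
    rw [k2]; field_simp
  rw [← k1, ← k2'] at hrel
  have hgn : -heisV q ^ 3 / ((‖heisV q‖ : ℝ) : ℂ) ^ 3 * ((‖heisV q‖ : ℝ) : ℂ) ^ 3
      = -heisV q ^ 3 := by field_simp
  refine mul_left_cancel₀ (pow_ne_zero 5 hN) ?_
  push_cast at hrel
  simp only [smul_apply, smul_eq_mul]
  push_cast
  generalize fderiv ℝ (fun q => -heisV q ^ 3 / ((‖heisV q‖ : ℝ) : ℂ) ^ 3) q a = D at *
  generalize -heisV q ^ 3 / ((‖heisV q‖ : ℝ) : ℂ) ^ 3 = g at *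
  set n := ((‖heisV q‖ : ℝ) : ℂ)
  linear_combination n ^ 2 * hD + (-3 * n * (n' a : ℝ) - 3 * I * n ^ 2 * (argForm q a : ℝ)) * hgn
    + 3 * heisV q ^ 3 * hrel - 3 * heisV q ^ 2 * v' a * hm

theorem norm_unitaryFactor {q : Heis} (hq : q ≠ 0) :
    ‖-heisV q ^ 3 / (heisNorm q : ℂ) ^ 6‖ = 1 := by
  have h0 : ‖heisV q‖ ≠ 0 := by simpa using heisV_ne_zero hq
  have : heisNorm q ^ 6 = ‖heisV q‖ ^ 3 := by rw [← heisNorm_sq]; ring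
  rw [norm_div, norm_neg, norm_pow, norm_pow, Complex.norm_real, Real.norm_eq_abs,
    abs_of_nonneg (heisNorm_nonneg q), this]
  field_simp

/-! ### Heisenberg spheres under the inversion -/

/-- The argument of `v` on the Heisenberg sphere, as a function of the latitude `s`. -/
def sphAngle (s : ℝ) : ℝ := Real.pi / 2 - 2 * Real.arcsin (Real.sin s / √2)

theorem abs_sin_div_sqrt_two_lt (s : ℝ) : |Real.sin s / √2| < 1 := by
  have h2 : (1 : ℝ) < √2 := Real.one_lt_sqrt_two
  rw [abs_div, abs_of_pos (by positivity : (0 : ℝ) < √2), div_lt_one (by positivity)]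
  exact (Real.abs_sin_le_one s).trans_lt h2

theorem sqrt_one_sub_sin_sq (s : ℝ) :
    √(1 - (Real.sin s / √2) ^ 2) = √(1 + Real.cos s ^ 2) / √2 := by
  rw [← Real.sqrt_div (one_add_cos_sq_pos s).le]
  congr 1
  rw [div_pow, Real.sq_sqrt (by norm_num), Real.sin_sq]
  ring

theorem hasDerivAt_sphAngle (s : ℝ) :
    HasDerivAt sphAngle (-2 * Real.cos s / √(1 + Real.cos s ^ 2)) s := by
  have h := abs_lt.1 (abs_sin_div_sqrt_two_lt s)
  have h1 := ((Real.hasDerivAt_arcsin h.1.ne' h.2.ne).comp s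
    ((Real.hasDerivAt_sin s).div_const (√2))).const_mul 2
  refine (h1.const_sub (Real.pi / 2)).congr_deriv ?_
  rw [sqrt_one_sub_sin_sq]
  have := sqrt_one_add_cos_sq_pos s
  field_simp

theorem continuous_sphAngle : Continuous sphAngle :=
  continuous_iff_continuousAt.2 fun s => (hasDerivAt_sphAngle s).continuousAt

theorem sin_sphAngle (s : ℝ) : Real.sin (sphAngle s) = Real.cos s ^ 2 := by
  have h := abs_lt.1 (abs_sin_div_sqrt_two_lt s)
  rw [sphAngle, Real.sin_pi_div_two_sub, Real.cos_two_mul, Real.cos_arcsin, sqrt_one_sub_sin_sq,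
    div_pow, Real.sq_sqrt (one_add_cos_sq_pos s).le, Real.sq_sqrt (by norm_num)]
  ring

theorem cos_sphAngle (s : ℝ) : Real.cos (sphAngle s) = sphHeight s := by
  have h := abs_lt.1 (abs_sin_div_sqrt_two_lt s)
  rw [sphAngle, Real.cos_pi_div_two_sub, Real.sin_two_mul, Real.cos_arcsin, sqrt_one_sub_sin_sq,
    Real.sin_arcsin h.1.le h.2.le, sphHeight]
  have h2 : √2 * √2 = 2 := Real.mul_self_sqrt (by norm_num)
  field_simp
  rw [sq, h2]
  ring

theorem exp_sphAngle (s : ℝ) : exp (sphAngle s * I) = ⟨sphHeight s, Real.cos s ^ 2⟩ := by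
  rw [Complex.exp_mul_I, ← Complex.ofReal_cos, ← Complex.ofReal_sin, cos_sphAngle, sin_sphAngle]
  apply Complex.ext <;> simp [-Complex.ofReal_pow]

theorem heisV_heisSphere (r φ s : ℝ) :
    heisV (heisSphere r φ s) = (r ^ 2 : ℝ) * exp (sphAngle s * I) := by
  rw [exp_sphAngle, heisSphere_eq, heisV]
  simp only [norm_mul, Complex.norm_exp_ofReal_mul_I, mul_one, Complex.norm_real]
  rw [← norm_mul, Real.norm_eq_abs, sq_abs]
  apply Complex.ext
  · simp [-Complex.ofReal_pow]
  · simp [-Complex.ofReal_pow]; ring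

theorem heisSphere_ne_zero {r : ℝ} (hr : 0 < r) (φ s : ℝ) : heisSphere r φ s ≠ 0 :=
  ne_zero_of_heisNorm_pos (by rwa [heisNorm_heisSphere hr.le])

theorem argForm_sphPhi {r : ℝ} (φ s : ℝ) :
    argForm (heisSphere r φ s) (sphPhi r φ s) = 0 := by
  have h := (hasFDerivAt_heisV _).comp_hasDerivAt φ (hasDerivAt_heisSphere_phi r φ s)
  have e : heisV ∘ (fun x => heisSphere r x s) = fun _ => ((r ^ 2 : ℝ) : ℂ) * exp (sphAngle s * I) := by
    funext x; exact heisV_heisSphere r x s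
  rw [e] at h
  rw [argForm_apply, h.unique (hasDerivAt_const φ _)]
  simp

theorem argForm_sphS {r : ℝ} (hr : 0 < r) (φ s : ℝ) :
    argForm (heisSphere r φ s) (sphS r φ s) = -2 * Real.cos s / √(1 + Real.cos s ^ 2) := by
  have h := (hasFDerivAt_heisV _).comp_hasDerivAt s (hasDerivAt_heisSphere_s r φ s)
  have e : heisV ∘ (fun x => heisSphere r φ x)
      = fun x => ((r ^ 2 : ℝ) : ℂ) * exp (sphAngle x * I) := by
    funext x; exact heisV_heisSphere r φ x
  have h2 := (((hasDerivAt_sphAngle s).ofReal_comp.mul_const I).cexp).const_mul ((r ^ 2 : ℝ) : ℂ)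
  rw [e] at h
  rw [argForm_apply, h.unique h2, heisV_heisSphere]
  have hr' : ((r ^ 2 : ℝ) : ℂ) ≠ 0 := by exact_mod_cast (pow_pos hr 2).ne'
  have : (((r ^ 2 : ℝ) : ℂ) * exp (sphAngle s * I))⁻¹ * (((r ^ 2 : ℝ) : ℂ) * (exp (sphAngle s * I) *
      (((-2 * Real.cos s / √(1 + Real.cos s ^ 2) : ℝ) : ℂ) * I)))
      = ((-2 * Real.cos s / √(1 + Real.cos s ^ 2) : ℝ) : ℂ) * I := by
    have := Complex.exp_ne_zero (sphAngle s * I)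
    field_simp
  rw [this]
  simp [-Complex.ofReal_div, -Complex.ofReal_mul]

/-- The inversion exchanges the spheres of radii `r` and `r⁻¹`. In the parametrization it reflects the
latitude and rotates `φ` by an angle depending on the latitude. -/
theorem heisInvSymm_heisSphere {r : ℝ} (hr : 0 < r) (φ s : ℝ) :
    heisInvSymm (heisSphere r φ s) = heisSphere r⁻¹ (φ - sphAngle s + Real.pi) (-s) := by
  have hr' : (r : ℂ) ≠ 0 := by exact_mod_cast hr.ne'
  have hn : ‖heisV (heisSphere r φ s)‖ = r ^ 2 := by
    rw [← heisNorm_sq, heisNorm_heisSphere hr.le]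
  rw [heisInvSymm, hn, heisV_heisSphere]
  simp only [heisSphere_eq]
  have h1 := Complex.exp_ne_zero (sphAngle s * I)
  have e : exp (((φ - sphAngle s + Real.pi : ℝ) : ℂ) * I)
      = -(exp (φ * I) / exp (sphAngle s * I)) := by
    push_cast
    rw [add_mul, sub_mul, Complex.exp_add, Complex.exp_sub, Complex.exp_pi_mul_I]
    ring
  refine Prod.ext ?_ ?_
  · simp only [e, Real.cos_neg]
    push_cast
    field_simp
  · have : sphHeight (-s) = -sphHeight s := by simp [sphHeight]
    simp only [this]
    field_simp

theorem fderiv_heisInvSymm_sphPhi {r : ℝ} (hr : 0 < r) (φ s : ℝ) :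
    fderiv ℝ heisInvSymm (heisSphere r φ s) (sphPhi r φ s)
      = sphPhi r⁻¹ (φ - sphAngle s + Real.pi) (-s) := by
  have h := (hasFDerivAt_heisInvSymm (heisSphere_ne_zero hr φ s)).comp_hasDerivAt φ
    (hasDerivAt_heisSphere_phi r φ s)
  have e : heisInvSymm ∘ (fun x => heisSphere r x s)
      = fun x => heisSphere r⁻¹ (x - sphAngle s + Real.pi) (-s) := by
    funext x; exact heisInvSymm_heisSphere hr x s
  rw [e] at h
  have h2 := (hasDerivAt_heisSphere_phi r⁻¹ (φ - sphAngle s + Real.pi) (-s)).scomp φ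
    (((hasDerivAt_id φ).sub_const (sphAngle s)).add_const Real.pi)
  rw [h.unique h2]
  simp

/-- The multiple of `sphPhi` is left unspecified, because it does not contribute to the value of a
two-form on `sphPhi` and `sphS`. -/
theorem fderiv_heisInvSymm_sphS {r : ℝ} (hr : 0 < r) (φ s : ℝ) :
    ∃ c : ℝ, fderiv ℝ heisInvSymm (heisSphere r φ s) (sphS r φ s)
      = c • sphPhi r⁻¹ (φ - sphAngle s + Real.pi) (-s)
        - sphS r⁻¹ (φ - sphAngle s + Real.pi) (-s) := by
  have h := (hasFDerivAt_heisInvSymm (heisSphere_ne_zero hr φ s)).comp_hasDerivAt s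
    (hasDerivAt_heisSphere_s r φ s)
  have e : heisInvSymm ∘ (fun x => heisSphere r φ x)
      = fun x => heisSphere r⁻¹ (φ - sphAngle x + Real.pi) (-x) := by
    funext x; exact heisInvSymm_heisSphere hr φ x
  rw [e] at h
  have ha : HasDerivAt (fun x => φ - sphAngle x + Real.pi)
      (2 * Real.cos s / √(1 + Real.cos s ^ 2)) s := by
    refine (((hasDerivAt_sphAngle s).const_sub φ).add_const Real.pi).congr_deriv ?_
    ring
  have hc : HasDerivAt (fun x => ((r⁻¹ * Real.cos (-x) : ℝ) : ℂ))
      ((-r⁻¹ * Real.sin s : ℝ) : ℂ) s := by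
    refine HasDerivAt.ofReal_comp ?_
    simp only [Real.cos_neg]
    simpa using (Real.hasDerivAt_cos s).const_mul r⁻¹
  have hh : HasDerivAt (fun x => r⁻¹ ^ 2 * sphHeight (-x))
      (-(r⁻¹ ^ 2 * (2 * Real.cos s ^ 3 / √(1 + Real.cos s ^ 2)))) s := by
    have := ((hasDerivAt_sphHeight (-s)).comp s (hasDerivAt_neg s)).const_mul (r⁻¹ ^ 2)
    refine this.congr_deriv ?_
    simp
  have hE := (hasDerivAt_exp_mul_I (φ - sphAngle s + Real.pi)).scomp s ha
  have h2 := (hc.mul hE).prodMk hh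
  have e2 : (fun x => heisSphere r⁻¹ (φ - sphAngle x + Real.pi) (-x)) = fun x =>
      (((fun x => ((r⁻¹ * Real.cos (-x) : ℝ) : ℂ)) * (fun x : ℝ => exp (x * I)) ∘
        fun x => φ - sphAngle x + Real.pi) x, r⁻¹ ^ 2 * sphHeight (-x)) := by
    funext x; exact heisSphere_eq _ _ _
  rw [e2] at h
  refine ⟨2 * Real.cos s / √(1 + Real.cos s ^ 2), ?_⟩
  rw [h.unique h2]
  refine Prod.ext ?_ ?_
  · simp [sphPhi, sphS]
    ring
  · simp [sphPhi, sphS]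

/-- Invariance of integrals over the sphere under `(φ, s) ↦ (φ - arg v + π, -s)`. -/
theorem integral_reparam {k : ℝ → ℝ → ℝ} (hk : Continuous fun x : ℝ × ℝ => k x.1 x.2)
    (hper : ∀ φ s, k (φ + 2 * Real.pi) s = k φ s) :
    ∫ φ in (-Real.pi)..Real.pi, ∫ s in (-(Real.pi / 2))..(Real.pi / 2),
      k (φ - sphAngle s + Real.pi) (-s)
    = ∫ φ in (-Real.pi)..Real.pi, ∫ s in (-(Real.pi / 2))..(Real.pi / 2), k φ s := by
  have hα := continuous_sphAngle
  have inner : ∀ s, ∫ φ in (-Real.pi)..Real.pi, k (φ - sphAngle s + Real.pi) (-s)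
      = ∫ φ in (-Real.pi)..Real.pi, k φ (-s) := by
    intro s
    have e : ∀ φ, φ - sphAngle s + Real.pi = φ + (Real.pi - sphAngle s) := fun φ => by ring
    simp only [e]
    rw [intervalIntegral.integral_comp_add_right (fun φ => k φ (-s))]
    have hp : Function.Periodic (fun φ => k φ (-s)) (2 * Real.pi) := fun φ => hper φ (-s)
    have := hp.intervalIntegral_add_eq (-Real.pi + (Real.pi - sphAngle s)) (-Real.pi)
    convert this using 2 <;> ring
  rw [integral_swap (f := fun φ s => k (φ - sphAngle s + Real.pi) (-s))
    (hk.comp (by fun_prop : Continuous fun x : ℝ × ℝ => (x.1 - sphAngle x.2 + Real.pi, -x.2)))]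
  simp only [inner]
  rw [integral_swap hk, intervalIntegral.integral_comp_neg
    (fun s => ∫ φ in (-Real.pi)..Real.pi, k φ s)]
  simp

/-- The integral over a large sphere of a two-form pulled back by the inversion is the flux through
the small sphere; the inversion reverses the orientation. -/
theorem sphereIntegral_heisInvSymm {l m : Heis → Heis →L[ℝ] ℝ} {r : ℝ} (hr : 0 < r)
    (hl : ∀ q, heisNorm q = r⁻¹ → ContinuousAt l q) (hm : ∀ q, heisNorm q = r⁻¹ → ContinuousAt m q)
    {W : Heis → Heis → Heis → ℂ}
    (hW : ∀ q, heisNorm q = r → ∀ a b, W q a b =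
      I * ((l (heisInvSymm q) (fderiv ℝ heisInvSymm q a) * m (heisInvSymm q) (fderiv ℝ heisInvSymm q b)
        - l (heisInvSymm q) (fderiv ℝ heisInvSymm q b)
          * m (heisInvSymm q) (fderiv ℝ heisInvSymm q a) : ℝ) : ℂ)) :
    I * sphereIntegral W r = (flux (fun q => cross (l q) (m q)) r⁻¹ : ℝ) := by
  have hr1 : 0 < r⁻¹ := inv_pos.2 hr
  set k : ℝ → ℝ → ℝ := fun φ s => det3 (cross (l (heisSphere r⁻¹ φ s)) (m (heisSphere r⁻¹ φ s)))
    (sphPhi r⁻¹ φ s) (sphS r⁻¹ φ s) with hk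
  have c0 : Continuous fun x : ℝ × ℝ => heisSphere r⁻¹ x.1 x.2 :=
    continuous_const.heisSphere continuous_fst continuous_snd
  have kc : Continuous fun x : ℝ × ℝ => k x.1 x.2 := by
    have h1 : Continuous fun x : ℝ × ℝ => l (heisSphere r⁻¹ x.1 x.2) :=
      continuous_iff_continuousAt.2 fun x =>
        ContinuousAt.comp' (hl _ (heisNorm_heisSphere hr1.le _ _)) c0.continuousAt
    have h2 : Continuous fun x : ℝ × ℝ => m (heisSphere r⁻¹ x.1 x.2) :=
      continuous_iff_continuousAt.2 fun x =>
        ContinuousAt.comp' (hm _ (heisNorm_heisSphere hr1.le _ _)) c0.continuousAt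
    have h3 : Continuous fun x : ℝ × ℝ =>
        cross (l (heisSphere r⁻¹ x.1 x.2)) (m (heisSphere r⁻¹ x.1 x.2)) :=
      crossL.isBoundedBilinearMap.continuous.comp (h1.prodMk h2)
    exact h3.det3 (continuous_const.sphPhi continuous_fst continuous_snd)
      (continuous_const.sphS continuous_fst continuous_snd)
  have hper : ∀ φ s, k (φ + 2 * Real.pi) s = k φ s := by
    intro φ s
    have e : exp (((φ + 2 * Real.pi : ℝ) : ℂ) * I) = exp (φ * I) := by
      push_cast
      rw [add_mul, Complex.exp_add, Complex.exp_two_pi_mul_I, mul_one]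
    simp only [hk, heisSphere_eq, sphPhi, sphS, e]
  have key : ∀ φ s, W (heisSphere r φ s) (deriv (fun x => heisSphere r x s) φ)
      (deriv (fun x => heisSphere r φ x) s)
      = -I * ((k (φ - sphAngle s + Real.pi) (-s) : ℝ) : ℂ) := by
    intro φ s
    obtain ⟨c, hc⟩ := fderiv_heisInvSymm_sphS hr φ s
    rw [(hasDerivAt_heisSphere_phi r φ s).deriv, (hasDerivAt_heisSphere_s r φ s).deriv,
      hW _ (heisNorm_heisSphere hr.le _ _), hc, fderiv_heisInvSymm_sphPhi hr,
      heisInvSymm_heisSphere hr, hk]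
    simp only [det3_cross, map_sub, map_smul, smul_eq_mul]
    push_cast
    ring
  rw [sphereIntegral]
  simp only [key]
  have : ∫ φ in (-Real.pi)..Real.pi, ∫ s in (-(Real.pi / 2))..(Real.pi / 2),
      -I * ((k (φ - sphAngle s + Real.pi) (-s) : ℝ) : ℂ)
      = -I * ((∫ φ in (-Real.pi)..Real.pi, ∫ s in (-(Real.pi / 2))..(Real.pi / 2),
        k (φ - sphAngle s + Real.pi) (-s) : ℝ) : ℂ) := by
    simp only [intervalIntegral.integral_const_mul, intervalIntegral.integral_ofReal]
  rw [this, integral_reparam kc hper, ← mul_assoc]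
  simp [flux, hk]

/-! ### The equation off the pole -/

namespace IsCoframe

variable {ϑ : Heis → Heis →L[ℝ] ℝ} {η : Heis → Heis →L[ℝ] ℂ} {U : Set Heis} (h : IsCoframe ϑ η U)
include h

theorem continuousOn_divg {B : Heis → Heis} (hB : ContDiffOn ℝ ∞ B U) : ContinuousOn (divg B) U := by
  have hd : ContinuousOn (fderiv ℝ B) U := hB.continuousOn_fderiv_of_isOpen h.isOpen (by simp)
  have h1 := fun v : Heis => hd.clm_apply (continuousOn_const (c := v))
  exact ((continuous_re.comp_continuousOn (continuous_fst.comp_continuousOn (h1 ex))).add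
    (continuous_im.comp_continuousOn (continuous_fst.comp_continuousOn (h1 ey)))).add
    (continuous_snd.comp_continuousOn (h1 et))

/-- Off the pole the distributional equation holds classically, in divergence form. -/
theorem equation_of_weak {g R : Heis → ℝ} (hg : ContDiffOn ℝ ∞ g U) (hR : ContinuousOn R U)
    (hc : ∀ q ∈ U, 0 < contactDensity ϑ q) {V : Set Heis} (hV : MeasurableSet V) (hUV : U ⊆ V)
    (hweak : ∀ φ : Heis → ℝ, ContDiff ℝ ∞ φ → HasCompactSupport φ → tsupport φ ⊆ U →
      ∫ q in V, (g q : ℂ) * (-4 * subLaplacian ϑ η (imagForm (connPot ϑ η)) (fun x => (φ x : ℂ)) q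
        + (R q * φ q : ℝ)) * (|contactDensity ϑ q| : ℝ) = 0) :
    ∀ q ∈ U, 4 * divg (gradField ϑ η g) q + R q * g q * contactDensity ϑ q = 0 := by
  set E : Heis → ℝ := fun q => 4 * divg (gradField ϑ η g) q + R q * g q * contactDensity ϑ q with hE
  have hEc : ContinuousOn E U :=
    (continuousOn_const.mul (h.continuousOn_divg (h.contDiffOn_gradField hg))).add
      ((hR.mul hg.continuousOn).mul h.contDiffOn_contactDensity.continuousOn)
  have main : ∀ φ : Heis → ℝ, ContDiff ℝ ∞ φ → HasCompactSupport φ → tsupport φ ⊆ U →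
      ∫ q, φ q • E q = 0 := by
    intro φ hφ hφc hφU
    -- the integrand is `4 div K + φ E`, where `K` is the field in Green's identity for `g` and `φ`
    set K : Heis → Heis := fun q => g q • gradField ϑ η φ q - φ q • gradField ϑ η g q with hK
    have hzero : ∀ q, q ∉ tsupport φ → φ =ᶠ[𝓝 q] fun _ => 0 := fun q hq =>
      (notMem_tsupport_iff_eventuallyEq.1 hq)
    have hKzero : ∀ q, q ∉ tsupport φ → K =ᶠ[𝓝 q] fun _ => 0 := by
      intro q hq
      filter_upwards [(hzero q hq).eventuallyEq_nhds] with x hx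
      have h1 : fderiv ℝ φ x = 0 := by rw [hx.fderiv_eq]; simp
      have h2 : φ x = 0 := hx.eq_of_nhds
      have h3 : gradField ϑ η φ x = 0 := by
        have := gradField_smul_const (ϑ := ϑ) (η := η) (q := x) (f := φ) (g := φ) (k := 0)
          (by simp [h1])
        simpa using this
      simp [hK, h2, h3]
    have hKU : ContDiffOn ℝ ∞ K U :=
      (hg.smul (h.contDiffOn_gradField hφ.contDiffOn)).sub
        (hφ.contDiffOn.smul (h.contDiffOn_gradField hg))
    have hKs : ContDiff ℝ 1 K := by
      rw [contDiff_iff_contDiffAt]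
      intro q
      by_cases hq : q ∈ tsupport φ
      · exact (hKU.contDiffAt (h.isOpen.mem_nhds (hφU hq))).of_le (by simp)
      · exact contDiffAt_const.congr_of_eventuallyEq (hKzero q hq)
    have hKc : HasCompactSupport K := by
      refine HasCompactSupport.intro hφc fun q hq => ?_
      exact (hKzero q hq).eq_of_nhds
    have hdivU : ∀ q ∈ U, divg K q
        = g q * divg (gradField ϑ η φ) q - φ q * divg (gradField ϑ η g) q := by
      intro q hq
      have hn := h.isOpen.mem_nhds hq
      have dg := (hg.contDiffAt hn).differentiableAt (by simp)
      have dφ := (hφ.contDiffAt (x := q)).differentiableAt (by simp)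
      have dBg := ((h.contDiffOn_gradField hg).contDiffAt hn).differentiableAt (by simp)
      have dBφ := ((h.contDiffOn_gradField hφ.contDiffOn).contDiffAt hn).differentiableAt (by simp)
      rw [hK, divg_sub (A := fun q => g q • gradField ϑ η φ q)
        (B := fun q => φ q • gradField ϑ η g q) (dg.smul dBφ) (dφ.smul dBg), divg_smul dg dBφ, divg_smul dφ dBg,
        h.fderiv_gradField_symm hq φ g]
      ring
    have hdivoff : ∀ q, q ∉ tsupport φ → divg K q = 0 := by
      intro q hq
      rw [divg_congr (hKzero q hq)]
      simp [divg]
    have hdivint : Integrable (divg K) := by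
      have hcont : Continuous (divg K) := by
        have hd : Continuous (fderiv ℝ K) := hKs.continuous_fderiv (by simp)
        unfold divg
        fun_prop
      exact hcont.integrable_of_hasCompactSupport (HasCompactSupport.intro hφc hdivoff)
    -- the integrand of the weak equation
    have hpoint : ∀ q ∈ U, (g q : ℂ) * (-4 * subLaplacian ϑ η (imagForm (connPot ϑ η))
        (fun x => (φ x : ℂ)) q + (R q * φ q : ℝ)) * (|contactDensity ϑ q| : ℝ)
        = ((4 * divg K q + φ q * E q : ℝ) : ℂ) := by
      intro q hq
      have h1 := h.divg_gradField hφ.contDiffOn hq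
      rw [abs_of_pos (hc q hq), hdivU q hq, hE]
      push_cast at h1 ⊢
      linear_combination (-4 * (g q : ℂ)) * h1
    have hoff : ∀ q, q ∉ tsupport φ → subLaplacian ϑ η (imagForm (connPot ϑ η))
        (fun x => (φ x : ℂ)) q = 0 := by
      intro q hq
      have e0 : ∀ᶠ x in 𝓝 q, fderiv ℝ (fun y => (φ y : ℂ)) x = 0 := by
        filter_upwards [(hzero q hq).eventuallyEq_nhds] with x hx
        have : (fun y => (φ y : ℂ)) =ᶠ[𝓝 x] fun _ => 0 := by
          filter_upwards [hx] with y hy; simp [hy]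
        rw [this.fderiv_eq]; simp
      have e1 : derivZ ϑ η (fun x => (φ x : ℂ)) =ᶠ[𝓝 q] fun _ => 0 := by
        filter_upwards [e0] with x hx; simp [derivZ, onZ, hx]
      have e2 : derivZbar ϑ η (fun x => (φ x : ℂ)) =ᶠ[𝓝 q] fun _ => 0 := by
        filter_upwards [e0] with x hx; simp [derivZbar, onZbar, hx]
      rw [subLaplacian, e1.eq_of_nhds, e2.eq_of_nhds, derivZ, derivZbar, e1.fderiv_eq,
        e2.fderiv_eq]
      simp [onZ, onZbar]
    have w := hweak φ hφ hφc hφU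
    rw [setIntegral_eq_of_subset_of_forall_sdiff_eq_zero hV hUV,
      setIntegral_congr_fun h.isOpen.measurableSet hpoint] at w
    swap
    · intro q hq
      have hq' : q ∉ tsupport φ := fun hh => hq.2 (hφU hh)
      rw [hoff q hq', (hzero q hq').eq_of_nhds]
      simp
    have w' : ∫ q in U, (4 * divg K q + φ q * E q) = 0 := by
      have := integral_ofReal (𝕜 := ℂ) (μ := volume.restrict U)
        (f := fun q => 4 * divg K q + φ q * E q)
      exact Complex.ofReal_eq_zero.1 (this.symm.trans w)
    have hφE : Integrable (fun q => φ q * E q) := by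
      refine Continuous.integrable_of_hasCompactSupport ?_
        (HasCompactSupport.intro hφc fun q hq => by simp [(hzero q hq).eq_of_nhds])
      rw [continuous_iff_continuousAt]
      intro q
      by_cases hq : q ∈ tsupport φ
      · exact hφ.continuous.continuousAt.mul (hEc.continuousAt (h.isOpen.mem_nhds (hφU hq)))
      · refine (continuousAt_const (y := (0 : ℝ))).congr ?_
        filter_upwards [hzero q hq] with x hx
        simp [hx]
    rw [integral_add (hdivint.const_mul 4).integrableOn hφE.integrableOn,
      setIntegral_eq_integral_of_forall_compl_eq_zero (f := fun q => 4 * divg K q)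
        (fun q hq => by rw [hdivoff q fun hh => hq (hφU hh)]; simp),
      setIntegral_eq_integral_of_forall_compl_eq_zero (f := fun q => φ q * E q)
        (fun q hq => by
          rw [(hzero q fun hh => hq (hφU hh)).eq_of_nhds]; simp),
      integral_const_mul, integral_divg_eq_zero hKs hKc] at w'
    simpa using w'
  have hae := h.isOpen.ae_eq_zero_of_integral_contDiff_smul_eq_zero (μ := volume) (f := E)
    (hEc.locallyIntegrableOn h.isOpen.measurableSet) main
  have hae' : E =ᵐ[volume.restrict U] fun _ => 0 := by
    rw [Filter.EventuallyEq, ae_restrict_iff' h.isOpen.measurableSet]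
    exact hae
  exact MeasureTheory.Measure.eqOn_open_of_ae_eq hae' h.isOpen hEc continuousOn_const

end IsCoframe

/-! ### Asymptotic calculus with respect to the Heisenberg norm -/

section Calculus

variable {α : Type*} {l : Filter α} {ρ : α → ℝ} {E F : Type*} [NormedAddCommGroup E]
  [NormedSpace ℝ E] [NormedAddCommGroup F] [NormedSpace ℝ F]

theorem isBigO_zpow_zpow (hρ : Tendsto ρ l (𝓝[>] 0)) {m n : ℤ} (h : n ≤ m) :
    (fun x => ρ x ^ m) =O[l] fun x => ρ x ^ n := by
  have h1 : ∀ᶠ x in l, ρ x ∈ Ioo (0 : ℝ) 1 := hρ.eventually (Ioo_mem_nhdsGT one_pos)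
  refine IsBigO.of_bound 1 (h1.mono fun x hx => ?_)
  rw [one_mul, Real.norm_of_nonneg (zpow_nonneg hx.1.le _),
    Real.norm_of_nonneg (zpow_nonneg hx.1.le _)]
  exact zpow_le_zpow_right_of_le_one₀ hx.1 hx.2.le h

omit [NormedSpace ℝ F] in
theorem Asymptotics.IsBigO.zpow_mono {f : α → F} {m : ℤ} (hf : f =O[l] fun x => ρ x ^ m)
    (hρ : Tendsto ρ l (𝓝[>] 0)) {n : ℤ} (h : n ≤ m) : f =O[l] fun x => ρ x ^ n :=
  hf.trans (isBigO_zpow_zpow hρ h)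

theorem Asymptotics.IsBigO.zpow_smul {f : α → ℝ} {g : α → F} {j k : ℤ}
    (hf : f =O[l] fun x => ρ x ^ j) (hg : g =O[l] fun x => ρ x ^ k)
    (hρ : Tendsto ρ l (𝓝[>] 0)) {n : ℤ} (h : n ≤ j + k) :
    (fun x => f x • g x) =O[l] fun x => ρ x ^ n := by
  refine (hf.smul hg).trans (IsBigO.trans (IsBigO.of_bound 1 ?_) (isBigO_zpow_zpow hρ h))
  have h1 : ∀ᶠ x in l, 0 < ρ x := hρ.eventually self_mem_nhdsWithin
  filter_upwards [h1] with x hx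
  rw [zpow_add₀ hx.ne', one_mul, smul_eq_mul]

theorem Asymptotics.IsBigO.zpow_mul {f g : α → ℝ} {j k : ℤ}
    (hf : f =O[l] fun x => ρ x ^ j) (hg : g =O[l] fun x => ρ x ^ k)
    (hρ : Tendsto ρ l (𝓝[>] 0)) {n : ℤ} (h : n ≤ j + k) :
    (fun x => f x * g x) =O[l] fun x => ρ x ^ n :=
  hf.zpow_smul hg hρ h

omit [NormedSpace ℝ F] in
theorem Filter.Tendsto.isBigO_zpow_zero {f : α → F} {y : F} (hf : Tendsto f l (𝓝 y)) :
    f =O[l] fun x => ρ x ^ (0 : ℤ) := by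
  simpa using hf.isBigO_one ℝ

omit [NormedSpace ℝ E] [NormedSpace ℝ F] in
theorem isBigO_zpow_of_le {f : α → E} {g : α → F} {k : ℤ} (hg : g =O[l] fun x => ρ x ^ k)
    {C : ℝ} (h : ∀ᶠ x in l, ‖f x‖ ≤ C * ‖g x‖) : f =O[l] fun x => ρ x ^ k :=
  (IsBigO.of_bound C h).trans hg

omit [NormedSpace ℝ F] in
theorem Asymptotics.IsBigO.zpow_one {f : α → F} {k : ℕ} (hf : f =O[l] fun x => ρ x ^ k) :
    f =O[l] fun x => ρ x ^ (k : ℤ) := by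
  simpa using hf

end Calculus

theorem continuous_heisNorm : Continuous heisNorm :=
  ((continuous_fst.norm.pow 4).add (continuous_snd.pow 2)).rpow_const
    fun _ => Or.inr (by norm_num)

theorem tendsto_heisNorm : Tendsto heisNorm (𝓝[≠] 0) (𝓝[>] 0) := by
  refine tendsto_nhdsWithin_iff.2 ⟨?_, ?_⟩
  · have := continuous_heisNorm.tendsto 0
    rw [heisNorm_zero] at this
    exact this.mono_left nhdsWithin_le_nhds
  · filter_upwards [self_mem_nhdsWithin] with q hq using heisNorm_pos hq

theorem norm_fst_le_heisNorm (q : Heis) : ‖q.1‖ ≤ heisNorm q := by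
  refine le_of_pow_le_pow_left₀ (n := 4) (by norm_num) (heisNorm_nonneg q) ?_
  rw [heisNorm_pow_four, heisN]; nlinarith [sq_nonneg q.2]

theorem abs_snd_le_heisNorm_sq (q : Heis) : |q.2| ≤ heisNorm q ^ 2 := by
  refine le_of_pow_le_pow_left₀ (n := 2) (by norm_num) (by positivity) ?_
  rw [sq_abs, ← pow_mul, heisNorm_pow_four, heisN]
  have : 0 ≤ ‖q.1‖ ^ 4 := by positivity
  linarith

/-- Heisenberg balls form a neighbourhood basis of the origin. -/
theorem exists_heisNorm_lt_of_mem_nhds {s : Set Heis} (hs : s ∈ 𝓝 (0 : Heis)) :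
    ∃ δ > 0, ∀ q, heisNorm q < δ → q ∈ s := by
  obtain ⟨ε, hε, hb⟩ := Metric.mem_nhds_iff.1 hs
  refine ⟨min ε 1, by positivity, fun q hq => hb ?_⟩
  have h0 := heisNorm_nonneg q
  have h1 : heisNorm q < ε := hq.trans_le (min_le_left _ _)
  have h2 : heisNorm q < 1 := hq.trans_le (min_le_right _ _)
  rw [mem_ball_zero_iff, Prod.norm_def, max_lt_iff]
  refine ⟨(norm_fst_le_heisNorm q).trans_lt h1, ?_⟩
  have := abs_snd_le_heisNorm_sq q
  rw [Real.norm_eq_abs]; nlinarith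

/-- The standard contact form as a real one-form. -/
def stdForm (q : Heis) : Heis →L[ℝ] ℝ :=
  ContinuousLinearMap.snd ℝ ℂ ℝ + (2 * q.1.re) • imCLM.comp (ContinuousLinearMap.fst ℝ ℂ ℝ)
    - (2 * q.1.im) • reCLM.comp (ContinuousLinearMap.fst ℝ ℂ ℝ)

theorem stdForm_apply (q u : Heis) :
    stdForm q u = u.2 + 2 * q.1.re * u.1.im - 2 * q.1.im * u.1.re := by
  simp [stdForm]

theorem stdContact_eq (q u : Heis) : stdContact q u = (stdForm q u : ℂ) := by
  rw [stdForm_apply, stdContact]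
  apply Complex.ext <;> (simp; try ring)

section Bounds

variable {α : Type*} {l : Filter α} {q : α → Heis}

theorem isBigO_fst : (fun x => (q x).1) =O[l] fun x => heisNorm (q x) ^ (1 : ℤ) :=
  IsBigO.of_bound 1 (Eventually.of_forall fun x => by
    rw [one_mul, zpow_one, Real.norm_of_nonneg (heisNorm_nonneg _)]
    exact norm_fst_le_heisNorm _)

theorem isBigO_re_fst : (fun x => (q x).1.re) =O[l] fun x => heisNorm (q x) ^ (1 : ℤ) :=
  isBigO_zpow_of_le isBigO_fst (C := 1) (Eventually.of_forall fun x => by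
    simpa using abs_re_le_norm _)

theorem isBigO_im_fst : (fun x => (q x).1.im) =O[l] fun x => heisNorm (q x) ^ (1 : ℤ) :=
  isBigO_zpow_of_le isBigO_fst (C := 1) (Eventually.of_forall fun x => by
    simpa using abs_im_le_norm _)

theorem isBigO_snd : (fun x => (q x).2) =O[l] fun x => heisNorm (q x) ^ (2 : ℤ) :=
  IsBigO.of_bound 1 (Eventually.of_forall fun x => by
    rw [one_mul, Real.norm_of_nonneg (zpow_nonneg (heisNorm_nonneg _) _)]
    exact_mod_cast abs_snd_le_heisNorm_sq _)

theorem isBigO_norm_fst_sq : (fun x => ‖(q x).1‖ ^ 2) =O[l] fun x => heisNorm (q x) ^ (2 : ℤ) := by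
  simpa using (isBigO_fst (l := l) (q := q)).norm_left.pow 2

end Bounds

theorem eq_zero_of_isBigO {F : Type*} [NormedAddCommGroup F] {f : Heis → F} (hf : ContinuousAt f 0)
    {k : ℕ} (hk : k ≠ 0) (hO : f =O[𝓝[≠] 0] fun q => heisNorm q ^ (k : ℤ)) : f 0 = 0 := by
  have a : Tendsto f (𝓝[≠] 0) (𝓝 (f 0)) := hf.tendsto.mono_left nhdsWithin_le_nhds
  have b : Tendsto f (𝓝[≠] 0) (𝓝 0) := by
    refine hO.trans_tendsto ?_
    have := (tendsto_heisNorm.mono_right nhdsWithin_le_nhds).pow k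
    simpa [hk] using this
  exact tendsto_nhds_unique a b

theorem fderiv_eq_zero_of_isBigO {F : Type*} [NormedAddCommGroup F] [NormedSpace ℝ F]
    {f : Heis → F} (hf : DifferentiableAt ℝ f 0) {k : ℕ} (hk : k ≠ 0)
    (hO : f =O[𝓝[≠] 0] fun q => heisNorm q ^ (k : ℤ)) {v : Heis} (hv : v ≠ 0)
    (ho : (fun t : ℝ => heisNorm (t • v) ^ (k : ℤ)) =o[𝓝[≠] 0] fun t => t) :
    fderiv ℝ f 0 v = 0 := by
  have f0 := eq_zero_of_isBigO hf.continuousAt hk hO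
  have hd : HasDerivAt (fun t : ℝ => f (t • v)) (fderiv ℝ f 0 v) 0 := by
    have hl : HasDerivAt (fun t : ℝ => t • v) v 0 := by
      simpa using (hasDerivAt_id (0 : ℝ)).smul_const v
    have hf' : HasFDerivAt f (fderiv ℝ f 0) ((0 : ℝ) • v) := by
      rw [zero_smul]
      exact hf.hasFDerivAt
    exact hf'.comp_hasDerivAt 0 hl
  refine hd.unique ?_
  rw [hasDerivAt_iff_isLittleO_nhds_zero]
  simp only [zero_add, zero_smul, f0, sub_zero, smul_zero]
  have hl : Tendsto (fun t : ℝ => t • v) (𝓝[≠] 0) (𝓝[≠] 0) := by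
    refine tendsto_nhdsWithin_iff.2 ⟨?_, ?_⟩
    · have : Continuous fun t : ℝ => t • v := by fun_prop
      have := this.tendsto 0
      rw [zero_smul] at this
      exact this.mono_left nhdsWithin_le_nhds
    · filter_upwards [self_mem_nhdsWithin] with t ht
      exact smul_ne_zero ht hv
  have key : (fun t : ℝ => f (t • v)) =o[𝓝[≠] 0] fun t => t :=
    (hO.comp_tendsto hl).trans_isLittleO ho
  rw [show 𝓝 (0 : ℝ) = 𝓝[≠] 0 ⊔ pure 0 by rw [sup_comm, pure_sup_nhdsNE]]
  refine key.sup ?_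
  rw [isLittleO_pure]; simp [f0]

theorem fderiv_eq_zero_of_isBigO_two {F : Type*} [NormedAddCommGroup F] [NormedSpace ℝ F]
    {f : Heis → F} (hf : DifferentiableAt ℝ f 0)
    (hO : f =O[𝓝[≠] 0] fun q => heisNorm q ^ (2 : ℤ)) {v : Heis} (hv : v.2 = 0) (hv0 : v ≠ 0) :
    fderiv ℝ f 0 v = 0 := by
  refine fderiv_eq_zero_of_isBigO hf (k := 2) two_ne_zero hO hv0 ?_
  have hn : ∀ t : ℝ, heisNorm (t • v) ^ ((2 : ℕ) : ℤ) = ‖v.1‖ ^ 2 * t ^ 2 := by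
    intro t
    have : heisNorm (t • v) ^ 2 = ‖v.1‖ ^ 2 * t ^ 2 := by
      rw [heisNorm_sq]
      simp [heisV, hv, mul_pow]; ring
    rw [← this]; norm_cast
  simp only [hn]
  exact ((isLittleO_pow_id (one_lt_two)).const_mul_left _).mono nhdsWithin_le_nhds

/-- Central differences: a smooth function which vanishes to order `3` for the Heisenberg norm has
horizontal derivatives vanishing to order `2`. -/
theorem isBigO_fderiv_horizontal {F : Type*} [NormedAddCommGroup F] [NormedSpace ℝ F]
    {f : Heis → F} (hf : ContDiffAt ℝ ∞ f 0)
    (hO : f =O[𝓝[≠] 0] fun q => heisNorm q ^ (3 : ℤ)) {v : Heis} (hv : v.2 = 0) (hv1 : ‖v‖ = 1) :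
    (fun q => fderiv ℝ f q v) =O[𝓝[≠] 0] fun q => heisNorm q ^ (2 : ℤ) := by
  have h1 : ContDiffAt ℝ ∞ (fun q => fderiv ℝ f q v) 0 :=
    (hf.fderiv_right (m := ∞) (by simp)).clm_apply contDiffAt_const
  set g := fun q => fderiv ℝ f q v
  have h2 : ContDiffAt ℝ ∞ (fun q => fderiv ℝ g q v) 0 :=
    (h1.fderiv_right (m := ∞) (by simp)).clm_apply contDiffAt_const
  set k := fun q => fderiv ℝ g q v
  obtain ⟨K, s, hs, hK⟩ := (h2.of_le (m := 1) (by simp)).exists_lipschitzOnWith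
  have e1 : ∀ᶠ q in 𝓝 (0 : Heis), DifferentiableAt ℝ f q :=
    ((hf.of_le (m := 1) (by simp)).eventually (by simp)).mono fun q h =>
      h.differentiableAt (by simp)
  have e2 : ∀ᶠ q in 𝓝 (0 : Heis), DifferentiableAt ℝ g q :=
    ((h1.of_le (m := 1) (by simp)).eventually (by simp)).mono fun q h =>
      h.differentiableAt (by simp)
  obtain ⟨C, hC0, hC⟩ := hO.exists_nonneg
  have e3 := eventually_nhdsWithin_iff.1 hC.bound
  have f0 : f 0 = 0 := eq_zero_of_isBigO hf.continuousAt three_ne_zero hO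
  obtain ⟨δ, hδ, hb⟩ := Metric.mem_nhds_iff.1 (Filter.inter_mem (Filter.inter_mem hs e1)
    (Filter.inter_mem e2 e3))
  have hball : ∀ q : Heis, ‖q‖ < δ → q ∈ s ∧ DifferentiableAt ℝ f q ∧ DifferentiableAt ℝ g q ∧
      ‖f q‖ ≤ C * heisNorm q ^ 3 := by
    intro q hq
    have := hb (mem_ball_zero_iff.2 hq)
    refine ⟨this.1.1, this.1.2, this.2.1, ?_⟩
    by_cases h : q = 0
    · rw [h, f0, heisNorm_zero]; simp
    · have h3 := this.2.2 h
      rw [Real.norm_of_nonneg (zpow_nonneg (heisNorm_nonneg _) _)] at h3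
      exact_mod_cast h3
  obtain ⟨δ', hδ', hsm⟩ := exists_heisNorm_lt_of_mem_nhds
    (Metric.ball_mem_nhds (0 : Heis) (half_pos hδ))
  refine IsBigO.of_bound (27 * C + 2 * K) ?_
  have e4 : ∀ᶠ q in 𝓝[≠] (0 : Heis), heisNorm q ∈ Ioo 0 (min δ' (δ / 2)) :=
    tendsto_heisNorm.eventually (Ioo_mem_nhdsGT (by positivity))
  filter_upwards [e4] with q hq4
  obtain ⟨hpos, hlt⟩ := hq4
  have hqb : ‖q‖ < δ / 2 := by simpa using hsm q (hlt.trans_le (min_le_left _ _))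
  have hhd : heisNorm q < δ / 2 := hlt.trans_le (min_le_right _ _)
  set h := heisNorm q with hh
  have hin : ∀ t ∈ Icc (-h) h, ‖q + t • v‖ < δ := by
    intro t ht
    calc ‖q + t • v‖ ≤ ‖q‖ + ‖t • v‖ := norm_add_le _ _
      _ = ‖q‖ + |t| := by rw [norm_smul, hv1, mul_one, Real.norm_eq_abs]
      _ < δ := by have := abs_le.2 ht; linarith
  have hline : ∀ t : ℝ, HasDerivAt (fun t : ℝ => q + t • v) v t := fun t => by
    simpa using ((hasDerivAt_id t).smul_const v).const_add q
  have hF : ∀ t ∈ Icc (-h) h, HasDerivAt (fun t : ℝ => f (q + t • v)) (g (q + t • v)) t :=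
    fun t ht => (hball _ (hin t ht)).2.1.hasFDerivAt.comp_hasDerivAt t (hline t)
  have hG : ∀ t ∈ Icc (-h) h, HasDerivAt (fun t : ℝ => g (q + t • v)) (k (q + t • v)) t :=
    fun t ht => by
      have := (hball _ (hin t ht)).2.2.1.hasFDerivAt
      exact this.comp_hasDerivAt t (hline t)
  have hsub : ∀ t ∈ Icc 0 h, t ∈ Icc (-h) h ∧ -t ∈ Icc (-h) h := fun t ht =>
    ⟨⟨by linarith [ht.1], ht.2⟩, ⟨by linarith [ht.2], by linarith [ht.1]⟩⟩
  have hG' : ∀ t ∈ Icc 0 h, HasDerivAt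
      (fun t : ℝ => g (q + t • v) + g (q + (-t) • v) - (2 : ℝ) • g q)
      (k (q + t • v) - k (q + (-t) • v)) t := by
    intro t ht
    have a := hG t (hsub t ht).1
    have b := (hG (-t) (hsub t ht).2).scomp t (hasDerivAt_neg t)
    have := (a.add b).sub_const ((2 : ℝ) • g q)
    simpa [sub_eq_add_neg, Function.comp_def] using this
  have hF' : ∀ t ∈ Icc 0 h, HasDerivAt
      (fun t : ℝ => f (q + t • v) - f (q + (-t) • v) - t • ((2 : ℝ) • g q))
      (g (q + t • v) + g (q + (-t) • v) - (2 : ℝ) • g q) t := by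
    intro t ht
    have a := hF t (hsub t ht).1
    have b := (hF (-t) (hsub t ht).2).scomp t (hasDerivAt_neg t)
    exact ((a.sub b).sub ((hasDerivAt_id t).smul_const ((2 : ℝ) • g q))).congr_deriv (by simp)
  have B1 : ∀ t ∈ Icc 0 h, ‖k (q + t • v) - k (q + (-t) • v)‖ ≤ 2 * K * h := by
    intro t ht
    refine (hK.norm_sub_le (hball _ (hin t (hsub t ht).1)).1
      (hball _ (hin (-t) (hsub t ht).2)).1).trans ?_
    have : q + t • v - (q + (-t) • v) = (2 * t) • v := by module
    rw [this, norm_smul, hv1, Real.norm_of_nonneg (by linarith [ht.1])]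
    have := ht.2
    nlinarith [K.coe_nonneg]
  have B2 : ∀ t ∈ Icc 0 h, ‖g (q + t • v) + g (q + (-t) • v) - (2 : ℝ) • g q‖ ≤ 2 * K * h * h := by
    intro t ht
    have := (convex_Icc (0 : ℝ) h).norm_image_sub_le_of_norm_hasDerivWithin_le
      (fun x hx => (hG' x hx).hasDerivWithinAt) B1 (left_mem_Icc.2 hpos.le) ht
    have e : g (q + (0 : ℝ) • v) + g (q + (-(0 : ℝ)) • v) - (2 : ℝ) • g q = 0 := by
      simp [two_smul]
    rw [e, sub_zero, sub_zero, Real.norm_of_nonneg ht.1] at this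
    refine this.trans ?_
    gcongr
    exact ht.2
  have B3 := (convex_Icc (0 : ℝ) h).norm_image_sub_le_of_norm_hasDerivWithin_le
      (fun x hx => (hF' x hx).hasDerivWithinAt) B2 (left_mem_Icc.2 hpos.le)
      (right_mem_Icc.2 hpos.le)
  simp only [zero_smul, neg_zero, add_zero, sub_self, sub_zero] at B3
  rw [Real.norm_of_nonneg hpos.le] at B3
  have hN : ∀ t ∈ Icc (-h) h, ‖f (q + t • v)‖ ≤ C * (3 * h) ^ 3 := by
    intro t ht
    refine (hball _ (hin t ht)).2.2.2.trans ?_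
    gcongr
    · exact heisNorm_nonneg _
    refine le_of_pow_le_pow_left₀ (n := 4) (by norm_num) (by positivity) ?_
    rw [heisNorm_pow_four, heisN]
    have a1 : ‖(q + t • v).1‖ ≤ 2 * h := by
      have : ‖v.1‖ ≤ 1 := hv1 ▸ norm_fst_le v
      calc ‖(q + t • v).1‖ ≤ ‖q.1‖ + ‖t • v.1‖ := norm_add_le _ _
        _ ≤ h + h * 1 := by
          rw [norm_smul]
          gcongr
          · exact norm_fst_le_heisNorm q
          · exact abs_le.2 ht
        _ = 2 * h := by ring
    have a2 : (q + t • v).2 = q.2 := by simp [hv]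
    have a3 := abs_snd_le_heisNorm_sq q
    rw [a2, ← sq_abs q.2]
    calc ‖(q + t • v).1‖ ^ 4 + |q.2| ^ 2 ≤ (2 * h) ^ 4 + (h ^ 2) ^ 2 := by gcongr
      _ ≤ (3 * h) ^ 4 := by nlinarith [pow_pos hpos 4]
  have hp := hN h ⟨by linarith, le_rfl⟩
  have hm := hN (-h) ⟨le_rfl, by linarith⟩
  have key : ‖h • (2 : ℝ) • g q‖ ≤ 2 * C * (3 * h) ^ 3 + 2 * K * h * h * h := by
    have : h • (2 : ℝ) • g q = (f (q + h • v) - f (q + (-h) • v))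
      - (f (q + h • v) - f (q + (-h) • v) - h • (2 : ℝ) • g q) := by abel
    rw [this]
    refine (norm_sub_le _ _).trans ?_
    have := norm_sub_le (f (q + h • v)) (f (q + (-h) • v))
    linarith
  rw [norm_smul, norm_smul, Real.norm_of_nonneg hpos.le, Real.norm_of_nonneg (by norm_num : (0 : ℝ) ≤ 2)]
    at key
  rw [Real.norm_of_nonneg (zpow_nonneg hpos.le _)]
  have : h * ‖g q‖ ≤ h * ((27 * C + 2 * K) * h ^ 2) := by
    nlinarith [mul_nonneg K.coe_nonneg (pow_pos hpos 3).le]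
  exact_mod_cast le_of_mul_le_mul_left this hpos

/-- A smooth function which vanishes to order `3` for the Heisenberg norm has derivative in the
direction `t` vanishing to order `1`. -/
theorem isBigO_fderiv_et {F : Type*} [NormedAddCommGroup F] [NormedSpace ℝ F]
    {f : Heis → F} (hf : ContDiffAt ℝ ∞ f 0)
    (hO : f =O[𝓝[≠] 0] fun q => heisNorm q ^ (3 : ℤ)) :
    (fun q => fderiv ℝ f q et) =O[𝓝[≠] 0] fun q => heisNorm q ^ (1 : ℤ) := by
  have h1 : ContDiffAt ℝ ∞ (fun q => fderiv ℝ f q et) 0 :=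
    (hf.fderiv_right (m := ∞) (by simp)).clm_apply contDiffAt_const
  -- the derivative at the origin vanishes, since `f (0, t) = O(|t| ^ (3 / 2))`
  have hz : fderiv ℝ f 0 et = 0 := by
    refine fderiv_eq_zero_of_isBigO (hf.differentiableAt (by simp)) three_ne_zero hO
      (v := et) (by simp) ?_
    have hn : ∀ t : ℝ, heisNorm (t • et) ^ ((3 : ℕ) : ℤ) = |t| * heisNorm (t • et) := by
      intro t
      have : heisNorm (t • et) ^ 2 = |t| := by
        rw [heisNorm_sq]
        simp [heisV]
      rw [← this]; norm_cast
    simp only [hn]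
    have t0 : Tendsto (fun t : ℝ => heisNorm (t • et)) (𝓝[≠] 0) (𝓝 0) := by
      have : Continuous fun t : ℝ => heisNorm (t • et) :=
        continuous_heisNorm.comp (by fun_prop)
      have := this.tendsto 0
      rw [zero_smul, heisNorm_zero] at this
      exact this.mono_left nhdsWithin_le_nhds
    have := (IsBigO.of_bound 1 (Eventually.of_forall fun t => by simp) :
      (fun t : ℝ => |t|) =O[𝓝[≠] 0] fun t => t).mul_isLittleO
        ((isLittleO_one_iff ℝ).2 t0)
    simpa using this
  have hb := (h1.differentiableAt (by simp)).isBigO_sub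
  simp only [hz, sub_zero] at hb
  refine (hb.mono nhdsWithin_le_nhds).trans (IsBigO.of_bound 1 ?_)
  have e : ∀ᶠ q in 𝓝[≠] (0 : Heis), heisNorm q ∈ Ioo (0 : ℝ) 1 :=
    tendsto_heisNorm.eventually (Ioo_mem_nhdsGT one_pos)
  filter_upwards [e] with q hq
  rw [zpow_one, one_mul, Real.norm_of_nonneg hq.1.le, Prod.norm_def, max_le_iff]
  refine ⟨norm_fst_le_heisNorm q, ?_⟩
  have := abs_snd_le_heisNorm_sq q
  rw [Real.norm_eq_abs]; nlinarith [hq.1, hq.2]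

/-! ### Coframes which osculate the Heisenberg coframe -/

/-- A unitary coframe near the origin which agrees with the standard coframe `(θ₀, √2 dz)` of the
Heisenberg group up to the errors allowed in CR normal coordinates. -/
structure IsNormalCoframe (ϑ : Heis → Heis →L[ℝ] ℝ) (η : Heis → Heis →L[ℝ] ℂ) (U : Set Heis) : Prop
    extends IsCoframe ϑ η U where
  zero_mem : 0 ∈ U
  contact_bound : ∃ a b : Heis → ℝ, a =O[𝓝[≠] 0] (fun q => heisNorm q ^ (4 : ℤ)) ∧
    b =O[𝓝[≠] 0] (fun q => heisNorm q ^ (5 : ℤ)) ∧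
    ∀ q ∈ U, ∀ u, ‖ϑ q u - stdForm q u‖ ≤ a q * ‖stdForm q u‖ + b q * ‖u.1‖
  coframe_bound : ∃ a b : Heis → ℝ, a =O[𝓝[≠] 0] (fun q => heisNorm q ^ (4 : ℤ)) ∧
    b =O[𝓝[≠] 0] (fun q => heisNorm q ^ (3 : ℤ)) ∧
    ∀ q ∈ U, ∀ u, ‖η q u - (√2 : ℂ) * u.1‖ ≤ a q * ‖u.1‖ + b q * ‖stdForm q u‖

theorem heisN_eq (q : Heis) : heisN q = (q.1.re ^ 2 + q.1.im ^ 2) ^ 2 + q.2 ^ 2 := by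
  rw [heisN, show ‖q.1‖ ^ 4 = (‖q.1‖ ^ 2) ^ 2 by ring, ← Complex.normSq_eq_norm_sq,
    Complex.normSq_apply]
  ring

theorem contDiff_heisN : ContDiff ℝ ∞ heisN := by
  have hre : ContDiff ℝ ∞ (fun q : Heis => q.1.re) := reCLM.contDiff.comp contDiff_fst
  have him : ContDiff ℝ ∞ (fun q : Heis => q.1.im) := imCLM.contDiff.comp contDiff_fst
  rw [show heisN = fun q => (q.1.re ^ 2 + q.1.im ^ 2) ^ 2 + q.2 ^ 2 from funext heisN_eq]
  exact ((((hre.pow 2).add (him.pow 2)).pow 2).add (contDiff_snd.pow 2))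

theorem fderiv_heisN (q u : Heis) : fderiv ℝ heisN q u =
    4 * ‖q.1‖ ^ 2 * (q.1.re * u.1.re + q.1.im * u.1.im)
      + 2 * q.2 * (stdForm q u + 2 * (q.1.im * u.1.re - q.1.re * u.1.im)) := by
  have hre : HasFDerivAt (fun q : Heis => q.1.re) (reCLM.comp (ContinuousLinearMap.fst ℝ ℂ ℝ)) q :=
    (reCLM.comp (ContinuousLinearMap.fst ℝ ℂ ℝ)).hasFDerivAt
  have him : HasFDerivAt (fun q : Heis => q.1.im) (imCLM.comp (ContinuousLinearMap.fst ℝ ℂ ℝ)) q :=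
    (imCLM.comp (ContinuousLinearMap.fst ℝ ℂ ℝ)).hasFDerivAt
  have ht : HasFDerivAt (fun q : Heis => q.2) (ContinuousLinearMap.snd ℝ ℂ ℝ) q :=
    (ContinuousLinearMap.snd ℝ ℂ ℝ).hasFDerivAt
  have h := (((hre.pow 2).add (him.pow 2)).pow 2).add (ht.pow 2)
  rw [show heisN = fun q => (q.1.re ^ 2 + q.1.im ^ 2) ^ 2 + q.2 ^ 2 from funext heisN_eq]
  have h' := h.fderiv
  have : fderiv ℝ (fun q : Heis => (q.1.re ^ 2 + q.1.im ^ 2) ^ 2 + q.2 ^ 2) q = _ := h'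
  rw [this, stdForm_apply, ← Complex.normSq_eq_norm_sq, Complex.normSq_apply]
  simp
  ring

/-- The derivative of `|z|⁴ + t²` in the direction of the standard horizontal vector `u` with
`√2 dz(u) = w`. -/
def stdDerivN (w : ℂ) (q : Heis) : ℝ :=
  (4 * ‖q.1‖ ^ 2 * (q.1.re * w.re + q.1.im * w.im)
    + 4 * q.2 * (q.1.im * w.re - q.1.re * w.im)) / √2

section

variable {α : Type*} {l : Filter α} {q : α → Heis}

theorem tendsto_heisNorm_comp (hq : Tendsto q l (𝓝[≠] 0)) :
    Tendsto (fun x => heisNorm (q x)) l (𝓝[>] 0) := tendsto_heisNorm.comp hq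

theorem isBigO_re {f : α → ℂ} {k : ℤ} (hf : f =O[l] fun x => heisNorm (q x) ^ k) :
    (fun x => (f x).re) =O[l] fun x => heisNorm (q x) ^ k :=
  isBigO_zpow_of_le hf (C := 1) (Eventually.of_forall fun x => by
    simpa using abs_re_le_norm _)

theorem isBigO_im {f : α → ℂ} {k : ℤ} (hf : f =O[l] fun x => heisNorm (q x) ^ k) :
    (fun x => (f x).im) =O[l] fun x => heisNorm (q x) ^ k :=
  isBigO_zpow_of_le hf (C := 1) (Eventually.of_forall fun x => by
    simpa using abs_im_le_norm _)

/-- Products of `x = Re z` and `y = Im z` with the components of a complex quantity. -/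
theorem isBigO_fst_mul (hq : Tendsto q l (𝓝[≠] 0)) {w : α → ℂ} {k n : ℤ}
    (hw : w =O[l] fun x => heisNorm (q x) ^ k) (hn : n ≤ 1 + k) :
    (fun x => (q x).1.re * (w x).re + (q x).1.im * (w x).im) =O[l]
      (fun x => heisNorm (q x) ^ n) ∧
    (fun x => (q x).1.im * (w x).re - (q x).1.re * (w x).im) =O[l]
      (fun x => heisNorm (q x) ^ n) := by
  have hρ := tendsto_heisNorm_comp hq
  exact ⟨(isBigO_re_fst.zpow_mul (isBigO_re hw) hρ hn).add
      (isBigO_im_fst.zpow_mul (isBigO_im hw) hρ hn),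
    (isBigO_im_fst.zpow_mul (isBigO_re hw) hρ hn).sub
      (isBigO_re_fst.zpow_mul (isBigO_im hw) hρ hn)⟩

theorem isBigO_stdDerivN (hq : Tendsto q l (𝓝[≠] 0)) (w : ℂ) :
    (fun x => stdDerivN w (q x)) =O[l] fun x => heisNorm (q x) ^ (3 : ℤ) := by
  have hρ := tendsto_heisNorm_comp hq
  have hw : (fun _ => w) =O[l] fun x => heisNorm (q x) ^ (0 : ℤ) :=
    (tendsto_const_nhds (x := w)).isBigO_zpow_zero
  obtain ⟨a, b⟩ := isBigO_fst_mul hq hw (n := 1) (by norm_num)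
  simp only [stdDerivN, div_eq_mul_inv, mul_comm _ (√2)⁻¹]
  exact (((isBigO_norm_fst_sq.const_mul_left 4).zpow_mul a hρ (by norm_num)).add
    ((isBigO_snd.const_mul_left 4).zpow_mul b hρ (by norm_num))).const_mul_left _

end

namespace IsNormalCoframe

variable {ϑ : Heis → Heis →L[ℝ] ℝ} {η : Heis → Heis →L[ℝ] ℂ} {U : Set Heis}
  (h : IsNormalCoframe ϑ η U)
include h

theorem mem_nhds : U ∈ 𝓝 (0 : Heis) := h.isOpen.mem_nhds h.zero_mem

theorem eventually_mem {α : Type*} {l : Filter α} {q : α → Heis} (hq : Tendsto q l (𝓝[≠] 0)) :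
    ∀ᶠ x in l, q x ∈ U :=
  (hq.mono_right nhdsWithin_le_nhds).eventually h.mem_nhds

theorem isBigO_zero_of_continuousOn {F : Type*} [NormedAddCommGroup F] {f : Heis → F}
    (hf : ContinuousOn f U) {α : Type*} {l : Filter α} {q : α → Heis}
    (hq : Tendsto q l (𝓝[≠] 0)) :
    (fun x => f (q x)) =O[l] fun x => heisNorm (q x) ^ (0 : ℤ) :=
  (((hf.continuousAt h.mem_nhds).tendsto.mono_left nhdsWithin_le_nhds).comp hq).isBigO_zpow_zero

section

variable {α : Type*} {l : Filter α} {q : α → Heis} (hq : Tendsto q l (𝓝[≠] 0)) {u : α → Heis}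
include hq

theorem contact_sub {j k : ℤ} (hz : (fun x => (u x).1) =O[l] fun x => heisNorm (q x) ^ j)
    (hσ : (fun x => stdForm (q x) (u x)) =O[l] fun x => heisNorm (q x) ^ k) {n : ℤ}
    (h1 : n ≤ 4 + k) (h2 : n ≤ 5 + j) :
    (fun x => ϑ (q x) (u x) - stdForm (q x) (u x)) =O[l] fun x => heisNorm (q x) ^ n := by
  obtain ⟨a, b, ha, hb, hab⟩ := h.contact_bound
  have hρ := tendsto_heisNorm_comp hq
  refine isBigO_zpow_of_le (((ha.comp_tendsto hq).zpow_mul hσ.norm_left hρ h1).add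
    ((hb.comp_tendsto hq).zpow_mul hz.norm_left hρ h2)) (C := 1) ?_
  filter_upwards [h.eventually_mem hq] with x hx
  rw [one_mul]
  exact (hab _ hx _).trans (le_abs_self _)

theorem coframe_sub {j k : ℤ} (hz : (fun x => (u x).1) =O[l] fun x => heisNorm (q x) ^ j)
    (hσ : (fun x => stdForm (q x) (u x)) =O[l] fun x => heisNorm (q x) ^ k) {n : ℤ}
    (h1 : n ≤ 4 + j) (h2 : n ≤ 3 + k) :
    (fun x => η (q x) (u x) - (√2 : ℂ) * (u x).1) =O[l] fun x => heisNorm (q x) ^ n := by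
  obtain ⟨a, b, ha, hb, hab⟩ := h.coframe_bound
  have hρ := tendsto_heisNorm_comp hq
  refine isBigO_zpow_of_le (((ha.comp_tendsto hq).zpow_mul hz.norm_left hρ h1).add
    ((hb.comp_tendsto hq).zpow_mul hσ.norm_left hρ h2)) (C := 1) ?_
  filter_upwards [h.eventually_mem hq] with x hx
  rw [one_mul]
  exact (hab _ hx _).trans (le_abs_self _)

theorem contact_isBigO {j k : ℤ} (hz : (fun x => (u x).1) =O[l] fun x => heisNorm (q x) ^ j)
    (hσ : (fun x => stdForm (q x) (u x)) =O[l] fun x => heisNorm (q x) ^ k) (hk : k ≤ 5 + j) :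
    (fun x => ϑ (q x) (u x)) =O[l] fun x => heisNorm (q x) ^ k := by
  simpa using (h.contact_sub hq hz hσ (n := k) (by linarith) hk).add hσ

theorem coframe_isBigO {j k : ℤ} (hz : (fun x => (u x).1) =O[l] fun x => heisNorm (q x) ^ j)
    (hσ : (fun x => stdForm (q x) (u x)) =O[l] fun x => heisNorm (q x) ^ k) (hk : j ≤ 3 + k) :
    (fun x => η (q x) (u x)) =O[l] fun x => heisNorm (q x) ^ j := by
  simpa using (h.coframe_sub hq hz hσ (n := j) (by linarith) hk).add (hz.const_mul_left (√2 : ℂ))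

end

/-- A horizontal vector field with constant `η`-component `w` is close to the corresponding
standard one. -/
theorem horizontal_field {H : Heis → Heis} (hH : ContinuousOn H U) {w : ℂ}
    (h0 : ∀ q ∈ U, ϑ q (H q) = 0) (hw : ∀ q ∈ U, η q (H q) = w) :
    (fun q => stdForm q (H q)) =O[𝓝[≠] 0] (fun q => heisNorm q ^ (5 : ℤ)) ∧
    (fun q => (H q).1 - w / (√2 : ℂ)) =O[𝓝[≠] 0] (fun q => heisNorm q ^ (4 : ℤ)) := by
  have hid : Tendsto (fun q : Heis => q) (𝓝[≠] 0) (𝓝[≠] 0) := tendsto_id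
  have hz := h.isBigO_zero_of_continuousOn (continuous_fst.comp_continuousOn hH) hid
  have hσ0 : (fun q => stdForm q (H q)) =O[𝓝[≠] 0] (fun q => heisNorm q ^ (0 : ℤ)) := by
    refine h.isBigO_zero_of_continuousOn (f := fun q => stdForm q (H q)) ?_ hid
    simp only [stdForm_apply]
    have := continuous_re.comp_continuousOn (continuous_fst.comp_continuousOn hH)
    have := continuous_im.comp_continuousOn (continuous_fst.comp_continuousOn hH)
    have := continuous_snd.comp_continuousOn hH
    simp only [Function.comp_def] at *
    fun_prop
  -- The error in `θ₀(H)` involves `ρ⁴ θ₀(H)` itself: an estimate of order `0` improves to order `4`,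
  -- and then to the order `5` of the error in `dz`.
  have step : ∀ {k : ℤ}, (fun q => stdForm q (H q)) =O[𝓝[≠] 0] (fun q => heisNorm q ^ k) →
      ∀ {n : ℤ}, n ≤ 4 + k → n ≤ 5 →
      (fun q => stdForm q (H q)) =O[𝓝[≠] 0] (fun q => heisNorm q ^ n) := by
    intro k hk n hn hn5
    refine isBigO_zpow_of_le (h.contact_sub hid hz hk hn (by linarith)) (C := 1) ?_
    filter_upwards [h.eventually_mem hid] with q hq
    rw [h0 q hq]; simp
  have hσ := step (step hσ0 (n := 4) (by norm_num) (by norm_num)) (n := 5) (by norm_num) le_rfl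
  refine ⟨hσ, isBigO_zpow_of_le (h.coframe_sub hid hz hσ (n := 4) (by norm_num) (by norm_num))
    (C := 1) ?_⟩
  filter_upwards [h.eventually_mem hid] with q hq
  rw [hw q hq, one_mul, norm_sub_rev w]
  have h2 : (√2 : ℂ) ≠ 0 := by
    exact_mod_cast Complex.ofReal_ne_zero.2 (by positivity : √2 ≠ 0)
  have : (H q).1 - w / (√2 : ℂ) = ((√2 : ℂ) * (H q).1 - w) / (√2 : ℂ) := by field_simp
  rw [this, norm_div]
  refine div_le_self (norm_nonneg _) ?_
  rw [Complex.norm_real, Real.norm_of_nonneg (by positivity)]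
  exact Real.one_le_sqrt.2 (by norm_num)

theorem horizontal_field_snd {H : Heis → Heis} (hH : ContinuousOn H U) {w : ℂ}
    (h0 : ∀ q ∈ U, ϑ q (H q) = 0) (hw : ∀ q ∈ U, η q (H q) = w) :
    (fun q => (H q).2) =O[𝓝[≠] 0] (fun q => heisNorm q ^ (1 : ℤ)) := by
  have hid : Tendsto (fun q : Heis => q) (𝓝[≠] 0) (𝓝[≠] 0) := tendsto_id
  have hz := h.isBigO_zero_of_continuousOn (continuous_fst.comp_continuousOn hH) hid
  have e : (fun q => (H q).2) =
      fun q => stdForm q (H q) + 2 * (q.1.im * (H q).1.re - q.1.re * (H q).1.im) := by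
    funext q; rw [stdForm_apply]; ring
  rw [e]
  exact ((h.horizontal_field hH h0 hw).1.zpow_mono tendsto_heisNorm (by norm_num)).add
    ((isBigO_fst_mul hid hz (by norm_num)).2.const_mul_left 2)

/-- The derivative of `|z|⁴ + t²` along a horizontal field, compared with its standard value. -/
theorem derivN_sub {H : Heis → Heis} (hH : ContinuousOn H U) {w : ℂ}
    (h0 : ∀ q ∈ U, ϑ q (H q) = 0) (hw : ∀ q ∈ U, η q (H q) = w) :
    (fun q => fderiv ℝ heisN q (H q) - stdDerivN w q) =O[𝓝[≠] 0]
      (fun q => heisNorm q ^ (7 : ℤ)) := by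
  have hid : Tendsto (fun q : Heis => q) (𝓝[≠] 0) (𝓝[≠] 0) := tendsto_id
  obtain ⟨hσ, hd⟩ := h.horizontal_field hH h0 hw
  obtain ⟨a, b⟩ := isBigO_fst_mul hid hd (n := 5) (by norm_num)
  have e : (fun q => fderiv ℝ heisN q (H q) - stdDerivN w q) = fun q =>
      4 * ‖q.1‖ ^ 2 * (q.1.re * ((H q).1 - w / (√2 : ℂ)).re + q.1.im * ((H q).1 - w / (√2 : ℂ)).im)
      + 2 * q.2 * stdForm q (H q)
      + 4 * q.2 * (q.1.im * ((H q).1 - w / (√2 : ℂ)).re - q.1.re * ((H q).1 - w / (√2 : ℂ)).im) := by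
    funext q
    have h1 : (w / (√2 : ℂ)).re = w.re / √2 := by rw [Complex.div_ofReal_re]
    have h2 : (w / (√2 : ℂ)).im = w.im / √2 := by rw [Complex.div_ofReal_im]
    rw [fderiv_heisN, stdDerivN, sub_re, sub_im, h1, h2]
    ring
  rw [e]
  exact (((isBigO_norm_fst_sq.const_mul_left 4).zpow_mul a tendsto_heisNorm (by norm_num)).add
    ((isBigO_snd.const_mul_left 2).zpow_mul hσ tendsto_heisNorm (by norm_num))).add
    ((isBigO_snd.const_mul_left 4).zpow_mul b tendsto_heisNorm (by norm_num))

theorem derivN {H : Heis → Heis} (hH : ContinuousOn H U) {w : ℂ}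
    (h0 : ∀ q ∈ U, ϑ q (H q) = 0) (hw : ∀ q ∈ U, η q (H q) = w) :
    (fun q => fderiv ℝ heisN q (H q)) =O[𝓝[≠] 0] (fun q => heisNorm q ^ (3 : ℤ)) := by
  simpa using ((h.derivN_sub hH h0 hw).zpow_mono tendsto_heisNorm (by norm_num)).add
    (isBigO_stdDerivN tendsto_id w)

/-- The derivative along a horizontal field of a smooth function vanishing to order `3`. -/
theorem fderiv_horizontal_field {H : Heis → Heis} (hH : ContinuousOn H U) {w : ℂ}
    (h0 : ∀ q ∈ U, ϑ q (H q) = 0) (hw : ∀ q ∈ U, η q (H q) = w) {f : Heis → ℝ}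
    (hf : ContDiffAt ℝ ∞ f 0) (hO : f =O[𝓝[≠] 0] fun q => heisNorm q ^ (3 : ℤ)) :
    (fun q => fderiv ℝ f q (H q)) =O[𝓝[≠] 0] (fun q => heisNorm q ^ (2 : ℤ)) := by
  have hid : Tendsto (fun q : Heis => q) (𝓝[≠] 0) (𝓝[≠] 0) := tendsto_id
  have hz := h.isBigO_zero_of_continuousOn (continuous_fst.comp_continuousOn hH) hid
  have e : (fun q => fderiv ℝ f q (H q)) = fun q => (H q).1.re * fderiv ℝ f q ex
      + (H q).1.im * fderiv ℝ f q ey + (H q).2 * fderiv ℝ f q et := by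
    funext q
    rw [map_heis (fderiv ℝ f q) (H q)]; rfl
  rw [e]
  have a := isBigO_fderiv_horizontal hf hO (v := ex) rfl (by simp [Prod.norm_def])
  have b := isBigO_fderiv_horizontal hf hO (v := ey) rfl (by simp [Prod.norm_def])
  exact (((isBigO_re hz).zpow_mul a tendsto_heisNorm (by norm_num)).add
    ((isBigO_im hz).zpow_mul b tendsto_heisNorm (by norm_num))).add
    ((h.horizontal_field_snd hH h0 hw).zpow_mul (isBigO_fderiv_et hf hO) tendsto_heisNorm
      (by norm_num))

theorem continuousOn_X : ContinuousOn (frX ϑ η) U := h.contDiffOn_X.continuousOn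
theorem continuousOn_Y : ContinuousOn (frY ϑ η) U := h.contDiffOn_Y.continuousOn

/-- The sublaplacian of `|z|⁴ + t²`. The field `B_N` has horizontal components of order `3`, and
horizontal derivatives lower the order by one. -/
theorem divg_gradField_heisN :
    (fun q => divg (gradField ϑ η heisN) q) =O[𝓝[≠] 0] (fun q => heisNorm q ^ (2 : ℤ)) := by
  have hid : Tendsto (fun q : Heis => q) (𝓝[≠] 0) (𝓝[≠] 0) := tendsto_id
  have hc := h.contDiffOn_contactDensity
  have hP : ContDiffOn ℝ ∞ (fun q => -(contactDensity ϑ q / 2) * fderiv ℝ heisN q (frX ϑ η q)) U :=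
    (hc.div_const 2).neg.mul (h.contDiffOn_fderiv_X contDiff_heisN.contDiffOn)
  have hQ : ContDiffOn ℝ ∞ (fun q => -(contactDensity ϑ q / 2) * fderiv ℝ heisN q (frY ϑ η q)) U :=
    (hc.div_const 2).neg.mul (h.contDiffOn_fderiv_Y contDiff_heisN.contDiffOn)
  have hc0 := h.isBigO_zero_of_continuousOn (hc.div_const 2).neg.continuousOn hid
  have hPO := hc0.zpow_mul (h.derivN h.continuousOn_X (fun q hq => h.ϑ_X hq) fun q hq => h.η_X hq)
    tendsto_heisNorm (n := 3) (by norm_num)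
  have hQO := hc0.zpow_mul (h.derivN h.continuousOn_Y (fun q hq => h.ϑ_Y hq) fun q hq => h.η_Y hq)
    tendsto_heisNorm (n := 3) (by norm_num)
  set P := fun q => -(contactDensity ϑ q / 2) * fderiv ℝ heisN q (frX ϑ η q)
  set Q := fun q => -(contactDensity ϑ q / 2) * fderiv ℝ heisN q (frY ϑ η q)
  have hdX := h.isBigO_zero_of_continuousOn
    (h.continuousOn_divg h.contDiffOn_X) hid
  have hdY := h.isBigO_zero_of_continuousOn
    (h.continuousOn_divg h.contDiffOn_Y) hid
  have hsum := (((h.fderiv_horizontal_field h.continuousOn_X (fun q hq => h.ϑ_X hq)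
      (fun q hq => h.η_X hq) (hP.contDiffAt h.mem_nhds) hPO).add
    (hPO.zpow_mul hdX tendsto_heisNorm (n := 2) (by norm_num))).add
    ((h.fderiv_horizontal_field h.continuousOn_Y (fun q hq => h.ϑ_Y hq)
      (fun q hq => h.η_Y hq) (hQ.contDiffAt h.mem_nhds) hQO).add
    (hQO.zpow_mul hdY tendsto_heisNorm (n := 2) (by norm_num))))
  refine hsum.congr' ?_ EventuallyEq.rfl
  filter_upwards [h.eventually_mem hid] with q hq
  have hn := h.isOpen.mem_nhds hq
  have e : gradField ϑ η heisN =ᶠ[𝓝 q] fun x => P x • frX ϑ η x + Q x • frY ϑ η x := by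
    filter_upwards [hn] with x hx
    rw [h.gradField_eq hx, smul_add, smul_smul, smul_smul]
  have dP := (hP.contDiffAt hn).differentiableAt (by simp)
  have dQ := (hQ.contDiffAt hn).differentiableAt (by simp)
  have dX := (h.contDiffOn_X.contDiffAt hn).differentiableAt (by simp)
  have dY := (h.contDiffOn_Y.contDiffAt hn).differentiableAt (by simp)
  rw [divg_congr e, ← divg_smul dP dX, ← divg_smul dQ dY]
  exact (divg_add (dP.smul dX) (dQ.smul dY)).symm

end IsNormalCoframe

/-! ### The connection form of an osculating coframe -/

namespace IsNormalCoframe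

variable {ϑ : Heis → Heis →L[ℝ] ℝ} {η : Heis → Heis →L[ℝ] ℂ} {U : Set Heis}
  (h : IsNormalCoframe ϑ η U)
include h

theorem contact_zero (u : Heis) : ϑ 0 u = u.2 := by
  have hid : Tendsto (fun q : Heis => q) (𝓝[≠] 0) (𝓝[≠] 0) := tendsto_id
  have hu : (fun _ => u.1) =O[𝓝[≠] 0] fun x => heisNorm x ^ (0 : ℤ) :=
    (tendsto_const_nhds (x := u.1)).isBigO_zpow_zero
  have hc : Continuous fun q => stdForm q u := by
    simp only [stdForm_apply]; fun_prop
  have hσ : (fun q => stdForm q u) =O[𝓝[≠] 0] fun x => heisNorm x ^ (0 : ℤ) :=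
    h.isBigO_zero_of_continuousOn hc.continuousOn hid
  have hO := h.contact_sub hid (u := fun _ => u) hu hσ (n := 1) (by norm_num) (by norm_num)
  have h1 : ContDiffAt ℝ ∞ ϑ 0 := h.smooth₁.contDiffAt h.mem_nhds
  have := eq_zero_of_isBigO ((h1.continuousAt.clm_apply continuousAt_const).sub hc.continuousAt)
    one_ne_zero hO
  simpa [stdForm_apply, sub_eq_zero] using this

theorem coframe_zero (u : Heis) : η 0 u = (√2 : ℂ) * u.1 := by
  have hid : Tendsto (fun q : Heis => q) (𝓝[≠] 0) (𝓝[≠] 0) := tendsto_id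
  have hu : (fun _ => u.1) =O[𝓝[≠] 0] fun x => heisNorm x ^ (0 : ℤ) :=
    (tendsto_const_nhds (x := u.1)).isBigO_zpow_zero
  have hc : Continuous fun q => stdForm q u := by
    simp only [stdForm_apply]; fun_prop
  have hσ : (fun q => stdForm q u) =O[𝓝[≠] 0] fun x => heisNorm x ^ (0 : ℤ) :=
    h.isBigO_zero_of_continuousOn hc.continuousOn hid
  have hO := h.coframe_sub hid (u := fun _ => u) hu hσ (n := 1) (by norm_num) (by norm_num)
  have h1 : ContDiffAt ℝ ∞ η 0 := h.smooth₂.contDiffAt h.mem_nhds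
  have := eq_zero_of_isBigO ((h1.continuousAt.clm_apply continuousAt_const).sub
    continuousAt_const) one_ne_zero hO
  simpa [sub_eq_zero] using this

/-- The value `4` is that of the standard form `θ₀`, for which `dθ₀ = 2 i dz ∧ dz̄`. -/
theorem contactDensity_zero : contactDensity ϑ 0 = 4 := by
  rw [contactDensity, h.unitary 0 h.zero_mem]
  simp only [h.unitary 0 h.zero_mem, h.contact_zero, h.coframe_zero]
  have : √2 * √2 = (2 : ℝ) := Real.mul_self_sqrt (by norm_num)
  simp
  linarith

theorem eventually_contactDensity_pos : ∀ᶠ q in 𝓝 (0 : Heis), 0 < contactDensity ϑ q := by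
  have hc := (h.contDiffOn_contactDensity.continuousOn.continuousAt h.mem_nhds).tendsto
  rw [h.contactDensity_zero] at hc
  exact hc.eventually (lt_mem_nhds (by norm_num))

/-- The coefficients of the coframe agree with those of `√2 dz` to order `3`. -/
theorem coframe_coeff (v : Heis) :
    (fun q => η q v - (√2 : ℂ) * v.1) =O[𝓝[≠] 0] fun q => heisNorm q ^ (3 : ℤ) := by
  have hid : Tendsto (fun q : Heis => q) (𝓝[≠] 0) (𝓝[≠] 0) := tendsto_id
  have hu : (fun _ => v.1) =O[𝓝[≠] 0] fun x => heisNorm x ^ (0 : ℤ) :=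
    (tendsto_const_nhds (x := v.1)).isBigO_zpow_zero
  have hc : Continuous fun q => stdForm q v := by
    simp only [stdForm_apply]; fun_prop
  exact h.coframe_sub hid (u := fun _ => v) hu
    (h.isBigO_zero_of_continuousOn hc.continuousOn hid) (by norm_num) (by norm_num)

theorem fderiv_coframe (v : Heis) {w : Heis} (hw : w = ex ∨ w = ey) :
    (fun q => fderiv ℝ η q w v) =O[𝓝[≠] 0] (fun q => heisNorm q ^ (2 : ℤ)) ∧
    (fun q => fderiv ℝ η q et v) =O[𝓝[≠] 0] (fun q => heisNorm q ^ (1 : ℤ)) := by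
  have hη : ContDiffAt ℝ ∞ (fun q => η q v - (√2 : ℂ) * v.1) 0 :=
    ((h.smooth₂.contDiffAt h.mem_nhds).clm_apply contDiffAt_const).sub contDiffAt_const
  have e : ∀ w' : Heis, (fun q => fderiv ℝ (fun q => η q v - (√2 : ℂ) * v.1) q w') =ᶠ[𝓝[≠] 0]
      fun q => fderiv ℝ η q w' v := by
    intro w'
    filter_upwards [h.eventually_mem tendsto_id] with q hq
    have hd : DifferentiableAt ℝ η q :=
      (h.smooth₂.contDiffAt (h.isOpen.mem_nhds hq)).differentiableAt (by simp)
    have := (hd.hasFDerivAt.clm_apply (hasFDerivAt_const v q)).sub_const ((√2 : ℂ) * v.1)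
    rw [this.fderiv]; simp
  refine ⟨(isBigO_fderiv_horizontal hη (h.coframe_coeff v) ?_ ?_).congr' (e w) EventuallyEq.rfl,
    (isBigO_fderiv_et hη (h.coframe_coeff v)).congr' (e et) EventuallyEq.rfl⟩
  · rcases hw with rfl | rfl <;> rfl
  · rcases hw with rfl | rfl <;> simp [Prod.norm_def]

theorem dForm_coframe_coord :
    (fun q => dForm η q ex ey) =O[𝓝[≠] 0] (fun q => heisNorm q ^ (2 : ℤ)) ∧
    (fun q => dForm η q ex et) =O[𝓝[≠] 0] (fun q => heisNorm q ^ (1 : ℤ)) ∧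
    (fun q => dForm η q ey et) =O[𝓝[≠] 0] (fun q => heisNorm q ^ (1 : ℤ)) := by
  have a : ∀ w, w = ex ∨ w = ey → (fun q => dForm η q w et) =O[𝓝[≠] 0]
      (fun q => heisNorm q ^ (1 : ℤ)) := fun w hw =>
    ((h.fderiv_coframe et hw).1.zpow_mono tendsto_heisNorm (by norm_num)).sub
      (h.fderiv_coframe w hw).2
  exact ⟨(h.fderiv_coframe ey (w := ex) (by simp)).1.sub
    (h.fderiv_coframe ex (w := ey) (by simp)).1, a ex (by simp), a ey (by simp)⟩

/-- `dη` on a pair of bounded vector fields, in terms of the size of their `t`-components. -/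
theorem dForm_coframe {A B : Heis → Heis} (hA : ContinuousOn A U) (hB : ContinuousOn B U)
    {j : ℤ} (hj : j ≤ 1)
    (hA2 : (fun q => (A q).2) =O[𝓝[≠] 0] (fun q => heisNorm q ^ j))
    (hB2 : (fun q => (B q).2) =O[𝓝[≠] 0] (fun q => heisNorm q ^ j)) :
    (fun q => dForm η q (A q) (B q)) =O[𝓝[≠] 0] (fun q => heisNorm q ^ (j + 1)) := by
  have hid : Tendsto (fun q : Heis => q) (𝓝[≠] 0) (𝓝[≠] 0) := tendsto_id
  have hA1 := h.isBigO_zero_of_continuousOn (continuous_fst.comp_continuousOn hA) hid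
  have hB1 := h.isBigO_zero_of_continuousOn (continuous_fst.comp_continuousOn hB) hid
  obtain ⟨h1, h2, h3⟩ := h.dForm_coframe_coord
  have e : (fun q => dForm η q (A q) (B q)) = fun q =>
      ((A q).1.re * (B q).1.im - (A q).1.im * (B q).1.re) • dForm η q ex ey
      + ((A q).1.re * (B q).2 - (A q).2 * (B q).1.re) • dForm η q ex et
      + ((A q).1.im * (B q).2 - (A q).2 * (B q).1.im) • dForm η q ey et := by
    funext q
    rw [dForm, map_heis (fderiv ℝ η q (A q)) (B q), map_heis (fderiv ℝ η q (B q)) (A q),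
      map_heis (fderiv ℝ η q) (A q), map_heis (fderiv ℝ η q) (B q)]
    simp only [dForm, add_apply, smul_apply]
    module
  rw [e]
  have hρ := tendsto_heisNorm
  refine ((IsBigO.zpow_smul (j := 0) ?_ h1 hρ (by linarith)).add
    (IsBigO.zpow_smul (j := j) ?_ h2 hρ le_rfl)).add (IsBigO.zpow_smul (j := j) ?_ h3 hρ le_rfl)
  · exact ((isBigO_re hA1).zpow_mul (isBigO_im hB1) hρ (by norm_num)).sub
      ((isBigO_im hA1).zpow_mul (isBigO_re hB1) hρ (by norm_num))
  · exact ((isBigO_re hA1).zpow_mul hB2 hρ (by norm_num)).sub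
      (hA2.zpow_mul (isBigO_re hB1) hρ (by norm_num))
  · exact ((isBigO_im hA1).zpow_mul hB2 hρ (by norm_num)).sub
      (hA2.zpow_mul (isBigO_im hB1) hρ (by norm_num))

/-- The connection form is of order `j + 2` on vectors with `dz = O(ρ ^ j)`,
`θ₀ = O(ρ ^ (j + 1))`. -/
theorem connPot_isBigO {α : Type*} {l : Filter α} {q u : α → Heis} (hq : Tendsto q l (𝓝[≠] 0))
    {j : ℤ} (hz : (fun x => (u x).1) =O[l] fun x => heisNorm (q x) ^ j)
    (hσ : (fun x => stdForm (q x) (u x)) =O[l] fun x => heisNorm (q x) ^ (j + 1)) :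
    (fun x => connPot ϑ η (q x) (u x)) =O[l] fun x => heisNorm (q x) ^ (j + 2) := by
  have hid : Tendsto (fun q : Heis => q) (𝓝[≠] 0) (𝓝[≠] 0) := tendsto_id
  have hX2 := h.horizontal_field_snd h.continuousOn_X (fun q hq => h.ϑ_X hq) fun q hq => h.η_X hq
  have hY2 := h.horizontal_field_snd h.continuousOn_Y (fun q hq => h.ϑ_Y hq) fun q hq => h.η_Y hq
  have hT := h.contDiffOn_T.continuousOn
  have hT2 := h.isBigO_zero_of_continuousOn (continuous_snd.comp_continuousOn hT) hid
  have hXY := h.dForm_coframe h.continuousOn_X h.continuousOn_Y le_rfl hX2 hY2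
  have hTX := h.dForm_coframe hT h.continuousOn_X (j := 0) (by norm_num) hT2
    (hX2.zpow_mono tendsto_heisNorm (by norm_num))
  have hTY := h.dForm_coframe hT h.continuousOn_Y (j := 0) (by norm_num) hT2
    (hY2.zpow_mono tendsto_heisNorm (by norm_num))
  have m1 := (isBigO_re hXY).comp_tendsto hq
  have m2 := (isBigO_im hXY).comp_tendsto hq
  have m3 := (((isBigO_re hTY).sub (isBigO_im hTX)).const_mul_left (2⁻¹ : ℝ)).comp_tendsto hq
  have c := h.coframe_isBigO hq hz hσ (by linarith)
  have hρ := tendsto_heisNorm_comp hq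
  have := ((m1.zpow_mul (isBigO_re c) hρ (n := j + 2) (by linarith)).add
    (m2.zpow_mul (isBigO_im c) hρ (n := j + 2) (by linarith))).add
    (m3.zpow_mul (h.contact_isBigO hq hz hσ (by linarith)) hρ (n := j + 2) (by linarith))
  refine this.congr_left fun x => ?_
  simp only [connPot, Function.comp_apply, add_apply, smul_apply, smul_eq_mul, reForm_apply,
    imForm_apply]
  ring

/-- The connection form vanishes to order `2`, so that its horizontal derivatives vanish at the centre. -/
theorem dForm_connPot_zero : dForm (connPot ϑ η) 0 ex ey = 0 := by
  have hid : Tendsto (fun q : Heis => q) (𝓝[≠] 0) (𝓝[≠] 0) := tendsto_id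
  have hd : ContDiffAt ℝ ∞ (connPot ϑ η) 0 := h.contDiffOn_connPot.contDiffAt h.mem_nhds
  have key : ∀ v w : Heis, v.2 = 0 → v ≠ 0 → w.2 = 0 → fderiv ℝ (connPot ϑ η) 0 v w = 0 := by
    intro v w hv hv0 hw
    have hz : (fun _ => w.1) =O[𝓝[≠] 0] fun x => heisNorm x ^ (0 : ℤ) :=
      (tendsto_const_nhds (x := w.1)).isBigO_zpow_zero
    have hσ : (fun q => stdForm q w) =O[𝓝[≠] 0] fun x => heisNorm x ^ (1 : ℤ) := by
      refine ((isBigO_fst_mul hid hz (n := 1) (by norm_num)).2.const_mul_left (-2)).congr_left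
        fun q => ?_
      rw [stdForm_apply, hw]; ring
    have hO := h.connPot_isBigO hid (u := fun _ => w) (j := 0) hz hσ
    have hd' : DifferentiableAt ℝ (fun q => connPot ϑ η q w) 0 :=
      (hd.clm_apply contDiffAt_const).differentiableAt (by simp)
    have := fderiv_eq_zero_of_isBigO_two hd' hO hv hv0
    have e := ((hd.differentiableAt (by simp)).hasFDerivAt.clm_apply (hasFDerivAt_const w 0)).fderiv
    rw [e] at this
    simpa using this
  rw [dForm, key ex ey rfl (by simp) rfl, key ey ex rfl (by simp) rfl, sub_zero]

/-- On vectors tangent to Heisenberg spheres, `λ_N` is `-2 N d(arg v) - 2 |z|² θ₀` up to terms of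
order `8`. -/
theorem rotGrad_heisN_sub {α : Type*} {l : Filter α} {q u : α → Heis}
    (hq : Tendsto q l (𝓝[≠] 0))
    (hz : (fun x => (u x).1) =O[l] fun x => heisNorm (q x) ^ (1 : ℤ))
    (hσ : (fun x => stdForm (q x) (u x)) =O[l] fun x => heisNorm (q x) ^ (2 : ℤ)) :
    (fun x => rotGrad ϑ η heisN (q x) (u x) - (-2 * heisN (q x) * argForm (q x) (u x)
      - 2 * ‖(q x).1‖ ^ 2 * stdForm (q x) (u x))) =O[l] fun x => heisNorm (q x) ^ (8 : ℤ) := by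
  have hρ := tendsto_heisNorm_comp hq
  have hX := (h.derivN_sub h.continuousOn_X (fun q hq => h.ϑ_X hq)
    fun q hq => h.η_X hq).comp_tendsto hq
  have hY := (h.derivN_sub h.continuousOn_Y (fun q hq => h.ϑ_Y hq)
    fun q hq => h.η_Y hq).comp_tendsto hq
  have c := h.coframe_isBigO hq hz hσ (by norm_num)
  have d := h.coframe_sub hq hz hσ (n := 5) (by norm_num) (by norm_num)
  have := (((hY.zpow_mul (isBigO_re c) hρ (n := 8) (by norm_num)).add
    ((isBigO_stdDerivN hq I).zpow_mul (isBigO_re d) hρ (n := 8) (by norm_num))).sub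
    (hX.zpow_mul (isBigO_im c) hρ (n := 8) (by norm_num))).sub
    ((isBigO_stdDerivN hq 1).zpow_mul (isBigO_im d) hρ (n := 8) (by norm_num))
  refine this.congr' ?_ EventuallyEq.rfl
  have hne : ∀ᶠ x in l, q x ≠ 0 := hq.eventually self_mem_nhdsWithin
  filter_upwards [hne] with x hx
  have hv := heisV_ne_zero hx
  have hN : heisN (q x) * argForm (q x) (u x)
      = 2 * (q x).2 * ((q x).1.re * (u x).1.re + (q x).1.im * (u x).1.im)
        - ‖(q x).1‖ ^ 2 * (u x).2 := by
    have e : (heisN (q x) : ℂ) * (heisV (q x))⁻¹ = conj (heisV (q x)) := by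
      rw [heisN_eq_norm_sq, ← Complex.normSq_eq_norm_sq, Complex.normSq_eq_conj_mul_self]
      field_simp
    have : heisN (q x) * argForm (q x) (u x)
        = (conj (heisV (q x)) * fderiv ℝ heisV (q x) (u x)).im := by
      rw [argForm_apply, ← e, mul_assoc, Complex.im_ofReal_mul]
    rw [this, fderiv_heisV]
    simp [heisV, -Complex.ofReal_pow]
    ring
  have hs : √2 * √2 = (2 : ℝ) := Real.mul_self_sqrt (by norm_num)
  have hs' : √2 / √2 = (1 : ℝ) := div_self (by positivity)
  have e1 : stdDerivN I (q x) * √2 =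
      4 * ‖(q x).1‖ ^ 2 * (q x).1.im - 4 * (q x).2 * (q x).1.re := by
    rw [stdDerivN, div_mul_cancel₀ _ (by positivity)]; simp; ring
  have e2 : stdDerivN 1 (q x) * √2 =
      4 * ‖(q x).1‖ ^ 2 * (q x).1.re + 4 * (q x).2 * (q x).1.im := by
    rw [stdDerivN, div_mul_cancel₀ _ (by positivity)]; simp
  simp only [Function.comp_apply, rotGrad, sub_apply,
    smul_apply, smul_eq_mul, reForm_apply, imForm_apply, sub_re, sub_im,
    Complex.re_ofReal_mul, Complex.im_ofReal_mul]
  have e3 : -2 * heisN (q x) * argForm (q x) (u x) = -2 * (heisN (q x) * argForm (q x) (u x)) := by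
    ring
  rw [e3, hN, stdForm_apply]
  linear_combination (-(u x).1.re) * e1 + (u x).1.im * e2

end IsNormalCoframe

/-! ### Integrals over small Heisenberg spheres -/

/-- The integral over the parameter rectangle of the Heisenberg spheres. -/
def sphInt (k : ℝ → ℝ → ℝ) : ℝ :=
  ∫ φ in (-Real.pi)..Real.pi, ∫ s in (-(Real.pi / 2))..(Real.pi / 2), k φ s

/-- The density on the parameter rectangle of the two-form `ι_B (dx ∧ dy ∧ dt)`. -/
def fluxDens (B : Heis → Heis) (r φ s : ℝ) : ℝ :=
  det3 (B (heisSphere r φ s)) (sphPhi r φ s) (sphS r φ s)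

theorem flux_eq (B : Heis → Heis) (r : ℝ) : flux B r = sphInt (fluxDens B r) := rfl

theorem shellInt_eq (g : Heis → ℝ) (r : ℝ) :
    shellInt g r = sphInt fun φ s => g (heisSphere r φ s) * polJac r s := rfl

section

variable {k k' : ℝ → ℝ → ℝ}

theorem sphInt_add (hk : Continuous fun p : ℝ × ℝ => k p.1 p.2)
    (hk' : Continuous fun p : ℝ × ℝ => k' p.1 p.2) :
    sphInt (fun φ s => k φ s + k' φ s) = sphInt k + sphInt k' := by
  have i2 : ∀ {f : ℝ → ℝ → ℝ}, (Continuous fun p : ℝ × ℝ => f p.1 p.2) → ∀ φ,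
      IntervalIntegrable (fun s => f φ s) volume (-(Real.pi / 2)) (Real.pi / 2) := fun hf φ =>
    Continuous.intervalIntegrable (hf.comp (by fun_prop : Continuous fun s : ℝ => (φ, s))) _ _
  have i1 : ∀ {f : ℝ → ℝ → ℝ}, (Continuous fun p : ℝ × ℝ => f p.1 p.2) →
      IntervalIntegrable (fun φ => ∫ s in (-(Real.pi / 2))..(Real.pi / 2), f φ s) volume
        (-Real.pi) Real.pi := fun hf =>
    Continuous.intervalIntegrable (continuous_integral hf _ _) _ _
  rw [sphInt, sphInt, sphInt, ← intervalIntegral.integral_add (i1 hk) (i1 hk')]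
  exact intervalIntegral.integral_congr fun φ _ =>
    intervalIntegral.integral_add (i2 hk φ) (i2 hk' φ)

theorem sphInt_const_mul (c : ℝ) (k : ℝ → ℝ → ℝ) :
    sphInt (fun φ s => c * k φ s) = c * sphInt k := by
  simp only [sphInt, intervalIntegral.integral_const_mul]

theorem sphInt_sub (hk : Continuous fun p : ℝ × ℝ => k p.1 p.2)
    (hk' : Continuous fun p : ℝ × ℝ => k' p.1 p.2) :
    sphInt (fun φ s => k φ s - k' φ s) = sphInt k - sphInt k' := by
  have := sphInt_add hk (k' := fun φ s => (-1) * k' φ s) (hk'.const_mul (-1))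
  rw [sphInt_const_mul] at this
  simp only [neg_one_mul, ← sub_eq_add_neg] at this
  exact this

theorem norm_sphInt_le {C : ℝ} (h : ∀ φ s, ‖k φ s‖ ≤ C) :
    ‖sphInt k‖ ≤ C * (2 * Real.pi ^ 2) := by
  have h1 : ∀ φ ∈ uIoc (-Real.pi) Real.pi,
      ‖∫ s in (-(Real.pi / 2))..(Real.pi / 2), k φ s‖ ≤ C * Real.pi := fun φ _ => by
    refine (intervalIntegral.norm_integral_le_of_norm_le_const fun s _ => h φ s).trans_eq ?_
    rw [show Real.pi / 2 - -(Real.pi / 2) = Real.pi by ring, abs_of_pos Real.pi_pos]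
  refine (intervalIntegral.norm_integral_le_of_norm_le_const h1).trans_eq ?_
  rw [abs_of_pos (by linarith [Real.pi_pos])]; ring

theorem sphInt_nonpos (h : ∀ φ, ∀ s, 0 ≤ Real.cos s → k φ s ≤ 0) : sphInt k ≤ 0 := by
  have h0 : 0 ≤ ∫ φ in (-Real.pi)..Real.pi, ∫ s in (-(Real.pi / 2))..(Real.pi / 2), -k φ s :=
    intervalIntegral.integral_nonneg (by linarith [Real.pi_pos]) fun φ _ =>
      intervalIntegral.integral_nonneg (by linarith [Real.pi_pos]) fun s hs => by
        have := h φ s (Real.cos_nonneg_of_mem_Icc hs)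
        linarith
  simp only [intervalIntegral.integral_neg] at h0
  rw [sphInt]; linarith

end

theorem polJac_nonneg {r s : ℝ} (hr : 0 ≤ r) (hs : 0 ≤ Real.cos s) : 0 ≤ polJac r s := by
  rw [polJac]; positivity

theorem abs_polJac_le {r : ℝ} (hr : 0 ≤ r) (s : ℝ) : ‖polJac r s‖ ≤ 2 * r ^ 3 := by
  rw [polJac, Real.norm_eq_abs, abs_div, abs_of_pos (sqrt_one_add_cos_sq_pos s), abs_mul,
    abs_of_nonneg (by positivity : 0 ≤ 2 * r ^ 3), div_le_iff₀ (sqrt_one_add_cos_sq_pos s)]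
  have h1 : 1 ≤ √(1 + Real.cos s ^ 2) := Real.one_le_sqrt.2 (by nlinarith [sq_nonneg (Real.cos s)])
  have h2 := Real.abs_cos_le_one s
  have h3 : 0 ≤ 2 * r ^ 3 := by positivity
  nlinarith [mul_le_mul_of_nonneg_left (h2.trans h1) h3]

/-- The limiting density `r⁻² d(arg v) ∧ θ₀` on Heisenberg spheres. -/
def modelDens (s : ℝ) : ℝ := 4 * Real.cos s ^ 3 / √(1 + Real.cos s ^ 2)

theorem continuous_modelDens : Continuous modelDens := by
  refine Continuous.div (by fun_prop) (by fun_prop) fun s => (sqrt_one_add_cos_sq_pos s).ne'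

/-- On each meridian, twice the height `sphHeight` is a primitive of the density. -/
theorem sphInt_modelDens : sphInt (fun _ s => modelDens s) = 8 * Real.pi := by
  have h : ∫ s in (-(Real.pi / 2))..(Real.pi / 2), modelDens s = 4 := by
    have e : ∀ s, HasDerivAt (fun s => 2 * sphHeight s) (modelDens s) s := fun s => by
      refine ((hasDerivAt_sphHeight s).const_mul 2).congr_deriv ?_
      rw [modelDens]; ring
    rw [intervalIntegral.integral_eq_sub_of_hasDerivAt (fun s _ => e s)
      (continuous_modelDens.intervalIntegrable _ _)]
    simp [sphHeight]; norm_num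
  simp only [sphInt, h, intervalIntegral.integral_const, smul_eq_mul]
  ring

theorem continuous_sph {F : Type*} [TopologicalSpace F] {g : Heis → F} {U : Set Heis}
    (hg : ContinuousOn g U) {r : ℝ} (hr : ∀ φ s, heisSphere r φ s ∈ U) :
    Continuous fun p : ℝ × ℝ => g (heisSphere r p.1 p.2) :=
  hg.comp_continuous (continuous_const.heisSphere continuous_fst continuous_snd) fun _ => hr _ _

theorem continuous_fluxDens {B : Heis → Heis} {U : Set Heis} (hB : ContinuousOn B U) {r : ℝ}
    (hr : ∀ φ s, heisSphere r φ s ∈ U) : Continuous fun p : ℝ × ℝ => fluxDens B r p.1 p.2 :=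
  (continuous_sph hB hr).det3 (continuous_const.sphPhi continuous_fst continuous_snd)
    (continuous_const.sphS continuous_fst continuous_snd)

theorem continuous_shellDens {g : Heis → ℝ} {U : Set Heis} (hg : ContinuousOn g U) {r : ℝ}
    (hr : ∀ φ s, heisSphere r φ s ∈ U) :
    Continuous fun p : ℝ × ℝ => g (heisSphere r p.1 p.2) * polJac r p.2 :=
  (continuous_sph hg hr).mul (continuous_polJac.comp (continuous_const.prodMk continuous_snd))

theorem continuousOn_sphInt {k : ℝ → ℝ → ℝ → ℝ} {s : Set ℝ}
    (hk : Continuous fun x : s × ℝ × ℝ => k x.1 x.2.1 x.2.2) :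
    ContinuousOn (fun r => sphInt (k r)) s := by
  rw [continuousOn_iff_continuous_domRestrict]
  refine continuous_integral (X := s) (f := fun r φ => ∫ s in (-(Real.pi / 2))..(Real.pi / 2),
    k r φ s) ?_ _ _
  exact continuous_integral (X := s × ℝ) (f := fun p s => k p.1 p.2 s)
    (hk.comp (by fun_prop : Continuous fun x : (s × ℝ) × ℝ => (x.1.1, x.1.2, x.2))) _ _

theorem continuousOn_flux {B : Heis → Heis} {U : Set Heis} (hB : ContinuousOn B U) {s : Set ℝ}
    (hs : ∀ r ∈ s, ∀ φ s, heisSphere r φ s ∈ U) : ContinuousOn (flux B) s := by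
  have c1 : Continuous fun x : s × ℝ × ℝ => (x.1 : ℝ) := by fun_prop
  have c2 : Continuous fun x : s × ℝ × ℝ => x.2.1 := by fun_prop
  have c3 : Continuous fun x : s × ℝ × ℝ => x.2.2 := by fun_prop
  have hP := hB.comp_continuous (c1.heisSphere c2 c3) fun x => hs _ x.1.2 _ _
  exact continuousOn_sphInt (k := fluxDens B) (hP.det3 (c1.sphPhi c2 c3) (c1.sphS c2 c3))

theorem continuousOn_shellInt {g : Heis → ℝ} {U : Set Heis} (hg : ContinuousOn g U) {s : Set ℝ}
    (hs : ∀ r ∈ s, ∀ φ s, heisSphere r φ s ∈ U) : ContinuousOn (shellInt g) s := by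
  have c1 : Continuous fun x : s × ℝ × ℝ => (x.1 : ℝ) := by fun_prop
  have c2 : Continuous fun x : s × ℝ × ℝ => x.2.1 := by fun_prop
  have c3 : Continuous fun x : s × ℝ × ℝ => x.2.2 := by fun_prop
  have hP := hg.comp_continuous (c1.heisSphere c2 c3) fun x => hs _ x.1.2 _ _
  exact continuousOn_sphInt (k := fun r φ s => g (heisSphere r φ s) * polJac r s)
    (hP.mul (continuous_polJac.comp (c1.prodMk c3)))

/-- The filter of parameters `(r, φ, s)` with `r → 0⁺`. -/
def sphFilter : Filter (ℝ × ℝ × ℝ) := comap Prod.fst (𝓝[>] 0)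

/-- The polar parametrization. -/
def sphPt (x : ℝ × ℝ × ℝ) : Heis := heisSphere x.1 x.2.1 x.2.2

theorem eventually_sphFilter {P : ℝ × ℝ × ℝ → Prop} :
    (∀ᶠ x in sphFilter, P x) ↔ ∀ᶠ r in 𝓝[>] (0 : ℝ), ∀ φ s, P (r, φ, s) := by
  rw [sphFilter, eventually_comap]
  refine eventually_congr (Eventually.of_forall fun r => ?_)
  constructor
  · exact fun h φ s => h (r, φ, s) rfl
  · rintro h ⟨r', φ, s⟩ rfl
    exact h φ s

theorem eventually_sphFilter_pos : ∀ᶠ x in sphFilter, 0 < x.1 :=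
  by
  refine eventually_sphFilter.2 ?_
  filter_upwards [self_mem_nhdsWithin] with r hr _ _ using hr

theorem heisNorm_sphPt : ∀ᶠ x in sphFilter, heisNorm (sphPt x) = x.1 :=
  eventually_sphFilter_pos.mono fun _ hx => heisNorm_heisSphere hx.le _ _

theorem tendsto_sphFilter_fst : Tendsto (fun x : ℝ × ℝ × ℝ => x.1) sphFilter (𝓝[>] 0) :=
  tendsto_comap

theorem tendsto_sphPt : Tendsto sphPt sphFilter (𝓝[≠] 0) := by
  refine tendsto_nhdsWithin_iff.2 ⟨?_, ?_⟩
  · intro s hs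
    obtain ⟨δ, hδ, h⟩ := exists_heisNorm_lt_of_mem_nhds hs
    refine eventually_sphFilter.2 ?_
    filter_upwards [Ioo_mem_nhdsGT hδ] with r hr φ s
    exact h _ (by rw [sphPt, heisNorm_heisSphere hr.1.le]; exact hr.2)
  · filter_upwards [eventually_sphFilter_pos] with x hx using heisSphere_ne_zero hx _ _

theorem isBigO_sphPt {F : Type*} [NormedAddCommGroup F] {f : ℝ × ℝ × ℝ → F} {n : ℤ} :
    (f =O[sphFilter] fun x => heisNorm (sphPt x) ^ n) ↔ f =O[sphFilter] fun x => x.1 ^ n :=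
  isBigO_congr EventuallyEq.rfl (heisNorm_sphPt.mono fun x hx => by simp only [hx])

theorem isBigO_comp_sphPt {F : Type*} [NormedAddCommGroup F] {f : Heis → F} {n : ℤ}
    (hf : f =O[𝓝[≠] 0] fun q => heisNorm q ^ n) :
    (fun x => f (sphPt x)) =O[sphFilter] fun x => x.1 ^ n :=
  isBigO_sphPt.1 (hf.comp_tendsto tendsto_sphPt)

theorem isBigO_polJac : (fun x : ℝ × ℝ × ℝ => polJac x.1 x.2.2) =O[sphFilter]
    fun x => x.1 ^ (3 : ℤ) := by
  refine IsBigO.of_bound 2 (eventually_sphFilter_pos.mono fun x hx => ?_)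
  rw [Real.norm_of_nonneg (zpow_nonneg hx.le 3)]
  exact_mod_cast abs_polJac_le hx.le _

theorem isBigO_sphInt {k : ℝ → ℝ → ℝ → ℝ} {n : ℤ}
    (hk : (fun x : ℝ × ℝ × ℝ => k x.1 x.2.1 x.2.2) =O[sphFilter] fun x => x.1 ^ n) :
    (fun r => sphInt (k r)) =O[𝓝[>] 0] fun r => r ^ n := by
  obtain ⟨C, hC⟩ := hk.bound
  refine IsBigO.of_bound (C * (2 * Real.pi ^ 2)) ?_
  filter_upwards [eventually_sphFilter.1 hC] with r hr
  exact (norm_sphInt_le hr).trans_eq (by ring)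

theorem isLittleO_sphInt {k : ℝ → ℝ → ℝ → ℝ} {n : ℤ}
    (hk : (fun x : ℝ × ℝ × ℝ => k x.1 x.2.1 x.2.2) =o[sphFilter] fun x => x.1 ^ n) :
    (fun r => sphInt (k r)) =o[𝓝[>] 0] fun r => r ^ n := by
  refine isLittleO_iff.2 fun c hc => ?_
  have hpi : 0 < 2 * Real.pi ^ 2 := by positivity
  filter_upwards [eventually_sphFilter.1 (isLittleO_iff.1 hk (div_pos hc hpi))] with r hr
  refine (norm_sphInt_le hr).trans_eq ?_
  field_simp

theorem isBigO_shellInt {g : Heis → ℝ} {m n : ℤ} (hg : g =O[𝓝[≠] 0] fun q => heisNorm q ^ m)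
    (hn : n ≤ m + 3) : (shellInt g) =O[𝓝[>] 0] fun r => r ^ n :=
  isBigO_sphInt (k := fun r φ s => g (heisSphere r φ s) * polJac r s)
    ((isBigO_comp_sphPt hg).zpow_mul isBigO_polJac tendsto_sphFilter_fst hn)

section Tangent

theorem isBigO_sphPhi : (fun x : ℝ × ℝ × ℝ => (sphPhi x.1 x.2.1 x.2.2).1) =O[sphFilter]
    (fun x => heisNorm (sphPt x) ^ (1 : ℤ)) := by
  refine isBigO_sphPt.2 (IsBigO.of_bound 1 (eventually_sphFilter_pos.mono fun x hx => ?_))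
  rw [sphPhi, norm_mul, norm_mul, Complex.norm_exp_ofReal_mul_I, Complex.norm_real, norm_I, zpow_one,
    one_mul, one_mul, mul_one, norm_mul]
  exact mul_le_of_le_one_right (norm_nonneg _) (Real.abs_cos_le_one _)

theorem isBigO_sphS : (fun x : ℝ × ℝ × ℝ => (sphS x.1 x.2.1 x.2.2).1) =O[sphFilter]
    (fun x => heisNorm (sphPt x) ^ (1 : ℤ)) := by
  refine isBigO_sphPt.2 (IsBigO.of_bound 1 (eventually_sphFilter_pos.mono fun x hx => ?_))
  rw [sphS, norm_mul, Complex.norm_exp_ofReal_mul_I, Complex.norm_real, zpow_one,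
    one_mul, mul_one, norm_mul, norm_neg]
  exact mul_le_of_le_one_right (norm_nonneg _) (Real.abs_sin_le_one _)

theorem stdForm_sphPhi (r φ s : ℝ) :
    stdForm (heisSphere r φ s) (sphPhi r φ s) = 2 * r ^ 2 * Real.cos s ^ 2 := by
  have h := Real.sin_sq_add_cos_sq φ
  rw [stdForm_apply, heisSphere_eq, sphPhi, exp_mul_I, ← ofReal_cos, ← ofReal_sin]
  simp [-ofReal_cos, -ofReal_sin]
  linear_combination (2 * r ^ 2 * Real.cos s ^ 2) * h

theorem stdForm_sphS (r φ s : ℝ) :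
    stdForm (heisSphere r φ s) (sphS r φ s)
      = r ^ 2 * (2 * Real.cos s ^ 3 / √(1 + Real.cos s ^ 2)) := by
  rw [stdForm_apply, heisSphere_eq, sphS, exp_mul_I, ← ofReal_cos, ← ofReal_sin]
  simp
  ring

theorem isBigO_stdForm_sphPhi :
    (fun x : ℝ × ℝ × ℝ => stdForm (sphPt x) (sphPhi x.1 x.2.1 x.2.2)) =O[sphFilter]
    (fun x => heisNorm (sphPt x) ^ (2 : ℤ)) := by
  refine isBigO_sphPt.2 (IsBigO.of_bound 2 (eventually_sphFilter_pos.mono fun x hx => ?_))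
  rw [sphPt, stdForm_sphPhi, Real.norm_of_nonneg (by positivity),
    Real.norm_of_nonneg (zpow_nonneg hx.le _)]
  have := Real.cos_sq_le_one x.2.2
  norm_cast
  nlinarith [pow_pos hx 2]

theorem isBigO_stdForm_sphS :
    (fun x : ℝ × ℝ × ℝ => stdForm (sphPt x) (sphS x.1 x.2.1 x.2.2)) =O[sphFilter]
    (fun x => heisNorm (sphPt x) ^ (2 : ℤ)) := by
  refine isBigO_sphPt.2 (IsBigO.of_bound 2 (eventually_sphFilter_pos.mono fun x hx => ?_))
  have h1 : 1 ≤ √(1 + Real.cos x.2.2 ^ 2) :=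
    Real.one_le_sqrt.2 (by nlinarith [sq_nonneg (Real.cos x.2.2)])
  have h3 : |Real.cos x.2.2| ^ 3 ≤ 1 := pow_le_one₀ (abs_nonneg _) (Real.abs_cos_le_one _)
  rw [sphPt, stdForm_sphS, norm_mul, norm_div, norm_mul, norm_pow, norm_pow, norm_zpow,
    Real.norm_of_nonneg (Real.sqrt_nonneg _), Real.norm_eq_abs (Real.cos _)]
  have : ‖(2 : ℝ)‖ * |Real.cos x.2.2| ^ 3 / √(1 + Real.cos x.2.2 ^ 2) ≤ 2 := by
    rw [div_le_iff₀ (by positivity)]; simp; linarith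
  calc _ ≤ ‖x.1‖ ^ 2 * 2 := by gcongr
    _ = 2 * ‖x.1‖ ^ (2 : ℤ) := by norm_cast; ring

/-- The two-form `d(arg v) ∧ θ₀` on Heisenberg spheres. -/
theorem argForm_wedge_stdForm {r : ℝ} (hr : 0 < r) (φ s : ℝ) :
    argForm (heisSphere r φ s) (sphPhi r φ s) * stdForm (heisSphere r φ s) (sphS r φ s)
      - argForm (heisSphere r φ s) (sphS r φ s) * stdForm (heisSphere r φ s) (sphPhi r φ s)
      = r ^ 2 * modelDens s := by
  rw [argForm_sphPhi, argForm_sphS hr, stdForm_sphPhi, modelDens]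
  ring

theorem isBigO_argForm_sphS :
    (fun x : ℝ × ℝ × ℝ => argForm (sphPt x) (sphS x.1 x.2.1 x.2.2)) =O[sphFilter]
    (fun x => heisNorm (sphPt x) ^ (0 : ℤ)) := by
  refine isBigO_sphPt.2 (IsBigO.of_bound 2 (eventually_sphFilter_pos.mono fun x hx => ?_))
  have h1 : 1 ≤ √(1 + Real.cos x.2.2 ^ 2) :=
    Real.one_le_sqrt.2 (by nlinarith [sq_nonneg (Real.cos x.2.2)])
  have h3 := Real.abs_cos_le_one x.2.2
  rw [sphPt, argForm_sphS hx, norm_div, norm_mul, Real.norm_of_nonneg (Real.sqrt_nonneg _),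
    div_le_iff₀ (by positivity), Real.norm_eq_abs (Real.cos _)]
  simp; nlinarith

end Tangent

namespace IsNormalCoframe

variable {ϑ : Heis → Heis →L[ℝ] ℝ} {η : Heis → Heis →L[ℝ] ℂ} {U : Set Heis}
  (h : IsNormalCoframe ϑ η U)
include h

theorem isBigO_contact_tangent {u : ℝ × ℝ × ℝ → Heis}
    (hz : (fun x => (u x).1) =O[sphFilter] fun x => heisNorm (sphPt x) ^ (1 : ℤ))
    (hσ : (fun x => stdForm (sphPt x) (u x)) =O[sphFilter] fun x => heisNorm (sphPt x) ^ (2 : ℤ)) :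
    (fun x => ϑ (sphPt x) (u x)) =O[sphFilter] (fun x => x.1 ^ (2 : ℤ)) ∧
    (fun x => ϑ (sphPt x) (u x) - stdForm (sphPt x) (u x)) =O[sphFilter]
      (fun x => x.1 ^ (6 : ℤ)) :=
  ⟨isBigO_sphPt.1 (h.contact_isBigO tendsto_sphPt hz hσ (by norm_num)),
    isBigO_sphPt.1 (h.contact_sub tendsto_sphPt hz hσ (by norm_num) (by norm_num))⟩

/-- `d(arg v) ∧ ϑ` on small spheres. -/
theorem fluxDens_argForm :
    (fun x : ℝ × ℝ × ℝ => fluxDens (fun q => cross (argForm q) (ϑ q)) x.1 x.2.1 x.2.2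
      - x.1 ^ (2 : ℤ) * modelDens x.2.2) =O[sphFilter] fun x => x.1 ^ (6 : ℤ) := by
  obtain ⟨-, a⟩ := h.isBigO_contact_tangent isBigO_sphPhi isBigO_stdForm_sphPhi
  have hα := isBigO_sphPt.1 isBigO_argForm_sphS
  refine ((hα.zpow_mul a tendsto_sphFilter_fst (n := 6) (by norm_num)).const_mul_left (-1)).congr'
    ?_ EventuallyEq.rfl
  filter_upwards [eventually_sphFilter_pos] with x hx
  have e := argForm_wedge_stdForm hx x.2.1 x.2.2
  rw [fluxDens, det3_cross]
  simp only [sphPt] at *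
  rw [argForm_sphPhi] at *
  simp only [zpow_ofNat]
  linear_combination -e

/-- `μ ∧ ϑ` on small spheres, where `i μ` is the connection form. -/
theorem fluxDens_connPot :
    (fun x : ℝ × ℝ × ℝ => fluxDens (fun q => cross (connPot ϑ η q) (ϑ q)) x.1 x.2.1 x.2.2)
      =O[sphFilter] fun x => x.1 ^ (5 : ℤ) := by
  obtain ⟨a, -⟩ := h.isBigO_contact_tangent isBigO_sphPhi isBigO_stdForm_sphPhi
  obtain ⟨b, -⟩ := h.isBigO_contact_tangent isBigO_sphS isBigO_stdForm_sphS
  have a' := isBigO_sphPt.1 (h.connPot_isBigO tendsto_sphPt isBigO_sphPhi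
    (by simpa using isBigO_stdForm_sphPhi))
  have b' := isBigO_sphPt.1 (h.connPot_isBigO tendsto_sphPt isBigO_sphS
    (by simpa using isBigO_stdForm_sphS))
  refine ((a'.zpow_mul b tendsto_sphFilter_fst (by norm_num)).sub
    (b'.zpow_mul a tendsto_sphFilter_fst (by norm_num))).congr_left fun x => ?_
  rw [fluxDens, det3_cross]; rfl

/-- The flux density of the horizontal gradient of `N = |z|⁴ + t²` on small spheres. -/
theorem fluxDens_gradField_heisN :
    (fun x : ℝ × ℝ × ℝ => fluxDens (gradField ϑ η heisN) x.1 x.2.1 x.2.2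
      - -2 * x.1 ^ (6 : ℤ) * modelDens x.2.2) =O[sphFilter] fun x => x.1 ^ (10 : ℤ) := by
  have hρ := tendsto_sphFilter_fst
  obtain ⟨a, a'⟩ := h.isBigO_contact_tangent isBigO_sphPhi isBigO_stdForm_sphPhi
  obtain ⟨b, b'⟩ := h.isBigO_contact_tangent isBigO_sphS isBigO_stdForm_sphS
  have p := isBigO_sphPt.1 (h.rotGrad_heisN_sub tendsto_sphPt isBigO_sphPhi isBigO_stdForm_sphPhi)
  have s := isBigO_sphPt.1 (h.rotGrad_heisN_sub tendsto_sphPt isBigO_sphS isBigO_stdForm_sphS)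
  have sP := isBigO_sphPt.1 isBigO_stdForm_sphPhi
  have sS := isBigO_sphPt.1 isBigO_stdForm_sphS
  have z2 : (fun x => ‖(sphPt x).1‖ ^ 2) =O[sphFilter] fun x => x.1 ^ (2 : ℤ) :=
    isBigO_sphPt.1 (isBigO_norm_fst_sq (q := sphPt))
  have N4 : (fun x => heisN (sphPt x)) =O[sphFilter] fun x => x.1 ^ (4 : ℤ) := by
    refine IsBigO.of_bound 1 (Eventually.of_forall fun x => ?_)
    rw [sphPt, heisN_heisSphere, one_mul]; norm_cast
  have α := isBigO_sphPt.1 isBigO_argForm_sphS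
  have lP := (((z2.zpow_mul sP hρ (n := 4) (by norm_num)).const_mul_left (-2)).zpow_mul b' hρ
    (n := 10) (by norm_num))
  have lS := ((((z2.zpow_mul sS hρ (n := 4) (by norm_num)).const_mul_left (-2)).sub
    ((N4.zpow_mul α hρ (n := 4) (by norm_num)).const_mul_left 2)).zpow_mul a' hρ
    (n := 10) (by norm_num))
  refine (((p.zpow_mul b hρ (n := 10) (by norm_num)).sub
    (s.zpow_mul a hρ (n := 10) (by norm_num))).add (lP.sub lS)).congr' ?_ EventuallyEq.rfl
  filter_upwards [eventually_sphFilter_pos] with x hx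
  have e := argForm_wedge_stdForm hx x.2.1 x.2.2
  rw [fluxDens, gradField, det3_cross]
  have hN : heisN (sphPt x) = x.1 ^ 4 := heisN_heisSphere _ _ _
  rw [hN]
  simp only [sphPt] at *
  rw [argForm_sphPhi] at *
  simp only [zpow_ofNat]
  linear_combination (2 * x.1 ^ 4) * e

end IsNormalCoframe

/-! ### Green's identity with the singular model `ρ⁻²` -/

/-- The singular model `ρ⁻²`. -/
def poleFun (q : Heis) : ℝ := heisNorm q ^ (-2 : ℤ)

theorem zpow_heisNorm (q : Heis) (n : ℤ) : heisNorm q ^ n = heisN q ^ ((1 / 4) * n : ℝ) := by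
  rw [Real.rpow_mul (heisN_nonneg q), Real.rpow_intCast]; rfl

theorem poleFun_eq (q : Heis) : poleFun q = heisN q ^ (-(1 / 2) : ℝ) := by
  exact (zpow_heisNorm q (-2)).trans (by norm_num)

theorem hasFDerivAt_poleFun {q : Heis} (hq : q ≠ 0) :
    HasFDerivAt poleFun ((-(1 / 2) * heisNorm q ^ (-6 : ℤ)) • fderiv ℝ heisN q) q := by
  have hN : HasFDerivAt heisN (fderiv ℝ heisN q) q :=
    (contDiff_heisN.differentiable (by simp) q).hasFDerivAt
  have h := (Real.hasDerivAt_rpow_const (p := -(1 / 2)) (Or.inl (heisN_pos hq).ne')).comp_hasFDerivAt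
    q hN
  rw [show poleFun = fun q => heisN q ^ (-(1 / 2) : ℝ) from funext poleFun_eq]
  have e : heisNorm q ^ (-6 : ℤ) = heisN q ^ (-(1 / 2) - 1 : ℝ) := by
    rw [zpow_heisNorm]; norm_num
  rw [e]
  exact h

theorem contDiffOn_poleFun {s : Set Heis} (hs : 0 ∉ s) : ContDiffOn ℝ ∞ poleFun s := by
  rw [show poleFun = fun q => heisN q ^ (-(1 / 2) : ℝ) from funext poleFun_eq]
  exact contDiff_heisN.contDiffOn.rpow_const_of_ne fun q hq =>
    (heisN_pos fun h => hs (h ▸ hq)).ne'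

theorem poleFun_heisSphere {r : ℝ} (hr : 0 ≤ r) (φ s : ℝ) :
    poleFun (heisSphere r φ s) = r ^ (-2 : ℤ) := by
  rw [poleFun, heisNorm_heisSphere hr]

theorem fderiv_poleFun_sph {r : ℝ} (hr : 0 < r) (φ s : ℝ) :
    fderiv ℝ poleFun (heisSphere r φ s) (sphR r φ s) = -2 * r ^ (-3 : ℤ) ∧
    fderiv ℝ poleFun (heisSphere r φ s) (sphPhi r φ s) = 0 ∧
    fderiv ℝ poleFun (heisSphere r φ s) (sphS r φ s) = 0 := by
  have hd := (hasFDerivAt_poleFun (heisSphere_ne_zero hr φ s)).differentiableAt.hasFDerivAt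
  refine ⟨?_, ?_, ?_⟩
  · have h1 := hd.comp_hasDerivAt r (hasDerivAt_heisSphere_r r φ s)
    have h2 : HasDerivAt (fun x : ℝ => x ^ (-2 : ℤ)) (((-2 : ℤ) : ℝ) * r ^ (-2 - 1 : ℤ)) r :=
      hasDerivAt_zpow _ _ (Or.inl hr.ne')
    have h3 : (fun x => poleFun (heisSphere x φ s)) =ᶠ[𝓝 r] fun x => x ^ (-2 : ℤ) :=
      (lt_mem_nhds hr).mono fun x hx => poleFun_heisSphere hx.le _ _
    have := h1.unique (h2.congr_of_eventuallyEq h3)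
    rw [this]; norm_num
  · have h1 := hd.comp_hasDerivAt φ (hasDerivAt_heisSphere_phi r φ s)
    refine h1.unique ((hasDerivAt_const φ (r ^ (-2 : ℤ))).congr_of_eventuallyEq ?_)
    exact Eventually.of_forall fun x => poleFun_heisSphere hr.le _ _
  · have h1 := hd.comp_hasDerivAt s (hasDerivAt_heisSphere_s r φ s)
    refine h1.unique ((hasDerivAt_const s (r ^ (-2 : ℤ))).congr_of_eventuallyEq ?_)
    exact Eventually.of_forall fun x => poleFun_heisSphere hr.le _ _

theorem det3_smul (k : ℝ) (a b c : Heis) : det3 (k • a) b c = k * det3 a b c := by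
  simp [det3]; ring

theorem det3_sub (a a' b c : Heis) : det3 (a - a') b c = det3 a b c - det3 a' b c := by
  simp [det3]; ring

theorem gradField_sub {ϑ : Heis → Heis →L[ℝ] ℝ} {η : Heis → Heis →L[ℝ] ℂ} {f g k : Heis → ℝ}
    {q : Heis} (hf : fderiv ℝ f q = fderiv ℝ g q - fderiv ℝ k q) :
    gradField ϑ η f q = gradField ϑ η g q - gradField ϑ η k q := by
  have : rotGrad ϑ η f q = rotGrad ϑ η g q - rotGrad ϑ η k q := by
    simp only [rotGrad, hf, sub_apply]; module
  rw [gradField, gradField, gradField, this, ← crossL_apply, map_sub]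
  simp only [crossL_apply, sub_apply]

/-- Since `ρ⁻²` is constant on Heisenberg spheres, its derivative along `B` is determined by the flux
density of `B`. -/
theorem fderiv_cramer_poleFun {r : ℝ} (hr : 0 < r) (φ s : ℝ) (B : Heis) :
    fderiv ℝ poleFun (heisSphere r φ s) B * polJac r s
      = -2 * r ^ (-3 : ℤ) * det3 B (sphPhi r φ s) (sphS r φ s) := by
  obtain ⟨h1, h2, h3⟩ := fderiv_poleFun_sph hr φ s
  rw [← det3_sph r φ s, det3_cramer, h1, h2, h3]; ring

theorem isBigO_modelDens :
    (fun x : ℝ × ℝ × ℝ => modelDens x.2.2) =O[sphFilter] fun x => x.1 ^ (0 : ℤ) := by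
  refine IsBigO.of_bound 4 (Eventually.of_forall fun x => ?_)
  have h1 : 1 ≤ √(1 + Real.cos x.2.2 ^ 2) :=
    Real.one_le_sqrt.2 (by nlinarith [sq_nonneg (Real.cos x.2.2)])
  have h3 : |Real.cos x.2.2| ^ 3 ≤ 1 := pow_le_one₀ (abs_nonneg _) (Real.abs_cos_le_one _)
  rw [modelDens, norm_div, norm_mul, norm_pow, Real.norm_of_nonneg (Real.sqrt_nonneg _),
    div_le_iff₀ (by positivity), Real.norm_eq_abs (Real.cos _)]
  simp; linarith

namespace IsNormalCoframe

variable {ϑ : Heis → Heis →L[ℝ] ℝ} {η : Heis → Heis →L[ℝ] ℂ} {U : Set Heis}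
  (h : IsNormalCoframe ϑ η U)
include h

theorem punctured : IsCoframe ϑ η (U \ {0}) :=
  h.toIsCoframe.mono (h.isOpen.sdiff isClosed_singleton) sdiff_subset

omit h in
theorem gradField_poleFun {q : Heis} (hq : q ≠ 0) : gradField ϑ η poleFun q
    = (-(1 / 2) * heisNorm q ^ (-6 : ℤ)) • gradField ϑ η heisN q :=
  IsCoframe.gradField_smul_const (hasFDerivAt_poleFun hq).fderiv

/-- The flux density of the gradient of `ρ⁻²` on small spheres. -/
theorem fluxDens_gradField_poleFun :
    (fun x : ℝ × ℝ × ℝ => fluxDens (gradField ϑ η poleFun) x.1 x.2.1 x.2.2 - modelDens x.2.2)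
      =O[sphFilter] fun x => x.1 ^ (4 : ℤ) := by
  have h6 : (fun x : ℝ × ℝ × ℝ => -(1 / 2) * x.1 ^ (-6 : ℤ)) =O[sphFilter] fun x => x.1 ^ (-6 : ℤ) :=
    (isBigO_refl _ _).const_mul_left _
  refine (h6.zpow_mul h.fluxDens_gradField_heisN tendsto_sphFilter_fst (n := 4)
    (by norm_num)).congr' ?_ EventuallyEq.rfl
  filter_upwards [eventually_sphFilter_pos] with x hx
  rw [fluxDens, fluxDens, gradField_poleFun (heisSphere_ne_zero hx _ _), det3_smul,
    heisNorm_heisSphere hx.le]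
  have : x.1 ^ (-6 : ℤ) * x.1 ^ (6 : ℤ) = 1 := by
    rw [← zpow_add₀ hx.ne']; simp
  linear_combination -modelDens x.2.2 * this

/-- On the Heisenberg group `ρ⁻²` is harmonic off the pole. Here the two terms of order `-4` in the
sublaplacian need not cancel, as this bound suffices. -/
theorem divg_gradField_poleFun :
    (fun q => divg (gradField ϑ η poleFun) q) =O[𝓝[≠] 0] fun q => heisNorm q ^ (-4 : ℤ) := by
  have hρ := tendsto_heisNorm
  have hid : Tendsto (fun q : Heis => q) (𝓝[≠] 0) (𝓝[≠] 0) := tendsto_id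
  have hX := h.derivN h.continuousOn_X (fun q hq => h.ϑ_X hq) fun q hq => h.η_X hq
  have hY := h.derivN h.continuousOn_Y (fun q hq => h.ϑ_Y hq) fun q hq => h.η_Y hq
  have hc0 := h.isBigO_zero_of_continuousOn
    (h.contDiffOn_contactDensity.div_const 2).neg.continuousOn hid
  have p : ∀ n : ℤ, (fun q => heisNorm q ^ n) =O[𝓝[≠] 0] fun q => heisNorm q ^ n :=
    fun n => isBigO_refl _ _
  have t1 := ((p (-6)).const_mul_left (-(1 / 2))).zpow_mul h.divg_gradField_heisN hρ
    (n := -4) (by norm_num)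
  have t2 := ((p (-10)).const_mul_left (3 / 4)).zpow_mul (hc0.zpow_mul
    ((hX.zpow_mul hX hρ (n := 6) (by norm_num)).add
      (hY.zpow_mul hY hρ (n := 6) (by norm_num))) hρ (n := 6) (by norm_num)) hρ
    (n := -4) (by norm_num)
  refine (t2.add t1).congr' ?_ EventuallyEq.rfl
  filter_upwards [h.eventually_mem hid, self_mem_nhdsWithin] with q hq hq0
  have hn := h.isOpen.mem_nhds hq
  have hpos : 0 < heisNorm q := heisNorm_pos hq0
  have e6 : ∀ x : Heis, heisNorm x ^ (-6 : ℤ) = poleFun x ^ 3 := fun x => by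
    rw [poleFun, ← zpow_natCast, ← zpow_mul]; norm_num
  have e : gradField ϑ η poleFun =ᶠ[𝓝 q] fun x =>
      (-(1 / 2) * poleFun x ^ 3) • gradField ϑ η heisN x := by
    filter_upwards [ne_zero_mem_nhds hq0] with x hx
    rw [gradField_poleFun hx, e6]
  have dN := ((h.contDiffOn_gradField contDiff_heisN.contDiffOn).contDiffAt hn).differentiableAt
    (by simp)
  have dk := ((hasFDerivAt_poleFun hq0).pow 3).const_mul (-(1 / 2))
  rw [divg_congr e, divg_smul dk.differentiableAt dN, ← e6]
  congr 1
  have : fderiv ℝ (fun x => -(1 / 2) * poleFun x ^ 3) q = _ := dk.fderiv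
  have e10 : heisNorm q ^ (-10 : ℤ) = poleFun q ^ 2 * heisNorm q ^ (-6 : ℤ) := by
    rw [poleFun, ← zpow_natCast, ← zpow_mul, ← zpow_add₀ hpos.ne']; norm_num
  rw [this]
  simp only [smul_apply, smul_eq_mul, nsmul_eq_mul]
  rw [h.fderiv_gradField hq, e10]
  simp
  ring

theorem contDiffOn_gradField_poleFun : ContDiffOn ℝ ∞ (gradField ϑ η poleFun) (U \ {0}) :=
  h.punctured.contDiffOn_gradField (contDiffOn_poleFun (by simp))

section Green

variable {r₁ r₂ : ℝ} (h0 : 0 < r₁) (h12 : r₁ ≤ r₂) (hs : ∀ q, heisNorm q ≤ r₂ → q ∈ U)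

omit h in
theorem mem_punctured {r : ℝ} (h0 : 0 < r) (hr : r ≤ r₂) (hs : ∀ q, heisNorm q ≤ r₂ → q ∈ U)
    (φ s : ℝ) : heisSphere r φ s ∈ U \ {0} :=
  ⟨hs _ (by rwa [heisNorm_heisSphere h0.le]), heisSphere_ne_zero h0 _ _⟩

include h0 h12 hs

theorem flux_sub_flux_punctured {B : Heis → Heis} (hB : ContDiffOn ℝ ∞ B (U \ {0})) :
    flux B r₂ - flux B r₁ = ∫ r in r₁..r₂, shellInt (divg B) r :=
  flux_sub_flux h.punctured.isOpen (hB.of_le (by simp)) h0.le h12 fun q hq =>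
    ⟨hs q hq.2, ne_zero_of_heisNorm_pos (h0.trans_le hq.1)⟩

/-- Green's identity for `f` and `ρ⁻²` on the region between two Heisenberg spheres. -/
theorem green {f : Heis → ℝ} (hf : ContDiffOn ℝ ∞ f (U \ {0})) :
    ∫ r in r₁..r₂, r ^ (-3 : ℤ) * flux (gradField ϑ η f) r =
      ((∫ r in r₁..r₂, shellInt (fun q => f q * divg (gradField ϑ η poleFun) q) r)
        - (flux (fun q => f q • gradField ϑ η poleFun q) r₂
          - flux (fun q => f q • gradField ϑ η poleFun q) r₁)) / 2 := by
  have hP := h.punctured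
  have hB := h.contDiffOn_gradField_poleFun
  have hdiv := (hP.continuousOn_divg hB)
  have hmem : ∀ r ∈ Icc r₁ r₂, ∀ φ s, heisSphere r φ s ∈ U \ {0} := fun r hr φ s =>
    mem_punctured (h0.trans_le hr.1) hr.2 hs φ s
  rw [h.flux_sub_flux_punctured h0 h12 hs
    (B := fun q => f q • gradField ϑ η poleFun q) (hf.smul hB)]
  have key : ∀ r ∈ uIcc r₁ r₂, shellInt (divg fun q => f q • gradField ϑ η poleFun q) r
      = shellInt (fun q => f q * divg (gradField ϑ η poleFun) q) r
        - 2 * (r ^ (-3 : ℤ) * flux (gradField ϑ η f) r) := by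
    intro r hr
    rw [uIcc_of_le h12] at hr
    have hr0 : 0 < r := h0.trans_le hr.1
    rw [shellInt_eq, shellInt_eq, flux_eq, ← mul_assoc, ← sphInt_const_mul, ← sphInt_sub
      (continuous_shellDens (hf.continuousOn.mul hdiv) (hmem r hr))
      ((continuous_fluxDens (hP.contDiffOn_gradField hf).continuousOn (hmem r hr)).const_mul _)]
    congr 1
    funext φ s
    have hq := hmem r hr φ s
    have hn := hP.isOpen.mem_nhds hq
    rw [divg_smul ((hf.contDiffAt hn).differentiableAt (by simp))
      ((hB.contDiffAt hn).differentiableAt (by simp)), hP.fderiv_gradField_symm hq, add_mul,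
      fderiv_cramer_poleFun hr0, fluxDens]
    ring
  rw [intervalIntegral.integral_congr key, intervalIntegral.integral_sub,
    intervalIntegral.integral_const_mul]
  · ring
  · exact (continuousOn_shellInt (hf.continuousOn.mul hdiv)
      (by rwa [uIcc_of_le h12])).intervalIntegrable
  · refine ContinuousOn.intervalIntegrable ?_
    rw [uIcc_of_le h12]
    refine continuousOn_const.mul (ContinuousOn.mul ?_
      (continuousOn_flux (hP.contDiffOn_gradField hf).continuousOn hmem))
    exact continuousOn_id.zpow₀ _ fun r hr => Or.inl (h0.trans_le hr.1).ne'

end Green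

/-- The weighted mean flux over `[ε, 2 ε]` of the gradient of a function vanishing to order
`m + 1`. -/
theorem green_bound {f : Heis → ℝ} (hf : ContDiffOn ℝ ∞ f (U \ {0})) {m : ℕ}
    (hO : f =O[𝓝[≠] 0] fun q => heisNorm q ^ ((m : ℤ) + 1)) :
    ∃ C ≥ 0, ∀ᶠ ε in 𝓝[>] (0 : ℝ),
      |∫ r in ε..(2 * ε), r ^ (-3 : ℤ) * flux (gradField ϑ η f) r| ≤ C * ε ^ (m + 1) := by
  have hρ := tendsto_sphFilter_fst
  have hd := isBigO_modelDens
  have hB : (fun x : ℝ × ℝ × ℝ => fluxDens (gradField ϑ η poleFun) x.1 x.2.1 x.2.2)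
      =O[sphFilter] fun x => x.1 ^ (0 : ℤ) := by
    simpa using (h.fluxDens_gradField_poleFun.zpow_mono hρ (n := 0) (by norm_num)).add hd
  have h1 : flux (fun q => f q • gradField ϑ η poleFun q) =O[𝓝[>] 0] fun r => r ^ ((m : ℤ) + 1) := by
    refine isBigO_sphInt (k := fluxDens (fun q => f q • gradField ϑ η poleFun q))
      (((isBigO_comp_sphPt hO).zpow_mul hB hρ (n := (m : ℤ) + 1) (by linarith)).congr_left fun x => ?_)
    rw [fluxDens, fluxDens, det3_smul]; rfl
  have h2 : shellInt (fun q => f q * divg (gradField ϑ η poleFun) q) =O[𝓝[>] 0]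
      fun r => r ^ (m : ℤ) :=
    isBigO_shellInt (hO.zpow_mul h.divg_gradField_poleFun tendsto_heisNorm
      (n := (m : ℤ) - 3) (by linarith)) (by linarith)
  obtain ⟨C₁, hC₁, b₁⟩ := h1.exists_nonneg
  obtain ⟨C₂, hC₂, b₂⟩ := h2.exists_nonneg
  obtain ⟨δ, hδ, hU⟩ := exists_heisNorm_lt_of_mem_nhds h.mem_nhds
  obtain ⟨δ', hδ', hb⟩ := mem_nhdsGT_iff_exists_Ioo_subset.1 (b₁.bound.and b₂.bound)
  refine ⟨C₁ * 2 ^ (m + 1) + C₁ + C₂ * 2 ^ m, by positivity, ?_⟩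
  have hmin : 0 < min δ δ' / 2 := by have := lt_min hδ (mem_Ioi.1 hδ'); linarith
  filter_upwards [Ioo_mem_nhdsGT hmin] with ε hε
  obtain ⟨e0, e1⟩ := hε
  have l1 : 2 * ε < δ := by have := min_le_left δ δ'; linarith
  have l2 : 2 * ε < δ' := by have := min_le_right δ δ'; linarith
  rw [h.green e0 (by linarith) (fun q hq => hU q (hq.trans_lt l1)) hf]
  have c1 : |flux (fun q => f q • gradField ϑ η poleFun q) (2 * ε)| ≤ C₁ * (2 * ε) ^ (m + 1) := by
    have := (hb ⟨by linarith, l2⟩ : _ ∧ _).1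
    rw [Real.norm_of_nonneg (zpow_nonneg (by linarith : 0 ≤ 2 * ε) _)] at this
    exact_mod_cast this
  have c2 : |flux (fun q => f q • gradField ϑ η poleFun q) ε| ≤ C₁ * ε ^ (m + 1) := by
    have := (hb ⟨e0, by linarith⟩ : _ ∧ _).1
    rw [Real.norm_of_nonneg (zpow_nonneg e0.le _)] at this
    exact_mod_cast this
  have c3 : |∫ r in ε..(2 * ε), shellInt (fun q => f q * divg (gradField ϑ η poleFun) q) r|
      ≤ C₂ * (2 * ε) ^ m * |2 * ε - ε| := by
    rw [← Real.norm_eq_abs]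
    refine intervalIntegral.norm_integral_le_of_norm_le_const fun r hr => ?_
    rw [uIoc_of_le (by linarith)] at hr
    have := (hb (show r ∈ Ioo 0 δ' from ⟨by linarith [hr.1], by linarith [hr.2]⟩) : _ ∧ _).2
    rw [Real.norm_of_nonneg (zpow_nonneg (by linarith [hr.1]) _), zpow_natCast] at this
    refine this.trans ?_
    have := hr.2
    have : 0 ≤ r := by linarith [hr.1]
    gcongr
  rw [show 2 * ε - ε = ε by ring, abs_of_pos e0] at c3
  rw [abs_div, abs_two, div_le_iff₀ two_pos]
  have t1 := abs_sub (∫ r in ε..(2 * ε), shellInt (fun q => f q * divg (gradField ϑ η poleFun) q) r)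
    (flux (fun q => f q • gradField ϑ η poleFun q) (2 * ε)
      - flux (fun q => f q • gradField ϑ η poleFun q) ε)
  have t2 := abs_sub (flux (fun q => f q • gradField ϑ η poleFun q) (2 * ε))
    (flux (fun q => f q • gradField ϑ η poleFun q) ε)
  have e1 : (2 * ε) ^ (m + 1) = 2 ^ (m + 1) * ε ^ (m + 1) := mul_pow _ _ _
  have e2 : C₂ * (2 * ε) ^ m * ε = C₂ * 2 ^ m * ε ^ (m + 1) := by rw [mul_pow, pow_succ]; ring
  rw [e1] at c1
  rw [e2] at c3
  have p1 : 0 ≤ C₁ * 2 ^ (m + 1) * ε ^ (m + 1) := by positivity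
  have p2 : 0 ≤ C₁ * ε ^ (m + 1) := by positivity
  have p3 : 0 ≤ C₂ * 2 ^ m * ε ^ (m + 1) := by positivity
  linarith

end IsNormalCoframe

/-- A lower bound for a function on `[ε, 2 ε]` from an upper bound for its mean. The constant is
`(2 ε)³ / ε`, because the weight is at least `(2 ε)⁻³`. -/
theorem le_of_integral_zpow_le {g : ℝ → ℝ} {ε m K : ℝ} (hε : 0 < ε) (hK : 0 ≤ K)
    (hg : ContinuousOn g (Icc ε (2 * ε))) (hm : ∀ r ∈ Icc ε (2 * ε), m ≤ g r)
    (hi : ∫ r in ε..(2 * ε), r ^ (-3 : ℤ) * g r ≤ K) : m ≤ 8 * ε ^ 2 * K := by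
  rcases le_or_gt m 0 with h | h
  · exact h.trans (by positivity)
  have h2 : ε ≤ 2 * ε := by linarith
  have hc : ContinuousOn (fun r => r ^ (-3 : ℤ) * g r) (uIcc ε (2 * ε)) := by
    rw [uIcc_of_le h2]
    exact (continuousOn_id.zpow₀ _ fun r hr => Or.inl (hε.trans_le hr.1).ne').mul hg
  have := intervalIntegral.integral_mono_on (f := fun _ => ((2 * ε) ^ 3)⁻¹ * m) (μ := volume) h2
    intervalIntegrable_const hc.intervalIntegrable (fun r hr => by
      have hr0 : 0 < r := hε.trans_le hr.1
      have h3 : ((2 * ε) ^ 3)⁻¹ ≤ r ^ (-3 : ℤ) := by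
        rw [zpow_neg, zpow_ofNat]
        have := hr.2
        gcongr
      exact mul_le_mul h3 (hm r hr) h.le (by positivity))
  rw [intervalIntegral.integral_const, smul_eq_mul] at this
  have e : (2 * ε - ε) * (((2 * ε) ^ 3)⁻¹ * m) = m / (8 * ε ^ 2) := by
    field_simp; ring
  rw [e] at this
  have := this.trans hi
  rw [div_le_iff₀ (by positivity)] at this
  linarith

/-! ### The limit of the flux -/

/-- The function `u` has the expansion `ρ⁻² + a + O(ρ)` at the origin, and its sublaplacian is
`o(ρ⁻²)`. -/
structure HasPoleExpansion (ϑ : Heis → Heis →L[ℝ] ℝ) (η : Heis → Heis →L[ℝ] ℂ) (U : Set Heis)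
    (u : Heis → ℝ) (a : ℝ) : Prop where
  smooth : ContDiffOn ℝ ∞ u (U \ {0})
  expansion : (fun q => u q - poleFun q - a) =O[𝓝[≠] 0] fun q => heisNorm q ^ (1 : ℤ)
  divg_gradField : (fun q => divg (gradField ϑ η u) q) =o[𝓝[≠] 0] fun q => heisNorm q ^ (-2 : ℤ)

/-- The flux of the gradient of `ρ⁻²` through small spheres. -/
theorem IsNormalCoframe.flux_gradField_poleFun {ϑ : Heis → Heis →L[ℝ] ℝ}
    {η : Heis → Heis →L[ℝ] ℂ} {U : Set Heis} (h : IsNormalCoframe ϑ η U) :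
    (fun r => flux (gradField ϑ η poleFun) r - 8 * Real.pi) =O[𝓝[>] 0] fun r => r ^ (4 : ℤ) := by
  refine (isBigO_sphInt (k := fun r φ s => fluxDens (gradField ϑ η poleFun) r φ s - modelDens s)
    h.fluxDens_gradField_poleFun).congr' ?_ EventuallyEq.rfl
  obtain ⟨δ, hδ, hU⟩ := exists_heisNorm_lt_of_mem_nhds h.mem_nhds
  filter_upwards [Ioo_mem_nhdsGT hδ] with r hr
  rw [flux_eq, ← sphInt_modelDens, sphInt_sub]
  · exact continuous_fluxDens h.contDiffOn_gradField_poleFun.continuousOn fun φ s =>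
      IsNormalCoframe.mem_punctured hr.1 le_rfl (fun q hq => hU q (hq.trans_lt hr.2)) φ s
  · exact continuous_modelDens.comp continuous_snd

/-- The flux density of the connection form of the blow-up. (At zeros of `u` both sides vanish,
because `3 / 0 = 0`.) -/
theorem fluxDens_blowup (ϑ : Heis → Heis →L[ℝ] ℝ) (η : Heis → Heis →L[ℝ] ℂ) (u : Heis → ℝ)
    (r φ s : ℝ) :
    fluxDens (fun q => cross (connPot ϑ η q - (3 / u q) • rotGrad ϑ η u q
        + (3 : ℝ) • argForm q) (scaledForm u ϑ q)) r φ s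
      = u (sphPt (r, φ, s)) ^ 2 * fluxDens (fun q => cross (connPot ϑ η q) (ϑ q)) r φ s
        - 3 * u (sphPt (r, φ, s)) * fluxDens (gradField ϑ η u) r φ s
        + 3 * u (sphPt (r, φ, s)) ^ 2 * fluxDens (fun q => cross (argForm q) (ϑ q)) r φ s := by
  simp only [fluxDens, gradField, det3_cross, scaledForm, add_apply, sub_apply, smul_apply,
    smul_eq_mul, sphPt]
  have : 3 / u (heisSphere r φ s) * u (heisSphere r φ s) ^ 2 = 3 * u (heisSphere r φ s) := by
    by_cases h0 : u (heisSphere r φ s) = 0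
    · simp [h0]
    · field_simp
  linear_combination
    (-(rotGrad ϑ η u (heisSphere r φ s) (sphPhi r φ s) * ϑ (heisSphere r φ s) (sphS r φ s))
      + rotGrad ϑ η u (heisSphere r φ s) (sphS r φ s)
        * ϑ (heisSphere r φ s) (sphPhi r φ s)) * this

theorem continuousOn_argForm {s : Set Heis} (hs : 0 ∉ s) : ContinuousOn argForm s := by
  have h1 : ContinuousOn (fun q => (heisV q)⁻¹) s :=
    contDiff_heisV.continuous.continuousOn.inv₀ fun q hq => heisV_ne_zero fun h => hs (h ▸ hq)
  have h2 : Continuous (fderiv ℝ heisV) := contDiff_heisV.continuous_fderiv (by simp)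
  exact continuousOn_const.clm_comp (h1.smul h2.continuousOn)

namespace HasPoleExpansion

variable {ϑ : Heis → Heis →L[ℝ] ℝ} {η : Heis → Heis →L[ℝ] ℂ} {U : Set Heis}
  (h : IsNormalCoframe ϑ η U) {u : Heis → ℝ} {a : ℝ} (hu : HasPoleExpansion ϑ η U u a)
include h hu

omit h in
theorem smooth_rem : ContDiffOn ℝ ∞ (fun q => u q - poleFun q - a) (U \ {0}) :=
  (hu.smooth.sub (contDiffOn_poleFun (by simp))).sub contDiffOn_const

theorem fderiv_rem {q : Heis} (hq : q ∈ U \ {0}) :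
    fderiv ℝ (fun q => u q - poleFun q - a) q = fderiv ℝ u q - fderiv ℝ poleFun q := by
  have hn := h.punctured.isOpen.mem_nhds hq
  have h1 := (hu.smooth.contDiffAt hn).differentiableAt (by simp)
  have h2 := ((contDiffOn_poleFun (by simp)).contDiffAt hn).differentiableAt (by simp)
  exact ((h1.hasFDerivAt.sub h2.hasFDerivAt).sub_const a).fderiv

theorem gradField_rem {q : Heis} (hq : q ∈ U \ {0}) :
    gradField ϑ η (fun q => u q - poleFun q - a) q
      = gradField ϑ η u q - gradField ϑ η poleFun q :=
  gradField_sub (fderiv_rem h hu hq)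

theorem contDiffOn_gradField_rem :
    ContDiffOn ℝ ∞ (gradField ϑ η fun q => u q - poleFun q - a) (U \ {0}) :=
  h.punctured.contDiffOn_gradField hu.smooth_rem

omit hu in
theorem exists_radius : ∃ δ > 0, ∀ q, heisNorm q < δ → q ∈ U :=
  exists_heisNorm_lt_of_mem_nhds h.mem_nhds

/-- The flux of the gradient of the regular part is nearly constant. -/
theorem flux_rem_sub {ε : ℝ} (hε : 0 < ε) : ∃ δ > 0, ∀ r₁ r₂, 0 < r₁ → r₁ ≤ r₂ → r₂ < δ →
    |flux (gradField ϑ η fun q => u q - poleFun q - a) r₂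
      - flux (gradField ϑ η fun q => u q - poleFun q - a) r₁| ≤ ε * r₂ ^ 2 := by
  obtain ⟨δ, hδ, hU⟩ := exists_radius h
  have h1 : shellInt (divg (gradField ϑ η u)) =o[𝓝[>] 0] fun r => r ^ (1 : ℤ) := by
    refine isLittleO_sphInt (k := fun r φ s => divg (gradField ϑ η u) (heisSphere r φ s) * polJac r s)
      ?_
    have t := (hu.divg_gradField.comp_tendsto tendsto_sphPt).mul_isBigO isBigO_polJac
    refine t.congr' EventuallyEq.rfl ?_
    filter_upwards [heisNorm_sphPt, eventually_sphFilter_pos] with x hx hx0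
    rw [Function.comp_apply, hx, ← zpow_add₀ hx0.ne']; norm_num
  have h2 : (fun r => flux (gradField ϑ η poleFun) r - 8 * Real.pi) =o[𝓝[>] 0]
      fun r => r ^ (2 : ℤ) := by
    refine h.flux_gradField_poleFun.trans_isLittleO ?_
    have : (fun r : ℝ => r ^ 4) =o[𝓝[>] 0] fun r => r ^ 2 :=
      (isLittleO_pow_pow (by norm_num : 2 < 4)).mono nhdsWithin_le_nhds
    exact_mod_cast this
  obtain ⟨δ₁, hδ₁, b₁⟩ := mem_nhdsGT_iff_exists_Ioo_subset.1
    ((isLittleO_iff.1 h1 (by positivity : 0 < ε / 3)).and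
      (isLittleO_iff.1 h2 (by positivity : 0 < ε / 3)))
  refine ⟨min δ δ₁, lt_min hδ hδ₁, fun r₁ r₂ h0 h12 hr => ?_⟩
  have l1 : r₂ < δ := hr.trans_le (min_le_left _ _)
  have l2 : r₂ < δ₁ := hr.trans_le (min_le_right _ _)
  have hmem : ∀ r, 0 < r → r ≤ r₂ → ∀ φ s, heisSphere r φ s ∈ U \ {0} := fun r hr0 hr2 φ s =>
    IsNormalCoframe.mem_punctured hr0 hr2 (fun q hq => hU q (hq.trans_lt l1)) φ s
  have hBu := h.punctured.contDiffOn_gradField hu.smooth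
  have split : ∀ r, 0 < r → r ≤ r₂ → flux (gradField ϑ η fun q => u q - poleFun q - a) r
      = flux (gradField ϑ η u) r - flux (gradField ϑ η poleFun) r := by
    intro r hr0 hr2
    rw [flux_eq, flux_eq, flux_eq, ← sphInt_sub (continuous_fluxDens hBu.continuousOn
      (hmem r hr0 hr2)) (continuous_fluxDens h.contDiffOn_gradField_poleFun.continuousOn
      (hmem r hr0 hr2))]
    congr 1
    funext φ s
    rw [fluxDens, gradField_rem h hu (hmem r hr0 hr2 φ s), det3_sub]; rfl
  rw [split r₂ (h0.trans_le h12) le_rfl, split r₁ h0 h12]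
  have c1 : |flux (gradField ϑ η u) r₂ - flux (gradField ϑ η u) r₁|
      ≤ ε / 3 * r₂ * |r₂ - r₁| := by
    rw [h.flux_sub_flux_punctured h0 h12 (fun q hq => hU q (hq.trans_lt l1)) hBu,
      ← Real.norm_eq_abs]
    refine intervalIntegral.norm_integral_le_of_norm_le_const fun r hr => ?_
    rw [uIoc_of_le h12] at hr
    have hr0 : 0 < r := h0.trans hr.1
    have := (b₁ (show r ∈ Ioo 0 δ₁ from ⟨hr0, hr.2.trans_lt l2⟩) : _ ∧ _).1
    rw [zpow_one, Real.norm_of_nonneg hr0.le] at this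
    refine this.trans ?_
    have := hr.2
    gcongr
  have c2 : ∀ r, 0 < r → r ≤ r₂ →
      |flux (gradField ϑ η poleFun) r - 8 * Real.pi| ≤ ε / 3 * r₂ ^ 2 := by
    intro r hr0 hr2
    have := (b₁ (show r ∈ Ioo 0 δ₁ from ⟨hr0, hr2.trans_lt l2⟩) : _ ∧ _).2
    rw [Real.norm_of_nonneg (zpow_nonneg hr0.le _), zpow_ofNat] at this
    refine this.trans ?_
    gcongr
  have d1 := abs_le.1 (c2 r₂ (h0.trans_le h12) le_rfl)
  have d2 := abs_le.1 (c2 r₁ h0 h12)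
  rw [abs_of_nonneg (by linarith : 0 ≤ r₂ - r₁)] at c1
  have d3 : ε / 3 * r₂ * (r₂ - r₁) ≤ ε / 3 * r₂ ^ 2 := by
    have : 0 ≤ ε / 3 * r₂ := by have := h0.trans_le h12; positivity
    nlinarith
  have d4 := abs_le.1 (c1.trans d3)
  rw [abs_le]
  constructor <;> linarith [d1.1, d1.2, d2.1, d2.2, d4.1, d4.2]

/-- The flux of the gradient of the regular part is nearly constant, and its mean is small because the
regular part is `O(ρ)`. -/
theorem flux_rem_isLittleO :
    flux (gradField ϑ η fun q => u q - poleFun q - a) =o[𝓝[>] 0] fun r => r ^ (2 : ℤ) := by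
  refine isLittleO_iff.2 fun c hc => ?_
  obtain ⟨δ, hδ, hU⟩ := exists_radius h
  obtain ⟨δ', hδ', hF⟩ := flux_rem_sub h hu (by positivity : 0 < c / 8)
  obtain ⟨C, hC, hG⟩ := h.green_bound hu.smooth_rem (m := 0) (by simpa using hu.expansion)
  set F := flux (gradField ϑ η fun q => u q - poleFun q - a)
  have hpos : 0 < min (min δ δ' / 2) (c / (16 * C + 1)) := by
    have := lt_min hδ hδ'
    positivity
  filter_upwards [hG, Ioo_mem_nhdsGT hpos] with ε hε he
  obtain ⟨e0, e1⟩ := he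
  have l0 : ε < min δ δ' / 2 := e1.trans_le (min_le_left _ _)
  have l1 : 2 * ε < δ := by have := min_le_left δ δ'; linarith
  have l2 : 2 * ε < δ' := by have := min_le_right δ δ'; linarith
  have l3 : ε * (16 * C + 1) < c := by
    have := e1.trans_le (min_le_right _ _)
    rwa [lt_div_iff₀ (by positivity)] at this
  have hcont : ContinuousOn F (Icc ε (2 * ε)) :=
    continuousOn_flux (contDiffOn_gradField_rem h hu).continuousOn fun r hr φ s =>
      IsNormalCoframe.mem_punctured (e0.trans_le hr.1) hr.2
        (fun q hq => hU q (hq.trans_lt l1)) φ s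
  have hvar : ∀ r ∈ Icc ε (2 * ε), |F r - F ε| ≤ c / 2 * ε ^ 2 := by
    intro r hr
    refine (hF ε r e0 hr.1 (hr.2.trans_lt l2)).trans ?_
    have : r ^ 2 ≤ (2 * ε) ^ 2 := by
      have := hr.2
      have : 0 ≤ r := e0.le.trans hr.1
      gcongr
    nlinarith
  rw [zero_add, pow_one] at hε
  have k1 := le_of_integral_zpow_le (g := F) (m := F ε - c / 2 * ε ^ 2) (K := C * ε) e0
    (by positivity) hcont (fun r hr => by linarith [(abs_le.1 (hvar r hr)).1])
    (abs_le.1 hε).2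
  have k2 := le_of_integral_zpow_le (g := fun r => -F r) (m := -F ε - c / 2 * ε ^ 2) (K := C * ε) e0
    (by positivity) hcont.neg (fun r hr => by linarith [(abs_le.1 (hvar r hr)).2])
    (by simp only [mul_neg, intervalIntegral.integral_neg]; linarith [(abs_le.1 hε).1])
  have k3 : 8 * ε ^ 2 * (C * ε) ≤ c / 2 * ε ^ 2 := by nlinarith [pow_pos e0 2]
  rw [Real.norm_eq_abs, Real.norm_of_nonneg (zpow_nonneg e0.le _), zpow_ofNat, abs_le]
  constructor <;> linarith

/-- The flux of `w ∇w`, where `w` is the regular part, has bounded growth: `|∇w|²` contributes with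
a definite sign, although it is not known to be bounded. -/
theorem flux_energy_sub (hc : ∀ q ∈ U, 0 < contactDensity ϑ q) :
    ∃ C ≥ 0, ∃ δ > 0, ∀ r₁ r₂, 0 < r₁ → r₁ ≤ r₂ → r₂ < δ →
    flux (fun q => (u q - poleFun q - a) • gradField ϑ η (fun q => u q - poleFun q - a) q) r₂
      - flux (fun q => (u q - poleFun q - a) • gradField ϑ η (fun q => u q - poleFun q - a) q) r₁
    ≤ C * (r₂ - r₁) := by
  obtain ⟨δ, hδ, hU⟩ := exists_radius h
  have hw := hu.smooth_rem
  have hwO := hu.expansion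
  have hB := contDiffOn_gradField_rem h hu
  have hP := h.punctured
  have hdiv : (fun q => divg (gradField ϑ η fun q => u q - poleFun q - a) q) =O[𝓝[≠] 0]
      fun q => heisNorm q ^ (-4 : ℤ) := by
    refine ((hu.divg_gradField.isBigO.zpow_mono tendsto_heisNorm (by norm_num)).sub
      h.divg_gradField_poleFun).congr' ?_ EventuallyEq.rfl
    filter_upwards [h.eventually_mem tendsto_id, self_mem_nhdsWithin] with q hq hq0
    have hn := hP.isOpen.mem_nhds (show q ∈ U \ {0} from ⟨hq, hq0⟩)
    have e : gradField ϑ η (fun q => u q - poleFun q - a) =ᶠ[𝓝 q]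
        fun x => gradField ϑ η u x - gradField ϑ η poleFun x :=
      mem_of_superset hn fun x hx => gradField_rem h hu hx
    rw [divg_congr e, divg_sub
      (((hP.contDiffOn_gradField hu.smooth).contDiffAt hn).differentiableAt (by simp))
      ((h.contDiffOn_gradField_poleFun.contDiffAt hn).differentiableAt (by simp))]
  set w := fun q => u q - poleFun q - a with hw_def
  have hI : shellInt (fun q => w q * divg (gradField ϑ η w) q) =O[𝓝[>] 0] fun r => r ^ (0 : ℤ) :=
    isBigO_shellInt (hwO.zpow_mul hdiv tendsto_heisNorm (n := -3) (by norm_num)) (by norm_num)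
  obtain ⟨C, hC, b⟩ := hI.exists_nonneg
  obtain ⟨δ', hδ', hb⟩ := mem_nhdsGT_iff_exists_Ioo_subset.1 b.bound
  refine ⟨C, hC, min δ δ', lt_min hδ hδ', fun r₁ r₂ h0 h12 hr => ?_⟩
  have l1 : r₂ < δ := hr.trans_le (min_le_left _ _)
  have l2 : r₂ < δ' := hr.trans_le (min_le_right _ _)
  have hs : ∀ q, heisNorm q ≤ r₂ → q ∈ U := fun q hq => hU q (hq.trans_lt l1)
  have hmem : ∀ r ∈ Icc r₁ r₂, ∀ φ s, heisSphere r φ s ∈ U \ {0} := fun r hr φ s =>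
    IsNormalCoframe.mem_punctured (h0.trans_le hr.1) hr.2 hs φ s
  have hwB : ContDiffOn ℝ ∞ (fun q => w q • gradField ϑ η w q) (U \ {0}) := hw.smul hB
  have hdf : ContinuousOn (fun q => fderiv ℝ w q (gradField ϑ η w q)) (U \ {0}) :=
    (hw.continuousOn_fderiv_of_isOpen hP.isOpen (by simp)).clm_apply hB.continuousOn
  rw [h.flux_sub_flux_punctured h0 h12 hs hwB]
  have key : ∀ r ∈ Icc r₁ r₂, shellInt (divg fun q => w q • gradField ϑ η w q) r ≤ C := by
    intro r hr
    have hr0 : 0 < r := h0.trans_le hr.1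
    have e : shellInt (divg fun q => w q • gradField ϑ η w q) r
        = shellInt (fun q => fderiv ℝ w q (gradField ϑ η w q)) r
          + shellInt (fun q => w q * divg (gradField ϑ η w) q) r := by
      rw [shellInt_eq, shellInt_eq, shellInt_eq, ← sphInt_add
        (continuous_shellDens hdf (hmem r hr))
        (continuous_shellDens (hw.continuousOn.mul (hP.continuousOn_divg hB)) (hmem r hr))]
      congr 1
      funext φ s
      have hn := hP.isOpen.mem_nhds (hmem r hr φ s)
      rw [divg_smul ((hw.contDiffAt hn).differentiableAt (by simp))
        ((hB.contDiffAt hn).differentiableAt (by simp)), add_mul]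
    have n1 : shellInt (fun q => fderiv ℝ w q (gradField ϑ η w q)) r ≤ 0 := by
      rw [shellInt_eq]
      refine sphInt_nonpos fun φ s hcos => mul_nonpos_of_nonpos_of_nonneg ?_
        (polJac_nonneg hr0.le hcos)
      have hq := hmem r hr φ s
      rw [hP.fderiv_gradField hq]
      have := hc _ hq.1
      refine mul_nonpos_of_nonpos_of_nonneg (by linarith) ?_
      exact add_nonneg (mul_self_nonneg _) (mul_self_nonneg _)
    have n2 := (hb (show r ∈ Ioo 0 δ' from ⟨hr0, hr.2.trans_lt l2⟩) :)
    simp only [mem_ofPred_eq, zpow_zero, norm_one, mul_one] at n2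
    linarith [(abs_le.1 n2).2]
  have hcont : ContinuousOn (shellInt (divg fun q => w q • gradField ϑ η w q)) (uIcc r₁ r₂) := by
    rw [uIcc_of_le h12]
    exact continuousOn_shellInt (hP.continuousOn_divg hwB) hmem
  have := intervalIntegral.integral_mono_on (g := fun _ => C) (μ := volume) h12
    hcont.intervalIntegrable intervalIntegrable_const key
  rw [intervalIntegral.integral_const, smul_eq_mul] at this
  linarith

/-- The flux of `w ∇w`, where `w` is the regular part, tends to zero: it is nearly monotone, so that its
mean over `[ε, 2 ε]` bounds its value at `ε` from one side and at `2 ε` from the other. -/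
theorem flux_energy_tendsto (hc : ∀ q ∈ U, 0 < contactDensity ϑ q) :
    Tendsto (flux fun q => (u q - poleFun q - a) •
      gradField ϑ η (fun q => u q - poleFun q - a) q) (𝓝[>] 0) (𝓝 0) := by
  obtain ⟨δ, hδ, hU⟩ := exists_radius h
  obtain ⟨C, hC, δ', hδ', hQ⟩ := flux_energy_sub h hu hc
  have hw := hu.smooth_rem
  have hwO := hu.expansion
  have hB := contDiffOn_gradField_rem h hu
  set w := fun q => u q - poleFun q - a with hw_def
  have hw2 : ContDiffOn ℝ ∞ (fun q => w q ^ 2) (U \ {0}) := hw.pow 2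
  obtain ⟨K, hK, hG⟩ := h.green_bound hw2 (m := 1) (by
    simpa [pow_two] using hwO.zpow_mul hwO tendsto_heisNorm (n := 2) (by norm_num))
  have hwB : ContDiffOn ℝ ∞ (fun q => w q • gradField ϑ η w q) (U \ {0}) := hw.smul hB
  set Q := flux fun q => w q • gradField ϑ η w q with hQ_def
  have hpos : 0 < min δ δ' / 2 := by
    have := lt_min hδ hδ'
    positivity
  -- lower bound at `ε` and upper bound at `2 ε`
  have key : ∀ᶠ ε in 𝓝[>] (0 : ℝ), -(C * ε + 8 * ε ^ 2 * (K * ε ^ 2)) ≤ Q ε ∧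
      Q (2 * ε) ≤ C * ε + 8 * ε ^ 2 * (K * ε ^ 2) := by
    filter_upwards [hG, Ioo_mem_nhdsGT hpos] with ε hε he
    obtain ⟨e0, e1⟩ := he
    have l1 : 2 * ε < δ := by have := min_le_left δ δ'; linarith
    have l2 : 2 * ε < δ' := by have := min_le_right δ δ'; linarith
    have hmem : ∀ r ∈ Icc ε (2 * ε), ∀ φ s, heisSphere r φ s ∈ U \ {0} := fun r hr φ s =>
      IsNormalCoframe.mem_punctured (e0.trans_le hr.1) hr.2
        (fun q hq => hU q (hq.trans_lt l1)) φ s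
    have hcont : ContinuousOn Q (Icc ε (2 * ε)) := continuousOn_flux hwB.continuousOn hmem
    have hsq : ∀ r ∈ uIcc ε (2 * ε), r ^ (-3 : ℤ) * flux (gradField ϑ η fun q => w q ^ 2) r
        = 2 * (r ^ (-3 : ℤ) * Q r) := by
      intro r hr
      rw [uIcc_of_le (by linarith)] at hr
      have : flux (gradField ϑ η fun q => w q ^ 2) r = 2 * Q r := by
        rw [hQ_def, flux_eq, flux_eq, ← sphInt_const_mul]
        congr 1
        funext φ s
        have hn := h.punctured.isOpen.mem_nhds (hmem r hr φ s)
        have hd := ((hw.contDiffAt hn).differentiableAt (by simp)).hasFDerivAt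
        have hk : fderiv ℝ (fun q => w q ^ 2) (heisSphere r φ s)
            = (2 * w (heisSphere r φ s)) • fderiv ℝ w (heisSphere r φ s) := by
          rw [(hd.pow 2).fderiv]; simp
        rw [fluxDens, fluxDens, IsCoframe.gradField_smul_const hk, det3_smul, det3_smul]
        ring
      rw [this]; ring
    rw [intervalIntegral.integral_congr hsq, intervalIntegral.integral_const_mul, one_add_one_eq_two]
      at hε
    have hi := abs_le.1 hε
    have p : 0 ≤ K * ε ^ 2 := by positivity
    have k1 := le_of_integral_zpow_le (g := fun r => -Q r) (m := -Q ε - C * ε) (K := K * ε ^ 2) e0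
      p hcont.neg (fun r hr => by
        have := hQ ε r e0 hr.1 (hr.2.trans_lt l2)
        nlinarith [hr.2])
      (by simp only [mul_neg, intervalIntegral.integral_neg]; linarith)
    have k2 := le_of_integral_zpow_le (g := Q) (m := Q (2 * ε) - C * ε) (K := K * ε ^ 2) e0
      p hcont (fun r hr => by
        have := hQ r (2 * ε) (e0.trans_le hr.1) hr.2 l2
        nlinarith [hr.1])
      (by linarith)
    exact ⟨by linarith, by linarith⟩
  have hz : Tendsto (fun ε : ℝ => C * ε + 8 * ε ^ 2 * (K * ε ^ 2)) (𝓝[>] 0) (𝓝 0) := by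
    have : Continuous fun ε : ℝ => C * ε + 8 * ε ^ 2 * (K * ε ^ 2) := by fun_prop
    have := this.tendsto 0
    simp only [mul_zero, ne_eq, OfNat.ofNat_ne_zero, not_false_eq_true, zero_pow, add_zero] at this
    exact this.mono_left nhdsWithin_le_nhds
  have hhalf : Tendsto (fun r : ℝ => r / 2) (𝓝[>] 0) (𝓝[>] 0) := by
    refine tendsto_nhdsWithin_iff.2 ⟨?_, ?_⟩
    · have : Continuous fun r : ℝ => r / 2 := by fun_prop
      have := this.tendsto 0
      rw [zero_div] at this
      exact this.mono_left nhdsWithin_le_nhds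
    · filter_upwards [self_mem_nhdsWithin] with r hr
      exact half_pos (mem_Ioi.1 hr)
  refine tendsto_of_tendsto_of_tendsto_of_le_of_le' (by simpa using hz.neg) (hz.comp hhalf)
    (key.mono fun _ hx => hx.1) ((hhalf.eventually key).mono fun r hx => ?_)
  have := hx.2
  rwa [mul_div_cancel₀ r two_ne_zero] at this

/-- The flux density whose limit is the p-mass, up to terms which tend to zero. -/
theorem fluxDens_sub :
    (fun x : ℝ × ℝ × ℝ =>
      fluxDens (fun q => cross (connPot ϑ η q - (3 / u q) • rotGrad ϑ η u q + (3 : ℝ) • argForm q)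
        (scaledForm u ϑ q)) x.1 x.2.1 x.2.2
      - (3 * a * modelDens x.2.2
        - 3 * (x.1 ^ (-2 : ℤ) + a) *
          fluxDens (gradField ϑ η fun q => u q - poleFun q - a) x.1 x.2.1 x.2.2
        - 3 * fluxDens (fun q => (u q - poleFun q - a) •
          gradField ϑ η (fun q => u q - poleFun q - a) q) x.1 x.2.1 x.2.2))
      =O[sphFilter] fun x => x.1 ^ (1 : ℤ) := by
  have hρ := tendsto_sphFilter_fst
  have hwO := isBigO_comp_sphPt hu.expansion
  have hd : (fun x : ℝ × ℝ × ℝ => modelDens x.2.2) =O[sphFilter] fun x => x.1 ^ (0 : ℤ) :=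
    isBigO_modelDens
  have p : ∀ n : ℤ, (fun x : ℝ × ℝ × ℝ => x.1 ^ n) =O[sphFilter] fun x => x.1 ^ n :=
    fun n => isBigO_refl _ _
  have ha : (fun _ : ℝ × ℝ × ℝ => a) =O[sphFilter] fun x => x.1 ^ (0 : ℤ) :=
    (tendsto_const_nhds (x := a)).isBigO_zpow_zero
  have haw := ha.add (hwO.zpow_mono hρ (n := 0) (by norm_num))
  have hU : (fun x => u (sphPt x)) =O[sphFilter] fun x => x.1 ^ (-2 : ℤ) := by
    refine ((p (-2)).add (haw.zpow_mono hρ (n := -2) (by norm_num))).congr' ?_ EventuallyEq.rfl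
    filter_upwards [eventually_sphFilter_pos] with x hx
    have := poleFun_heisSphere hx.le x.2.1 x.2.2
    rw [sphPt, this]; ring
  have hU2 := hU.zpow_mul hU hρ (n := -4) (by norm_num)
  have t1 := hU2.zpow_mul h.fluxDens_connPot hρ (n := 1) (by norm_num)
  have t2 := (hU2.zpow_mul h.fluxDens_argForm hρ (n := 1) (by norm_num)).const_mul_left 3
  have t3 := (hU.zpow_mul h.fluxDens_gradField_poleFun hρ (n := 1) (by norm_num)).const_mul_left 3
  have t4 := ((hwO.add ((haw.zpow_mul haw hρ (n := 0) (by norm_num)).zpow_mul (p 2) hρ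
    (n := 1) (by norm_num))).zpow_mul hd hρ (n := 1) (by norm_num)).const_mul_left 3
  refine (((t1.add t2).sub t3).add t4).congr' ?_ EventuallyEq.rfl
  obtain ⟨δ, hδ, hUδ⟩ := exists_radius h
  have hball : ∀ᶠ x in sphFilter, x.1 ∈ Ioo 0 δ := tendsto_sphFilter_fst.eventually
    (Ioo_mem_nhdsGT hδ)
  filter_upwards [hball] with x hx
  have hq := IsNormalCoframe.mem_punctured hx.1 le_rfl (fun q hq => hUδ q (hq.trans_lt hx.2))
    x.2.1 x.2.2
  have e0 := poleFun_heisSphere hx.1.le x.2.1 x.2.2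
  have eD : fluxDens (gradField ϑ η u) x.1 x.2.1 x.2.2
      = fluxDens (gradField ϑ η poleFun) x.1 x.2.1 x.2.2
        + fluxDens (gradField ϑ η fun q => u q - poleFun q - a) x.1 x.2.1 x.2.2 := by
    rw [fluxDens, fluxDens, fluxDens, gradField_rem h hu hq, det3_sub]; ring
  have eW : fluxDens (fun q => (u q - poleFun q - a) •
        gradField ϑ η (fun q => u q - poleFun q - a) q) x.1 x.2.1 x.2.2
      = (u (sphPt x) - x.1 ^ (-2 : ℤ) - a)
        * fluxDens (gradField ϑ η fun q => u q - poleFun q - a) x.1 x.2.1 x.2.2 := by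
    rw [fluxDens, fluxDens, det3_smul, e0]; rfl
  have h22 : x.1 ^ (-2 : ℤ) * x.1 ^ (2 : ℤ) = 1 := by
    rw [← zpow_add₀ hx.1.ne']; simp
  have e0' : poleFun (sphPt x) = x.1 ^ (-2 : ℤ) := e0
  rw [fluxDens_blowup, eD, eW, e0']
  set Uu := u (sphPt x)
  linear_combination (3 * modelDens x.2.2 * (x.1 ^ (-2 : ℤ) - 2 * Uu)) * h22

/-- The limit of the flux near the pole to which the p-mass is reduced. The terms of order `r⁻²` in
the model parts cancel. -/
theorem flux_tendsto (hc : ∀ q ∈ U, 0 < contactDensity ϑ q) :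
    Tendsto (flux fun q => cross (connPot ϑ η q - (3 / u q) • rotGrad ϑ η u q
      + (3 : ℝ) • argForm q) (scaledForm u ϑ q)) (𝓝[>] 0) (𝓝 (24 * Real.pi * a)) := by
  obtain ⟨δ, hδ, hU⟩ := exists_radius h
  have hw := hu.smooth_rem
  have hB := contDiffOn_gradField_rem h hu
  have hE := isBigO_sphInt (k := fun r φ s =>
      fluxDens (fun q => cross (connPot ϑ η q - (3 / u q) • rotGrad ϑ η u q + (3 : ℝ) • argForm q)
        (scaledForm u ϑ q)) r φ s
      - (3 * a * modelDens s
        - 3 * (r ^ (-2 : ℤ) + a) *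
          fluxDens (gradField ϑ η fun q => u q - poleFun q - a) r φ s
        - 3 * fluxDens (fun q => (u q - poleFun q - a) •
          gradField ϑ η (fun q => u q - poleFun q - a) q) r φ s)) (fluxDens_sub h hu)
  have id0 : Tendsto (fun r : ℝ => r) (𝓝[>] 0) (𝓝 0) := tendsto_id.mono_right nhdsWithin_le_nhds
  have hE0 := hE.trans_tendsto (by simpa using id0)
  have hF := flux_rem_isLittleO h hu
  have hQ := flux_energy_tendsto h hu hc
  have hF1 : Tendsto (fun r => r ^ (-2 : ℤ) *
      flux (gradField ϑ η fun q => u q - poleFun q - a) r) (𝓝[>] 0) (𝓝 0) := by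
    refine hF.tendsto_div_nhds_zero.congr fun r => ?_
    rw [zpow_neg, div_eq_inv_mul]
  have hF0 : Tendsto (flux (gradField ϑ η fun q => u q - poleFun q - a)) (𝓝[>] 0) (𝓝 0) :=
    hF.isBigO.trans_tendsto (by simpa using id0.pow 2)
  have := ((hE0.add_const (3 * a * (8 * Real.pi))).sub ((hF1.add (hF0.const_mul a)).const_mul 3)).sub
    (hQ.const_mul 3)
  rw [show 0 + 3 * a * (8 * Real.pi) - 3 * (0 + a * 0) - 3 * 0 = 24 * Real.pi * a by ring] at this
  refine this.congr' ?_
  filter_upwards [Ioo_mem_nhdsGT hδ] with r hr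
  have hmem : ∀ φ s, heisSphere r φ s ∈ U \ {0} := fun φ s =>
    IsNormalCoframe.mem_punctured hr.1 le_rfl (fun q hq => hU q (hq.trans_lt hr.2)) φ s
  have hP := h.punctured
  have cu : Continuous fun p : ℝ × ℝ => u (sphPt (r, p.1, p.2)) :=
    continuous_sph hu.smooth.continuousOn hmem
  have cross_cont : ∀ {l : Heis → Heis →L[ℝ] ℝ}, ContinuousOn l (U \ {0}) →
      Continuous fun p : ℝ × ℝ => fluxDens (fun q => cross (l q) (ϑ q)) r p.1 p.2 := fun hl =>
    continuous_fluxDens (contDiffOn_zero.1 (ContDiffOn.cross (contDiffOn_zero.2 hl)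
      (contDiffOn_zero.2 hP.smooth₁.continuousOn))) hmem
  have c1 := cross_cont hP.contDiffOn_connPot.continuousOn
  have c2 := cross_cont (continuousOn_argForm (s := U \ {0}) (by simp))
  have c3 := continuous_fluxDens (hP.contDiffOn_gradField hu.smooth).continuousOn hmem
  have c4 := continuous_fluxDens hB.continuousOn hmem
  have c5 := continuous_fluxDens (hw.continuousOn.smul hB.continuousOn) hmem
  have c6 : Continuous fun p : ℝ × ℝ => 3 * a * modelDens p.2 :=
    (continuous_modelDens.comp continuous_snd).const_mul _
  have cK : Continuous fun p : ℝ × ℝ => fluxDens (fun q => cross (connPot ϑ η q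
      - (3 / u q) • rotGrad ϑ η u q + (3 : ℝ) • argForm q) (scaledForm u ϑ q)) r p.1 p.2 := by
    simp only [fluxDens_blowup]
    exact (((cu.pow 2).mul c1).sub ((cu.const_mul 3).mul c3)).add
      (((cu.pow 2).const_mul 3).mul c2)
  have c4' := c4.const_mul (3 * (r ^ (-2 : ℤ) + a))
  have c5' := c5.const_mul 3
  rw [sphInt_sub cK ((c6.sub c4').sub c5'), sphInt_sub (c6.sub c4') c5', sphInt_sub c6 c4',
    sphInt_const_mul, sphInt_const_mul, sphInt_const_mul, sphInt_modelDens, ← flux_eq, ← flux_eq,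
    ← flux_eq]
  ring

end HasPoleExpansion

/-! ### Coordinate expressions of the data on the manifold -/

theorem dForm_imagForm {μ : Heis → Heis →L[ℝ] ℝ} {q : Heis} (hμ : DifferentiableAt ℝ μ q)
    (a b : Heis) : dForm (imagForm μ) q a b = I * ((dForm μ q a b : ℝ) : ℂ) := by
  have h1 : ∀ v w, fderiv ℝ (imagForm μ) q v w = I * (fderiv ℝ μ q v w : ℂ) := by
    intro v w
    have h : HasFDerivAt (imagForm μ) _ q :=
      ((hasFDerivAt_const (ofRealCLM : ℝ →L[ℝ] ℂ) q).clm_comp hμ.hasFDerivAt).const_smul I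
    rw [h.fderiv]
    simp
  rw [dForm, dForm, h1, h1]
  push_cast
  ring

theorem IsNormalCoframe.mono {ϑ : Heis → Heis →L[ℝ] ℝ} {η : Heis → Heis →L[ℝ] ℂ} {U U' : Set Heis}
    (h : IsNormalCoframe ϑ η U) (hU' : IsOpen U') (hs : U' ⊆ U) (h0 : 0 ∈ U') :
    IsNormalCoframe ϑ η U' := by
  obtain ⟨a, b, ha, hb, hab⟩ := h.contact_bound
  obtain ⟨c, d, hc, hd, hcd⟩ := h.coframe_bound
  exact ⟨h.toIsCoframe.mono hU' hs, h0, ⟨a, b, ha, hb, fun q hq => hab q (hs hq)⟩,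
    ⟨c, d, hc, hd, fun q hq => hcd q (hs hq)⟩⟩

section

variable {M : Type*} [TopologicalSpace M] [ChartedSpace Heis M] {C : CRStructure M}
  {θ : OneForm M ℝ} {κ : Heis → M} {V : Set Heis} {η : Heis → Heis →L[ℝ] ℂ}

/-- A unitary coframe on `M` is one in coordinates. That `ϑ` and `η` are jointly injective follows
from the positivity of `dθ(v, J v)`. -/
theorem isCoframe_of_isUnitaryCoframe (hθ : C.IsContactForm θ univ) (hκ : IsParam κ V)
    (hη : C.IsUnitaryCoframe θ κ V η) : IsCoframe (pull κ θ) η V := by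
  have hunit : ∀ q ∈ V, ∀ u v,
      dForm (pull κ θ) q u v = 2 * ((η q u).re * (η q v).im - (η q u).im * (η q v).re) := by
    intro q hq u v
    have := congrArg re (hη.unitary q hq u v)
    rw [ofReal_re] at this
    rw [this]
    simp [wedge, conjForm]
    ring
  refine ⟨hκ.isOpen, hθ.smooth κ V hκ (subset_univ _), hη.smooth, hunit, fun q hq u h1 h2 => ?_⟩
  -- otherwise `dθ(u, J u)` would be both positive and zero
  by_contra hu
  have hξ : dParam κ q u ∈ C.ξ (κ q) := (hθ.mem_ξ_iff _ (mem_univ _) _).2 h1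
  obtain ⟨w, hw⟩ := (hκ.bijective q hq).2 (C.J (κ q) (dParam κ q u))
  have := hθ.pos κ V hκ (subset_univ _) q hq u w hu hξ hw
  rw [hunit q hq, h2] at this
  simp at this

/-- CR normal coordinates give a coframe which osculates the standard one. -/
theorem isNormalCoframe_of_isCRNormal {p : M} (hθ : C.IsContactForm θ univ)
    (hκ : C.IsCRNormal θ p κ V η) : IsNormalCoframe (pull κ θ) η V := by
  have conv : ∀ {f : Heis → ℂ} {k : ℕ}, f =O[𝓝 0] (fun q => heisNorm q ^ k) →
      (fun q => ‖f q‖) =O[𝓝[≠] 0] fun q => heisNorm q ^ (k : ℤ) := fun hf =>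
    (hf.mono nhdsWithin_le_nhds).zpow_one.norm_left
  refine ⟨isCoframe_of_isUnitaryCoframe hθ hκ.isParam hκ.coframe, hκ.zero_mem, ?_, ?_⟩
  · obtain ⟨a, b, c, ha, hb, hc, habc⟩ := hκ.contact_expansion
    refine ⟨fun q => ‖a q‖, fun q => ‖b q‖ + ‖c q‖, conv ha, (conv hb).add (conv hc),
      fun q hq u => ?_⟩
    have e : ((pull κ θ q u - stdForm q u : ℝ) : ℂ)
        = a q * (stdForm q u : ℂ) + b q * u.1 + c q * conj u.1 := by
      push_cast
      rw [habc q hq u, stdContact_eq]; ring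
    rw [← Complex.norm_real, e]
    refine (norm_add₃_le).trans ?_
    simp only [norm_mul, Complex.norm_real, RCLike.norm_conj]
    linarith
  · obtain ⟨a, b, c, ha, hb, hc, habc⟩ := hκ.coframe_expansion
    refine ⟨fun q => √2 * ‖a q‖ + ‖b q‖, fun q => ‖c q‖,
      ((conv ha).const_mul_left _).add (conv hb), conv hc, fun q hq u => ?_⟩
    have e : η q u - (√2 : ℂ) * u.1
        = (√2 : ℂ) * a q * u.1 + b q * conj u.1 + c q * (stdForm q u : ℂ) := by
      rw [habc q hq u, stdContact_eq]; ring
    rw [e]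
    refine (norm_add₃_le).trans ?_
    simp only [norm_mul, Complex.norm_real, RCLike.norm_conj, Real.norm_of_nonneg (Real.sqrt_nonneg 2)]
    linarith

/-- The curvature in coordinates, by means of the connection form. -/
theorem curvature_eq {R : M → ℝ} (hR : C.IsWebsterCurvature θ R) (hκ : IsParam κ V)
    (hη : C.IsUnitaryCoframe θ κ V η) (h : IsCoframe (pull κ θ) η V) {q : Heis} (hq : q ∈ V)
    {u v : Heis} (hu : pull κ θ q u = 0) (hv : pull κ θ q v = 0) :
    dForm (connPot (pull κ θ) η) q u v
      = -2 * R (κ q) * ((η q u).re * (η q v).im - (η q u).im * (η q v).re) := by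
  have := hR κ V η _ hκ hη h.isConnectionForm q hq u v hu hv
  have hd : DifferentiableAt ℝ (connPot (pull κ θ) η) q :=
    (h.contDiffOn_connPot.contDiffAt (h.isOpen.mem_nhds hq)).differentiableAt (by simp)
  rw [dForm_imagForm hd] at this
  have := congrArg im this
  simp [wedge, conjForm] at this
  linarith

theorem continuousOn_curvature {R : M → ℝ} (hR : C.IsWebsterCurvature θ R) (hκ : IsParam κ V)
    (hη : C.IsUnitaryCoframe θ κ V η) (h : IsCoframe (pull κ θ) η V) :
    ContinuousOn (fun q => R (κ q)) V := by
  have hc := (ContDiffOn.dForm h.isOpen h.contDiffOn_connPot h.contDiffOn_X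
    h.contDiffOn_Y).continuousOn.const_mul (-2⁻¹ : ℝ)
  refine hc.congr fun q hq => ?_
  beta_reduce
  rw [curvature_eq hR hκ hη h hq (h.ϑ_X hq) (h.ϑ_Y hq), h.η_X hq, h.η_Y hq]
  simp

/-- The curvature vanishes at the centre of CR normal coordinates. -/
theorem curvature_center {R : M → ℝ} (hR : C.IsWebsterCurvature θ R) (hκ : IsParam κ V)
    (hη : C.IsUnitaryCoframe θ κ V η) (h : IsNormalCoframe (pull κ θ) η V) : R (κ 0) = 0 := by
  have := curvature_eq hR hκ hη h.toIsCoframe h.zero_mem (u := ex) (v := ey)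
    (by simp [h.contact_zero]) (by simp [h.contact_zero])
  rw [h.dForm_connPot_zero, h.coframe_zero, h.coframe_zero] at this
  simpa [ex, ey, eq_comm] using this

theorem param_ne_center {p : M} (hκ : IsParam κ V) (h0 : (0 : Heis) ∈ V) (hp : κ 0 = p) {q : Heis}
    (hq : q ∈ V \ {0}) : κ q ≠ p := fun h => hq.2 (hκ.injOn hq.1 h0 (h.trans hp.symm))

theorem contDiffOn_green {p : M} {G : M → ℝ} (hG : ContMDiffOn 𝓘(ℝ, Heis) 𝓘(ℝ, ℝ) ∞ G {p}ᶜ)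
    (hκ : IsParam κ V) {V' : Set Heis} (hV' : V' ⊆ V) (hp : ∀ q ∈ V', κ q ≠ p) :
    ContDiffOn ℝ ∞ (fun q => G (κ q)) V' := by
  rw [← contMDiffOn_iff_contDiffOn]
  exact hG.comp (hκ.smooth.mono hV') fun q hq => hp q hq

/-- The conformal factor of the blow-up has a pole expansion at the centre. -/
theorem hasPoleExpansion_green {R : M → ℝ} {p : M} {G : M → ℝ} {A : ℝ}
    (hθ : C.IsContactForm θ univ) (hR : C.IsWebsterCurvature θ R)
    (hκ : C.IsCRNormal θ p κ V η) (hG : C.IsGreenFunction θ R p G)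
    (hA : (fun q => G (κ q) - (1 / (2 * Real.pi * heisNorm q ^ 2) + A)) =O[𝓝[≠] 0] heisNorm)
    {B : Set Heis} (hBo : IsOpen B) (hBV : B ⊆ V)
    (h0B : (0 : Heis) ∈ B) (hc : ∀ q ∈ B, 0 < contactDensity (pull κ θ) q) :
    HasPoleExpansion (pull κ θ) η B (fun q => 2 * Real.pi * G (κ q)) (2 * Real.pi * A) := by
  have hN := isNormalCoframe_of_isCRNormal hθ hκ
  have hB := hN.mono hBo hBV h0B
  have hP := hB.punctured
  have hne : ∀ q ∈ B \ {0}, κ q ≠ p := fun q hq =>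
    param_ne_center hκ.isParam hκ.zero_mem hκ.map_zero ⟨hBV hq.1, hq.2⟩
  have hg : ContDiffOn ℝ ∞ (fun q => G (κ q)) (B \ {0}) :=
    contDiffOn_green hG.smooth hκ.isParam (sdiff_subset.trans hBV) hne
  have hRc := continuousOn_curvature hR hκ.isParam hκ.coframe hN.toIsCoframe
  have heq := hP.equation_of_weak hg (hRc.mono (sdiff_subset.trans hBV))
    (fun q hq => hc q hq.1) hN.isOpen.measurableSet (sdiff_subset.trans hBV) (by
      intro φ hφ hφc hφs
      have := (hG.equation κ V η _ hκ.isParam hκ.coframe hN.isConnectionForm φ hφ hφc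
        (hφs.trans (sdiff_subset.trans hBV))).1 0 hκ.zero_mem hκ.map_zero
      have hφ0 : φ 0 = 0 := image_eq_zero_of_notMem_tsupport fun h => (hφs h).2 rfl
      rw [hφ0] at this
      simpa using this)
  have hexp : (fun q => 2 * Real.pi * G (κ q) - poleFun q - 2 * Real.pi * A) =O[𝓝[≠] 0]
      fun q => heisNorm q ^ (1 : ℤ) := by
    simp only [zpow_one]
    refine (hA.const_mul_left (2 * Real.pi)).congr' ?_ EventuallyEq.rfl
    filter_upwards [self_mem_nhdsWithin] with q hq
    have hρ := heisNorm_pos hq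
    have := Real.pi_pos
    rw [poleFun, zpow_neg, zpow_ofNat]
    field_simp
    ring
  refine ⟨hg.const_smul (2 * Real.pi), hexp, ?_⟩
  -- the curvature tends to zero at the centre
  have hR0 : (fun q => R (κ q)) =o[𝓝[≠] 0] fun _ => (1 : ℝ) := by
    rw [isLittleO_one_iff]
    have := (hRc.continuousAt hN.mem_nhds).tendsto
    rw [curvature_center hR hκ.isParam hκ.coframe hN] at this
    exact this.mono_left nhdsWithin_le_nhds
  have hu : (fun q => 2 * Real.pi * G (κ q)) =O[𝓝[≠] 0] fun q => heisNorm q ^ (-2 : ℤ) := by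
    have h1 := hexp.zpow_mono tendsto_heisNorm (n := -2) (by norm_num)
    have h2 : (fun _ : Heis => 2 * Real.pi * A) =O[𝓝[≠] 0] fun q => heisNorm q ^ (-2 : ℤ) :=
      (tendsto_const_nhds.isBigO_zpow_zero).zpow_mono tendsto_heisNorm (by norm_num)
    refine ((h1.add h2).add (isBigO_refl poleFun _)).congr_left fun q => ?_
    ring
  have hcO := hB.isBigO_zero_of_continuousOn hB.contDiffOn_contactDensity.continuousOn
    (tendsto_id (α := Heis) (x := 𝓝[≠] 0))
  have hprod := (hR0.mul_isBigO (hu.zpow_mul hcO tendsto_heisNorm (n := -2) (by norm_num))).const_mul_left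
    (-(1 / 4))
  simp only [one_mul] at hprod
  refine hprod.congr' ?_ EventuallyEq.rfl
  filter_upwards [hB.eventually_mem (tendsto_id (α := Heis) (x := 𝓝[≠] 0)), self_mem_nhdsWithin]
    with q hq hq0
  have hqP : q ∈ B \ {0} := ⟨hq, hq0⟩
  have hn := hP.isOpen.mem_nhds hqP
  have e : gradField (pull κ θ) η (fun q => 2 * Real.pi * G (κ q)) =ᶠ[𝓝 q]
      fun x => (2 * Real.pi) • gradField (pull κ θ) η (fun q => G (κ q)) x := by
    filter_upwards [hn] with x hx
    refine IsCoframe.gradField_smul_const ?_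
    have hd := (hg.contDiffAt (hP.isOpen.mem_nhds hx)).differentiableAt (by simp)
    exact (hd.hasFDerivAt.const_mul (2 * Real.pi)).fderiv
  have hd := ((hP.contDiffOn_gradField hg).contDiffAt hn).differentiableAt (by simp)
  rw [divg_congr e, divg_smul (differentiableAt_const _) hd]
  have := heq q hqP
  simp
  linear_combination -(Real.pi / 2) * this

/-- The conformal factor of the blow-up is positive near the pole. -/
theorem eventually_pole_pos {u : Heis → ℝ} {a : ℝ}
    (h : (fun q => u q - poleFun q - a) =O[𝓝[≠] 0] fun q => heisNorm q ^ (1 : ℤ)) :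
    ∀ᶠ q in 𝓝[≠] (0 : Heis), 0 < u q := by
  have h1 : Tendsto (fun q => u q - poleFun q - a) (𝓝[≠] 0) (𝓝 0) :=
    h.trans_tendsto (by simpa using tendsto_heisNorm.mono_right nhdsWithin_le_nhds)
  have h2 : Tendsto poleFun (𝓝[≠] 0) atTop := by
    have : Tendsto (fun r : ℝ => (r ^ 2)⁻¹) (𝓝[>] 0) atTop := by
      refine tendsto_inv_nhdsGT_zero.comp (tendsto_nhdsWithin_iff.2 ⟨?_, ?_⟩)
      · have : Continuous fun r : ℝ => r ^ 2 := by fun_prop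
        have := this.tendsto 0
        simp only [ne_eq, OfNat.ofNat_ne_zero, not_false_eq_true, zero_pow] at this
        exact this.mono_left nhdsWithin_le_nhds
      · filter_upwards [self_mem_nhdsWithin] with r hr
        exact pow_pos (mem_Ioi.1 hr) 2
    refine (this.comp tendsto_heisNorm).congr fun q => ?_
    rw [Function.comp_apply, poleFun, zpow_neg]; norm_cast
  have := (h1.add_const a).add_atTop h2
  filter_upwards [this.eventually_gt_atTop 0] with q hq
  linarith

end

/-! ### The blow-up in inverted coordinates -/

/-- The contact form `u² ϑ` in the inverted coordinates. -/
def invertedForm (u : Heis → ℝ) (ϑ : Heis → Heis →L[ℝ] ℝ) : Heis → Heis →L[ℝ] ℝ :=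
  pullForm heisInvSymm (scaledForm u ϑ)

/-- The unitary coframe of `u² ϑ` in the inverted coordinates, multiplied by the unitary factor
`-v³ / ρ⁶`. -/
def invertedCoframe (u : Heis → ℝ) (ϑ : Heis → Heis →L[ℝ] ℝ) (η : Heis → Heis →L[ℝ] ℂ) (q : Heis) :
    Heis →L[ℝ] ℂ :=
  (-heisV q ^ 3 / (heisNorm q : ℂ) ^ 6) • pullForm heisInvSymm (scaledCoframe u ϑ η) q

theorem dForm_congr {F : Type*} [NormedAddCommGroup F] [NormedSpace ℝ F]
    {α β : Heis → Heis →L[ℝ] F} {U : Set Heis} (hU : IsOpen U) (h : EqOn α β U) {q : Heis}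
    (hq : q ∈ U) (a b : Heis) : dForm α q a b = dForm β q a b := by
  rw [dForm, dForm, (h.eventuallyEq_of_mem (hU.mem_nhds hq)).fderiv_eq]

namespace IsCoframe

variable {ϑ : Heis → Heis →L[ℝ] ℝ} {η : Heis → Heis →L[ℝ] ℂ} {U U' : Set Heis}

theorem congr (h : IsCoframe ϑ η U) {ϑ' : Heis → Heis →L[ℝ] ℝ} {η' : Heis → Heis →L[ℝ] ℂ}
    (h₁ : EqOn ϑ' ϑ U) (h₂ : EqOn η' η U) : IsCoframe ϑ' η' U where
  isOpen := h.isOpen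
  smooth₁ := h.smooth₁.congr h₁
  smooth₂ := h.smooth₂.congr h₂
  unitary q hq a b := by rw [dForm_congr h.isOpen h₁ hq, h₂ hq, h.unitary q hq]
  inj q hq a := by rw [h₁ hq, h₂ hq]; exact h.inj q hq a

theorem pullForm_heisInvSymm (h : IsCoframe ϑ η U) (hU' : IsOpen U') (h0 : ∀ q ∈ U', q ≠ 0)
    (hm : MapsTo heisInvSymm U' U) :
    IsCoframe (_root_.pullForm heisInvSymm ϑ) (_root_.pullForm heisInvSymm η) U' :=
  h.pullForm hU' (fun q hq => (contDiffAt_heisInvSymm (h0 q hq)).contDiffWithinAt) hm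
    fun q hq _ => fderiv_heisInvSymm_injective (h0 q hq)

/-- The contact form and coframe of the blow-up in the inverted coordinates form a unitary coframe. -/
theorem inverted (h : IsCoframe ϑ η U) {u : Heis → ℝ} (hu : ContDiffOn ℝ ∞ u U)
    (hu0 : ∀ q ∈ U, u q ≠ 0) (hU' : IsOpen U') (h0 : ∀ q ∈ U', q ≠ 0)
    (hm : MapsTo heisInvSymm U' U) :
    IsCoframe (invertedForm u ϑ) (invertedCoframe u ϑ η) U' :=
  ((h.scaled hu hu0).pullForm_heisInvSymm hU' h0 hm).rotate
    (fun q hq => (fderiv_unitaryFactor (h0 q hq)).1.contDiffWithinAt)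
    fun q hq => norm_unitaryFactor (h0 q hq)

/-- The two-form `ω₁¹ ∧ θ` of the blow-up in the inverted coordinates. -/
theorem connPot_inverted (h : IsCoframe ϑ η U) {u : Heis → ℝ} (hu : ContDiffOn ℝ ∞ u U)
    (hu0 : ∀ q ∈ U, u q ≠ 0) (hU' : IsOpen U') (h0 : ∀ q ∈ U', q ≠ 0)
    (hm : MapsTo heisInvSymm U' U) {q : Heis} (hq : q ∈ U') (a b : Heis) :
    wedge (imagForm (connPot (invertedForm u ϑ) (invertedCoframe u ϑ η)) q)
      (toC (invertedForm u ϑ q)) a b =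
    I * (((fun x => connPot ϑ η x - (3 / u x) • rotGrad ϑ η u x + (3 : ℝ) • argForm x) (heisInvSymm q)
        (fderiv ℝ heisInvSymm q a) * scaledForm u ϑ (heisInvSymm q) (fderiv ℝ heisInvSymm q b)
      - (fun x => connPot ϑ η x - (3 / u x) • rotGrad ϑ η u x + (3 : ℝ) • argForm x) (heisInvSymm q)
        (fderiv ℝ heisInvSymm q b) * scaledForm u ϑ (heisInvSymm q) (fderiv ℝ heisInvSymm q a) : ℝ)
          : ℂ) := by
  have hFq := hm hq
  have hq0 := h0 q hq
  have hS := h.scaled hu hu0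
  have hP := hS.pullForm_heisInvSymm hU' h0 hm
  have hI := h.inverted hu hu0 hU' h0 hm
  obtain ⟨g1, g2⟩ := fderiv_unitaryFactor hq0
  have m1 := h.isConnMod_scaled hu hFq (hu0 _ hFq) (h.isConnMod_connPot hFq)
  have m2 := hS.isConnMod_pullForm (contDiffAt_heisInvSymm hq0) hFq m1
  have m3 := hP.isConnMod_rotate hq (g1.differentiableAt (by simp)) g2 m2
  have e := hI.isConnMod_unique hq (hI.isConnMod_connPot hq) m3 a b
  have e1 : ∀ c, invertedForm u ϑ q c
      = scaledForm u ϑ (heisInvSymm q) (fderiv ℝ heisInvSymm q c) := fun c => rfl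
  rw [e1, e1] at e
  simp only [wedge, imagForm_apply, toC, e1]
  have hs : ∀ z w x y : ℝ, I * (z : ℂ) * (w : ℂ) - I * (x : ℂ) * (y : ℂ)
      = I * ((z * w - x * y : ℝ) : ℂ) := by intros; push_cast; ring
  rw [hs, e]
  simp only [sub_apply, add_apply, smul_apply, ContinuousLinearMap.comp_apply,
    argForm_heisInvSymm hq0, smul_eq_mul]
  congr 2
  ring

end IsCoframe

theorem isConnectionForm_congr {ϑ ϑ' : Heis → Heis →L[ℝ] ℝ} {η η' ω₁ : Heis → Heis →L[ℝ] ℂ}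
    {U : Set Heis} (h : IsConnectionForm ϑ η U ω₁) (hU : IsOpen U) (h₁ : EqOn ϑ' ϑ U)
    (h₂ : EqOn η' η U) : IsConnectionForm ϑ' η' U ω₁ where
  smooth := h.smooth
  imaginary := h.imaginary
  structure_eq := by
    obtain ⟨a, ha⟩ := h.structure_eq
    refine ⟨a, fun q hq v w => ?_⟩
    rw [dForm_congr hU h₂ hq, h₁ hq, h₂ hq, ha q hq]

/-- The integral of `ω₁¹ ∧ θ` over a large sphere, as the flux of a field near the centre. -/
theorem IsCoframe.sphereIntegral_inverted {ϑ : Heis → Heis →L[ℝ] ℝ} {η : Heis → Heis →L[ℝ] ℂ}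
    {U U' : Set Heis} (h : IsCoframe ϑ η U) {u : Heis → ℝ} (hu : ContDiffOn ℝ ∞ u U)
    (hu0 : ∀ q ∈ U, u q ≠ 0) (hU0 : (0 : Heis) ∉ U) (hU' : IsOpen U') (h0 : ∀ q ∈ U', q ≠ 0)
    (hm : MapsTo heisInvSymm U' U) {Λ : ℝ} (hΛ : 0 < Λ) (hΛU' : ∀ q, heisNorm q = Λ → q ∈ U')
    (hΛU : ∀ q, heisNorm q = Λ⁻¹ → q ∈ U) {W : Heis → Heis → Heis → ℂ}
    (hW : ∀ q ∈ U', W q = wedge (imagForm (connPot (invertedForm u ϑ) (invertedCoframe u ϑ η)) q)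
      (toC (invertedForm u ϑ q))) :
    I * sphereIntegral W Λ = (flux (fun q => cross (connPot ϑ η q - (3 / u q) • rotGrad ϑ η u q
      + (3 : ℝ) • argForm q) (scaledForm u ϑ q)) Λ⁻¹ : ℝ) := by
  have hl : ContinuousOn (fun q => connPot ϑ η q - (3 / u q) • rotGrad ϑ η u q
      + (3 : ℝ) • argForm q) U :=
    (h.contDiffOn_connPot.continuousOn.sub ((continuousOn_const.div hu.continuousOn hu0).smul
      (h.contDiffOn_rotGrad hu).continuousOn)).add ((continuousOn_argForm hU0).const_smul (3 : ℝ))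
  have hmc : ContinuousOn (scaledForm u ϑ) U := (h.scaled hu hu0).smooth₁.continuousOn
  exact sphereIntegral_heisInvSymm hΛ
    (fun q hq => hl.continuousAt (h.isOpen.mem_nhds (hΛU q hq)))
    (fun q hq => hmc.continuousAt (h.isOpen.mem_nhds (hΛU q hq)))
    fun q hq a b => by
      rw [hW q (hΛU' q hq)]
      exact h.connPot_inverted hu hu0 hU' h0 hm (hΛU' q hq) a b

section

variable {M : Type*} [TopologicalSpace M] [ChartedSpace Heis M] {C : CRStructure M}
  {θ : OneForm M ℝ} {κ : Heis → M} {V : Set Heis} {η : Heis → Heis →L[ℝ] ℂ}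

theorem dParam_comp_heisInvSymm (hκ : IsParam κ V) {q : Heis} (hq : q ≠ 0)
    (hV : heisInvSymm q ∈ V) :
    dParam (κ ∘ heisInvSymm) q = (dParam κ (heisInvSymm q)).comp (fderiv ℝ heisInvSymm q) := by
  have h1 := (hκ.smooth.contMDiffAt (hκ.isOpen.mem_nhds hV)).mdifferentiableAt (by simp)
  have h2 := ((contDiffAt_heisInvSymm hq).differentiableAt (by simp)).mdifferentiableAt
  rw [dParam, mfderiv_comp q h1 h2, mfderiv_eq_fderiv]
  rfl

theorem IsParam.comp_heisInvSymm (hκ : IsParam κ V) {V' : Set Heis} (hV' : IsOpen V')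
    (h0 : ∀ q ∈ V', q ≠ 0) (hm : MapsTo heisInvSymm V' V) : IsParam (κ ∘ heisInvSymm) V' where
  isOpen := hV'
  injOn := hκ.injOn.comp (fun q hq q' hq' e => by
    rw [← (heisInv_heisInvSymm q (h0 q hq)).1, e, (heisInv_heisInvSymm q' (h0 q' hq')).1]) hm
  smooth := hκ.smooth.comp (contMDiffOn_iff_contDiffOn.2 fun q hq =>
    (contDiffAt_heisInvSymm (h0 q hq)).contDiffWithinAt) hm
  bijective q hq := by
    rw [dParam_comp_heisInvSymm hκ (h0 q hq) (hm hq)]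
    have hi : Function.Injective (fderiv ℝ heisInvSymm q) :=
      (injective_iff_map_eq_zero _).2 fun a => fderiv_heisInvSymm_injective (h0 q hq)
    exact (hκ.bijective _ (hm hq)).comp
      ⟨hi, LinearMap.injective_iff_surjective (f := (fderiv ℝ heisInvSymm q).toLinearMap).1 hi⟩

/-- A positive multiple of a contact form is a contact form. -/
theorem isContactForm_blowupForm {p : M} {G : M → ℝ} (hθ : C.IsContactForm θ univ)
    (hG : ContMDiffOn 𝓘(ℝ, Heis) 𝓘(ℝ, ℝ) ∞ G {p}ᶜ) {S : Set M} (hp : ∀ x ∈ S, x ≠ p)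
    (h0 : ∀ x ∈ S, 0 < G x) : C.IsContactForm (blowupForm G θ) S := by
  have hpi := Real.pi_pos
  have hf : ∀ (κ : Heis → M) (V : Set Heis), IsParam κ V → κ '' V ⊆ S →
      ContDiffOn ℝ ∞ (fun q => (2 * Real.pi * G (κ q)) ^ 2) V := fun κ V hκ hV =>
    (contDiffOn_const.mul (contDiffOn_green hG hκ Subset.rfl
      fun q hq => hp _ (hV (mem_image_of_mem κ hq)))).pow 2
  refine ⟨fun κ V hκ hV => (hf κ V hκ hV).smul (hθ.smooth κ V hκ (subset_univ _)),
    fun x hx v => ?_, fun κ V hκ hV q hq a b ha hξ hJ => ?_⟩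
  · have := (h0 x hx).ne'
    rw [hθ.mem_ξ_iff x (mem_univ _)]
    simp [blowupForm, this, hpi.ne']
  · have hn := hκ.isOpen.mem_nhds hq
    have d1 := ((hf κ V hκ hV).contDiffAt hn).differentiableAt (by simp)
    have d2 := ((hθ.smooth κ V hκ (subset_univ _)).contDiffAt hn).differentiableAt (by simp)
    have ha0 : pull κ θ q a = 0 := (hθ.mem_ξ_iff _ (mem_univ _) _).1 hξ
    have hb0 : pull κ θ q b = 0 :=
      (hθ.mem_ξ_iff _ (mem_univ _) (dParam κ q b)).1 (hJ ▸ C.J_mem _ _ hξ)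
    have e : dForm (pull κ (blowupForm G θ)) q a b = _ := dForm_smul d1 d2 a b
    rw [e, ha0, hb0]
    have := h0 _ (hV (mem_image_of_mem κ hq))
    have := hθ.pos κ V hκ (subset_univ _) q hq a b ha hξ hJ
    simp only [mul_zero, sub_zero, zero_add]
    positivity

/-- The contact form of the blow-up in the inverted coordinates. -/
theorem pull_blowupForm (G : M → ℝ) (hκ : IsParam κ V) {V' : Set Heis} (h0 : ∀ q ∈ V', q ≠ 0)
    (hm : MapsTo heisInvSymm V' V) :
    EqOn (pull (κ ∘ heisInvSymm) (blowupForm G θ))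
      (invertedForm (fun q => 2 * Real.pi * G (κ q)) (pull κ θ)) V' := by
  intro q hq
  rw [pull, dParam_comp_heisInvSymm hκ (h0 q hq) (hm hq)]
  rfl

/-- The coframe of the blow-up in the inverted coordinates. -/
theorem blowupCoframe_eq {G : M → ℝ} {V' U : Set Heis} (hU : IsOpen U)
    (hG : ContDiffOn ℝ ∞ (fun q => G (κ q)) U) (hm : MapsTo heisInvSymm V' U) :
    EqOn (blowupCoframe G θ κ η)
      (invertedCoframe (fun q => 2 * Real.pi * G (κ q)) (pull κ θ) η) V' := by
  intro q hq
  have hd := ((hG.contDiffAt (hU.mem_nhds (hm hq))).differentiableAt (by simp)).hasFDerivAt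
  have h1 : HasFDerivAt (fun q' => (G (κ q') : ℂ)) _ (heisInvSymm q) :=
    ofRealCLM.hasFDerivAt.comp (heisInvSymm q) hd
  have h2 := hd.const_mul (2 * Real.pi)
  have e : blowupCoframe₀ G θ κ η (heisInvSymm q)
      = scaledCoframe (fun q => 2 * Real.pi * G (κ q)) (pull κ θ) η (heisInvSymm q) := by
    refine ContinuousLinearMap.ext fun a => ?_
    simp only [blowupCoframe₀, scaledCoframe, derivZbar, onZbar, h1.fderiv, h2.fderiv, add_apply,
      smul_apply, ContinuousLinearMap.comp_apply, ofRealCLM_apply, smul_eq_mul]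
    change _ = _ + (I * ((2 * Real.pi * fderiv ℝ (fun q => G (κ q)) (heisInvSymm q)
      (dualFrame (pull κ θ) η (heisInvSymm q) (0, 1)) : ℝ) : ℂ)
      - ((2 * Real.pi * fderiv ℝ (fun q => G (κ q)) (heisInvSymm q)
      (dualFrame (pull κ θ) η (heisInvSymm q) (0, I)) : ℝ) : ℂ)) * _
    push_cast
    linear_combination (2 * Real.pi * (fderiv ℝ (fun q => G (κ q)) (heisInvSymm q)
      (dualFrame (pull κ θ) η (heisInvSymm q) (0, I)) : ℝ) * (pull κ θ (heisInvSymm q) a : ℝ))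
      * I_mul_I
  rw [blowupCoframe, e]
  rfl

/-- The inverted coframe has type `(1,0)`: on `ξ` it is a complex multiple of `η`. -/
theorem isUnitaryCoframe_blowupCoframe {u : Heis → ℝ} (hκ : IsParam κ V)
    (hθ : C.IsContactForm θ univ) (hη : C.IsUnitaryCoframe θ κ V η) {V' : Set Heis}
    {θ' : OneForm M ℝ} {η' : Heis → Heis →L[ℝ] ℂ}
    (h0 : ∀ q ∈ V', q ≠ 0) (hm : MapsTo heisInvSymm V' V)
    (hI : IsCoframe (pull (κ ∘ heisInvSymm) θ') η' V')
    (he : EqOn η' (invertedCoframe u (pull κ θ) η) V') :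
    C.IsUnitaryCoframe θ' (κ ∘ heisInvSymm) V' η' where
  smooth := hI.smooth₂
  type_one_zero q hq a b ha hb := by
    rw [dParam_comp_heisInvSymm hκ (h0 q hq) (hm hq)] at ha hb
    have t := hη.type_one_zero _ (hm hq) (fderiv ℝ heisInvSymm q a) (fderiv ℝ heisInvSymm q b) ha hb
    have ha0 : pull κ θ (heisInvSymm q) (fderiv ℝ heisInvSymm q a) = 0 :=
      (hθ.mem_ξ_iff _ (mem_univ _) _).1 ha
    have hb0 : pull κ θ (heisInvSymm q) (fderiv ℝ heisInvSymm q b) = 0 :=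
      (hθ.mem_ξ_iff _ (mem_univ _) (dParam κ (heisInvSymm q) (fderiv ℝ heisInvSymm q b))).1
        (by
          have := C.J_mem _ _ ha
          rw [ContinuousLinearMap.comp_apply] at hb
          rw [hb]; exact this)
    rw [he hq]
    simp [invertedCoframe, pullForm, scaledCoframe, ha0, hb0, t]
    ring
  unitary q hq a b := by
    rw [hI.unitary q hq]
    apply Complex.ext <;> simp [wedge, conjForm] <;> ring

end

end

theorem lemma2p5 {M : Type*} [TopologicalSpace M] [T2Space M] [CompactSpace M]
    [ChartedSpace Heis M] [IsManifold 𝓘(ℝ, Heis) ∞ M] [MeasurableSpace M] [BorelSpace M]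
    (C : CRStructure M) (hY : 0 < C.yamabeInvariant)
    (θ : OneForm M ℝ) (hθ : C.IsContactForm θ univ)
    (R : M → ℝ) (hR : C.IsWebsterCurvature θ R)
    (p : M) (κ : Heis → M) (V : Set Heis) (η : Heis → Heis →L[ℝ] ℂ)
    (hκ : C.IsCRNormal θ p κ V η)
    (G : M → ℝ) (hG : C.IsGreenFunction θ R p G)
    (A : ℝ)
    (hA : (fun q => G (κ q) - (1 / (2 * Real.pi * heisNorm q ^ 2) + A)) =O[𝓝[≠] 0] heisNorm) :
    C.HasPMass (blowupForm G θ) (κ ∘ heisInvSymm)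
      (blowupCoframe G θ κ η) (48 * Real.pi ^ 2 * A) := by
  have hN := isNormalCoframe_of_isCRNormal hθ hκ
  have hpi := Real.pi_pos
  -- a ball on which the contact form induces the right orientation
  obtain ⟨ε, hε, hεB⟩ := exists_heisNorm_lt_of_mem_nhds
    (inter_mem hN.mem_nhds hN.eventually_contactDensity_pos)
  have hball : ∀ s, IsOpen {q : Heis | heisNorm q < s} :=
    fun s => isOpen_lt continuous_heisNorm continuous_const
  have hpole₀ := hasPoleExpansion_green hθ hR hκ hG hA (hball ε) (fun q hq => (hεB q hq).1)
    (by simpa [heisNorm_zero] using hε) fun q hq => (hεB q hq).2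
  -- a smaller ball, on which the Green's function is also positive
  have hpos := eventually_nhdsWithin_iff.1 (eventually_pole_pos hpole₀.expansion)
  obtain ⟨δ, hδ, hδB⟩ := exists_heisNorm_lt_of_mem_nhds
    (inter_mem (inter_mem hN.mem_nhds hN.eventually_contactDensity_pos) hpos)
  set B : Set Heis := {q | heisNorm q < δ} with hBdef
  have hBV : B ⊆ V := fun q hq => (hδB q hq).1.1
  have h0B : (0 : Heis) ∈ B := by simpa [hBdef, heisNorm_zero] using hδ
  have hc : ∀ q ∈ B, 0 < contactDensity (pull κ θ) q := fun q hq => (hδB q hq).1.2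
  have hB := hN.mono (hball δ) hBV h0B
  have hpole := hasPoleExpansion_green hθ hR hκ hG hA (hball δ) hBV h0B hc
  set u : Heis → ℝ := fun q => 2 * Real.pi * G (κ q) with hu
  have hupos : ∀ q ∈ B \ {0}, 0 < u q := fun q hq => (hδB q hq.1).2 hq.2
  have hP := hB.punctured
  have hne : ∀ q ∈ B \ {0}, κ q ≠ p := fun q hq =>
    param_ne_center hκ.isParam hκ.zero_mem hκ.map_zero ⟨hBV hq.1, hq.2⟩
  have hg : ContDiffOn ℝ ∞ (fun q => G (κ q)) (B \ {0}) :=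
    contDiffOn_green hG.smooth hκ.isParam (sdiff_subset.trans hBV) hne
  have hu0 : ∀ q ∈ B \ {0}, u q ≠ 0 := fun q hq => (hupos q hq).ne'
  set V' : Set Heis := {q | δ⁻¹ < heisNorm q} with hV'def
  have hV' : IsOpen V' := isOpen_lt continuous_const continuous_heisNorm
  have h0 : ∀ q ∈ V', q ≠ 0 := fun q hq =>
    ne_zero_of_heisNorm_pos ((inv_pos.2 hδ).trans hq)
  have hm : MapsTo heisInvSymm V' (B \ {0}) := fun q hq => by
    refine ⟨?_, heisInvSymm_ne_zero (h0 q hq)⟩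
    change heisNorm _ < δ
    rw [heisNorm_heisInvSymm (h0 q hq)]
    exact inv_lt_of_inv_lt₀ hδ hq
  have hmV : MapsTo heisInvSymm V' V := fun q hq => hBV (hm hq).1
  have e₁ := pull_blowupForm (θ := θ) G hκ.isParam h0 hmV
  have e₂ := blowupCoframe_eq (θ := θ) (η := η) hP.isOpen hg hm
  have hI := hP.inverted hpole.smooth hu0 hV' h0 hm
  refine ⟨δ⁻¹, V', rfl, hκ.isParam.comp_heisInvSymm hV' h0 hmV,
    isContactForm_blowupForm hθ hG.smooth ?_ ?_,
    isUnitaryCoframe_blowupCoframe hκ.isParam hθ hκ.coframe h0 hmV (hI.congr e₁ e₂) e₂,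
    _, isConnectionForm_congr hI.isConnectionForm hV' e₁ e₂, ?_⟩
  · rintro _ ⟨q, hq, rfl⟩
    exact hne _ (hm hq)
  · rintro _ ⟨q, hq, rfl⟩
    exact pos_of_mul_pos_right (hupos _ (hm hq)) (by positivity)
  · have hlim := ((continuous_ofReal.tendsto _).comp (hpole.flux_tendsto hB hc)).comp
      tendsto_inv_atTop_nhdsGT_zero
    have hval : ((24 * Real.pi * (2 * Real.pi * A) : ℝ) : ℂ) = ((48 * Real.pi ^ 2 * A : ℝ) : ℂ) := by
      push_cast; ring
    rw [hval] at hlim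
    refine hlim.congr' ?_
    filter_upwards [eventually_gt_atTop δ⁻¹] with Λ hΛ
    have hΛ0 : 0 < Λ := (inv_pos.2 hδ).trans hΛ
    refine (hP.sphereIntegral_inverted hpole.smooth hu0 (by simp) hV' h0 hm hΛ0
      (fun q hq => ?_) (fun q hq => ⟨?_, ?_⟩) fun q hq => ?_).symm
    · change δ⁻¹ < heisNorm q
      rwa [hq]
    · change heisNorm q < δ
      rw [hq]
      exact inv_lt_of_inv_lt₀ hδ hΛ
    · exact ne_zero_of_heisNorm_pos (hq ▸ inv_pos.2 hΛ0)
    · rw [e₁ hq]
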